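/- **Setting.** Let $\mathcal M$ be a model of ZFC (for instance any model of ZF + $V=L$); its elements are called individuals, and "set", "function", $\mathbb N$, $(x,y)$, $0=\emptyset$, $1=\{0\}$, $2=\{0,1\}$ are understood in $\mathcal M$. A *realizability algebra* $\mathcal A$ in $\mathcal M$ consists of sets $\Lambda$ (terms), $\Pi$ (stacks), $\Lambda\star\Pi$ (processes), functions $(\xi,\eta)\mapsto\xi\eta$ from $\Lambda^2$ to $\Lambda$, $(\xi,\pi)\mapsto\xi\cdot\pi$ from $\Lambda\times\Pi$ to $\Pi$, $(\xi,\pi)\mapsto\xi\star\pi$ from $\Lambda\times\Pi$ to $\Lambda\star\Pi$, $\pi\mapsto k_\pi$ from $\Pi$ to $\Lambda$, all in $\mathcal M$, elements $B,C,I,K,W,cc$ of $\Lambda$, a set $QP\subset\Lambda$ of *proof-like* terms that contains these six elements and is closed under application, and a set $\bot\!\!\!\bot\subset\Lambda\star\Pi$ such that $p\succ q$ and $q\in\bot\!\!\!\bot$ imply $p\in\bot\!\!\!\bot$. Here $\succ$ is the least preorder on $\Lambda\star\Pi$ with $\xi\eta\star\pi\succ\xi\star\eta\cdot\pi$; $I\star\xi\cdot\pi\succ\xi\star\pi$;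 $K\star\xi\cdot\eta\cdot\pi\succ\xi\star\pi$; $W\star\xi\cdot\eta\cdot\pi\succ\xi\star\eta\cdot\eta\cdot\pi$; $C\star\xi\cdot\eta\cdot\zeta\cdot\pi\succ\xi\star\zeta\cdot\eta\cdot\pi$; $B\star\xi\cdot\eta\cdot\zeta\cdot\pi\succ\xi\star(\eta\zeta)\cdot\pi$; $cc\star\xi\cdot\pi\succ\xi\star k_\pi\cdot\pi$; $k_\pi\star\xi\cdot\varpi\succ\xi\star\pi$. $\mathcal A$ is *coherent* if for every $\theta\in QP$ there is $\pi\in\Pi$ with $\theta\star\pi\notin\bot\!\!\!\bot$. Formulas with parameters in $\mathcal M$ are built with $\bot,\to,\forall$ from the atomic formulas $a\not\mathrel\varepsilon b$. A closed formula $F$ has a value $\|F\|\subset\Pi$, and $\xi\Vdash F$ means $\xi\star\pi\in\bot\!\!\!\bot$ for all $\pi\in\|F\|$: $\|\bot\|=\Pi$; $\|a\not\mathrel\varepsilon b\|=\{\pi\in\Pi:(a,\pi)\in b\}$; $\|F\to G\|=\{\xi\cdot\pi:\xi\Vdash F,\ \pi\in\|G\|\}$; $\|\forall x\,F(x)\|=\bigcup_{a\in\mathcal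 M}\|F(a)\|$. Other connectives are defined classically ($\neg F$ is $F\to\bot$, etc.), $a\mathrel\varepsilon b$ is $\neg(a\not\mathrel\varepsilon b)$, and $a=b$ is Leibniz equality $\forall z(a\not\mathrel\varepsilon z\to b\not\mathrel\varepsilon z)$. Functions defined on $\mathcal M$ are used as function symbols. $F$ is *realized* if $\theta\Vdash F$ for some $\theta\in QP$. For a set $X$ let $\gimel X=X\times\Pi$. The Boolean operations $\wedge,\vee$ of $2$ (extended arbitrarily to $\mathcal M$) make $\gimel 2$ a Boolean algebra in the realizability model; $i\le j$ means $i\wedge j=i$. With $\underline 0=KI$, $\sigma=(BW)(BB)$, $\underline{n+1}=\sigma\,\underline n$, the set of integers of the realizability model is $\mathbb N_{\mathcal A}=\{(n,\underline n\cdot\pi):n\in\mathbb N,\ \pi\in\Pi\}$. In the formula below, countable means being the image of a map defined on $\mathbb N_{\mathcal A}$, and $\mathbb R$ is $\mathcal P(\mathbb N_{\mathcal A})$: a real is an individual whose $\varepsilon$-elements are $\varepsilon$-elements of $\mathbb N_{\mathcal A}$, two such being the same real if they have the same $\varepsilon$-elements; a subset of $\mathbb R$ is represented by an individual whose $\varepsilon$-elements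 are reals, up to having the same reals as elements. $\gimel 2$, $\gimel\kappa$ and $\mathbb N_{\mathcal A}$ are considered as sets of $\varepsilon$-elements with Leibniz equality. Maps are relations given by individuals that are compatible with these equalities, and $X\oplus Y$ is the disjoint union. **Theorem.** Let $\mathcal A$ be a coherent realizability algebra in $\mathcal M$ and let $\kappa$ be the cardinal, in $\mathcal M$, of $\Lambda\cup\Pi\cup\mathbb N$. Then the following formula is realized: if $\gimel\kappa$ is countable, then $\gimel 2$ is countable and there is a map $i\mapsto X_i$ from the Boolean algebra $\gimel 2$ into $\mathcal P(\mathbb R)$ such that, for all $i,j\mathrel\varepsilon\gimel 2$: 1. $X_0=\{\emptyset\}$; and if $i\ne0$, then there is an injection from $\mathbb N_{\mathcal A}$ into $X_i$ and $X_i$ is not countable; 2. $X_i\times X_i$ is equipotent with $X_i$; 3. $X_i\cap X_j=X_{i\wedge j}$, and therefore $X_i\subset X_j$ if $i\le j$; 4. if $i\wedge j=0$, then $X_{i\vee j}$ is equipotent with $X_i\times X_j$; 5. there is a surjection from $X_1$ onto $\mathbb R$; 6. if $J$ is a subset of $\gimel 2$ and there is a surjection from $\bigcup_{j\mathrel\varepsilon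 J}X_j$ onto $X_i$, then $i\le j$ for some $j\mathrel\varepsilon J$; 7. if there is a surjection from $X_j$ onto $X_i$, then $i\le j$; 8. if $i\ne0$, $j\ne0$ and $i\wedge j=0$, then there is no surjection from $X_i\oplus X_j$ onto $X_i\times X_j$. -/

import Mathlib

universe u

/-! ### The ground model: first-order models of ZFC -/

/-- The single binary relation symbol (membership) of the language of set theory. -/
inductive MemSymbol : ℕ → Type
  | mem : MemSymbol 2

/-- The first-order language of set theory. -/
def langSet : FirstOrder.Language := ⟨fun _ => Empty, MemSymbol⟩

namespace GroundModel

section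
variable {M : Type u} [langSet.Structure M]

/-- The membership relation of the structure `M`. -/
def memM (x y : M) : Prop :=
  FirstOrder.Language.Structure.RelMap (L := langSet) MemSymbol.mem ![x, y]

infix:50 " ∈ₘ " => memM

/-- The elements, in the sense of `M`, of the individual `a`. -/
abbrev El (a : M) : Type u := {x : M // x ∈ₘ a}

end

/-- `M` is a model of ZFC. The schemes range over all classes of `M` that are first-order definable
in the language of set theory with parameters from `M`. -/
structure IsModelZFC (M : Type u) [langSet.Structure M] : Prop where
  extensionality : ∀ a b : M, (∀ x, x ∈ₘ a ↔ x ∈ₘ b) → a = b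
  foundation : ∀ a : M, (∃ x, x ∈ₘ a) → ∃ x, x ∈ₘ a ∧ ∀ y, y ∈ₘ a → ¬ y ∈ₘ x
  pairing : ∀ a b : M, ∃ c, ∀ x, x ∈ₘ c ↔ x = a ∨ x = b
  union : ∀ a : M, ∃ b, ∀ x, x ∈ₘ b ↔ ∃ y, y ∈ₘ a ∧ x ∈ₘ y
  powerset : ∀ a : M, ∃ b, ∀ x, x ∈ₘ b ↔ ∀ z, z ∈ₘ x → z ∈ₘ a
  infinity : ∃ a : M, (∃ e, e ∈ₘ a ∧ ∀ z, ¬ z ∈ₘ e) ∧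
    ∀ x, x ∈ₘ a → ∃ s, s ∈ₘ a ∧ ∀ z, z ∈ₘ s ↔ z ∈ₘ x ∨ z = x
  separation : ∀ S : Set M, Set.Definable₁ Set.univ langSet S →
    ∀ a : M, ∃ b, ∀ x, x ∈ₘ b ↔ x ∈ₘ a ∧ x ∈ S
  replacement : ∀ R : Set (M × M), Set.Definable₂ Set.univ langSet R →
    ∀ a : M, (∀ x, x ∈ₘ a → ∀ y z, (x, y) ∈ R → (x, z) ∈ R → y = z) →
      ∃ b, ∀ y, y ∈ₘ b ↔ ∃ x, x ∈ₘ a ∧ (x, y) ∈ R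
  choice : ∀ a : M, (∀ x, x ∈ₘ a → ∃ y, y ∈ₘ x) →
    (∀ x y, x ∈ₘ a → y ∈ₘ a → x ≠ y → ∀ z, ¬ (z ∈ₘ x ∧ z ∈ₘ y)) →
      ∃ c, ∀ x, x ∈ₘ a → ∃! z, z ∈ₘ x ∧ z ∈ₘ c

noncomputable section
variable {M : Type u} [langSet.Structure M] [Nonempty M]

/-- The individual `{x | P x}` of `M`. It is only used for classes `P` that are sets in every model
of ZFC, where it is the unique individual whose elements are the `x` with `P x`. -/
def compr (P : M → Prop) : M := Classical.epsilon fun s => ∀ x, x ∈ₘ s ↔ P x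

/-- The unordered pair `{x, y}` in `M`. -/
def upair (x y : M) : M := compr fun z => z = x ∨ z = y

/-- The ordered pair `(x, y)` in `M`. -/
def pair (x y : M) : M := upair (upair x x) (upair x y)

variable (M) in
/-- `0 = ∅`. -/
def zero : M := compr fun _ => False

/-- `x ∪ {x}`. -/
def succ (x : M) : M := compr fun z => z ∈ₘ x ∨ z = x

variable (M) in
/-- `1 = {0}`. -/
def one : M := succ (zero M)

variable (M) in
/-- `2 = {0, 1}`. -/
def two : M := succ (one M)

variable (M) in
/-- The set `ℕ` of the model `M`: the least inductive set. -/
def omega : M := compr fun n => ∀ a : M, zero M ∈ₘ a → (∀ x, x ∈ₘ a → succ x ∈ₘ a) → n ∈ₘ a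

/-- `M` contains a bijection from `a` onto `b`. -/
def Equipotent (a b : M) : Prop :=
  ∃ g : M, (∀ x, x ∈ₘ a → ∃! y, y ∈ₘ b ∧ pair x y ∈ₘ g) ∧
    (∀ y, y ∈ₘ b → ∃! x, x ∈ₘ a ∧ pair x y ∈ₘ g)

/-- `a` is a von Neumann ordinal of `M` (in the presence of foundation). -/
def IsOrdinal (a : M) : Prop :=
  (∀ x, x ∈ₘ a → ∀ y, y ∈ₘ x → y ∈ₘ a) ∧
    ∀ x, x ∈ₘ a → ∀ y, y ∈ₘ x → ∀ z, z ∈ₘ y → z ∈ₘ x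

/-- In `M`, `k` is the cardinal of `a`: the least ordinal equipotent with `a`. -/
def IsCardinalOf (k a : M) : Prop :=
  IsOrdinal k ∧ Equipotent k a ∧ ∀ x, x ∈ₘ k → ¬ Equipotent x a

/-- Extension to `M` of the Boolean operation `∧` of `{0, 1}`. -/
def meet (i j : M) : M :=
  open scoped Classical in if i = one M ∧ j = one M then one M else zero M

/-- Extension to `M` of the Boolean operation `∨` of `{0, 1}`. -/
def join (i j : M) : M :=
  open scoped Classical in if i = one M ∨ j = one M then one M else zero M

end

end GroundModel

open GroundModel

/-! ### Realizability algebras -/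

/-- Three sets of the ground model (terms, stacks, processes) with the operations and the
distinguished terms of a realizability algebra. The operations belong to `M`: their graphs are
individuals of `M`. -/
structure AlgebraData (M : Type u) [langSet.Structure M] [Nonempty M] where
  Lam : M
  Stk : M
  Proc : M
  app : El Lam → El Lam → El Lam
  push : El Lam → El Stk → El Stk
  star : El Lam → El Stk → El Proc
  cont : El Stk → El Lam
  cB : El Lam
  cC : El Lam
  cI : El Lam
  cK : El Lam
  cW : El Lam
  cc : El Lam
  app_internal : ∃ g : M, ∀ x y z, pair (pair x.1 y.1) z.1 ∈ₘ g ↔ app x y = z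
  push_internal : ∃ g : M, ∀ x p q, pair (pair x.1 p.1) q.1 ∈ₘ g ↔ push x p = q
  star_internal : ∃ g : M, ∀ x p q, pair (pair x.1 p.1) q.1 ∈ₘ g ↔ star x p = q
  cont_internal : ∃ g : M, ∀ p x, pair p.1 x.1 ∈ₘ g ↔ cont p = x

section
variable {M : Type u} [langSet.Structure M] [Nonempty M]

/-- One step of execution of processes. -/
inductive AlgebraData.Step (A : AlgebraData M) : El A.Proc → El A.Proc → Prop
  | app (x y p) : Step A (A.star (A.app x y) p) (A.star x (A.push y p))
  | cI (x p) : Step A (A.star A.cI (A.push x p)) (A.star x p)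
  | cK (x y p) : Step A (A.star A.cK (A.push x (A.push y p))) (A.star x p)
  | cW (x y p) : Step A (A.star A.cW (A.push x (A.push y p)))
      (A.star x (A.push y (A.push y p)))
  | cC (x y z p) : Step A (A.star A.cC (A.push x (A.push y (A.push z p))))
      (A.star x (A.push z (A.push y p)))
  | cB (x y z p) : Step A (A.star A.cB (A.push x (A.push y (A.push z p))))
      (A.star x (A.push (A.app y z) p))
  | cc (x p) : Step A (A.star A.cc (A.push x p)) (A.star x (A.push (A.cont p) p))
  | cont (x p q) : Step A (A.star (A.cont p) (A.push x q)) (A.star x p)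

/-- Execution: the least preorder that contains the execution steps. -/
def AlgebraData.Exec (A : AlgebraData M) : El A.Proc → El A.Proc → Prop :=
  Relation.ReflTransGen A.Step

end

/-- A realizability algebra in the ground model `M`: moreover, a set of processes (the pole)
closed under anti-execution, and a set of proof-like terms which contains the elementary
combinators and is closed under application. -/
structure RealizabilityAlgebra (M : Type u) [langSet.Structure M] [Nonempty M] extends
    AlgebraData M where
  pole : M
  pole_subset : ∀ p, p ∈ₘ pole → p ∈ₘ Proc
  pole_closed : ∀ p q : El Proc, toAlgebraData.Exec p q → q.1 ∈ₘ pole → p.1 ∈ₘ pole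
  QP : M
  QP_subset : ∀ t, t ∈ₘ QP → t ∈ₘ Lam
  QP_cB : cB.1 ∈ₘ QP
  QP_cC : cC.1 ∈ₘ QP
  QP_cI : cI.1 ∈ₘ QP
  QP_cK : cK.1 ∈ₘ QP
  QP_cW : cW.1 ∈ₘ QP
  QP_cc : cc.1 ∈ₘ QP
  QP_app : ∀ t s : El Lam, t.1 ∈ₘ QP → s.1 ∈ₘ QP → (app t s).1 ∈ₘ QP

noncomputable section
variable {M : Type u} [langSet.Structure M] [Nonempty M]

/-- Every proof-like term avoids the pole against some stack. -/
def RealizabilityAlgebra.Coherent (A : RealizabilityAlgebra M) : Prop :=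
  ∀ t : El A.Lam, t.1 ∈ₘ A.QP → ∃ p : El A.Stk, ¬ (A.star t p).1 ∈ₘ A.pole

/-- The set of which `κ` is the cardinal: terms, stacks and integers. -/
def RealizabilityAlgebra.support (A : RealizabilityAlgebra M) : M :=
  compr fun x => x ∈ₘ A.Lam ∨ x ∈ₘ A.Stk ∨ x ∈ₘ omega M

/-! ### The realizability model: truth values of formulas -/

/-- Falsity values: the closed formula `F` with parameters in `M` is identified with its truth
value `‖F‖`, a set of stacks. The connectives below build the value of a formula from the values
of its parts. -/
def TV (A : RealizabilityAlgebra M) : Type u := Set (El A.Stk)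

namespace TV
variable {A : RealizabilityAlgebra M}

/-- The term `t` realizes the formula `F`. -/
def Force (t : El A.Lam) (F : TV A) : Prop :=
  ∀ p : El A.Stk, p ∈ (show Set (El A.Stk) from F) → (A.star t p).1 ∈ₘ A.pole

/-- `⊥`. -/
def bot : TV A := (Set.univ : Set (El A.Stk))

/-- `F → G`. -/
def imp (F G : TV A) : TV A :=
  {q : El A.Stk | ∃ t p, Force t F ∧ p ∈ (show Set (El A.Stk) from G) ∧ q = A.push t p}

/-- `∀ x, F x`, where `x` ranges over all the individuals of `M`. -/
def all (F : M → TV A) : TV A := {p : El A.Stk | ∃ a, p ∈ (show Set (El A.Stk) from F a)}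

/-- The atomic formula "`a` is not a (strong) element of `b`". -/
def neps (a b : M) : TV A := {p : El A.Stk | pair a p.1 ∈ₘ b}

infixr:25 " ⇾ " => imp

/-- `¬ F`. -/
def neg (F : TV A) : TV A := F ⇾ bot

/-- Conjunction. -/
def and (F G : TV A) : TV A := (F ⇾ G ⇾ bot) ⇾ bot

/-- Disjunction. -/
def or (F G : TV A) : TV A := neg F ⇾ neg G ⇾ bot

infixr:35 " ⩓ " => and
infixr:30 " ⩔ " => or

/-- `F ↔ G`. -/
def iff (F G : TV A) : TV A := (F ⇾ G) ⩓ (G ⇾ F)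

/-- `∃ x, F x`. -/
def ex (F : M → TV A) : TV A := neg (all fun x => neg (F x))

/-- Strong membership `a ε b`. -/
def eps (a b : M) : TV A := neg (neps a b)

infix:50 " ε' " => eps

/-- Leibniz equality of individuals. -/
def eq (a b : M) : TV A := all fun z => neps a z ⇾ neps b z

infix:50 " ≐ " => eq

end TV

/-- The formula `F` is realized in the realizability model: it is realized by a proof-like term. -/
def RealizabilityAlgebra.Realizes (A : RealizabilityAlgebra M) (F : TV A) : Prop :=
  ∃ t : El A.Lam, t.1 ∈ₘ A.QP ∧ TV.Force t F

namespace RealizabilityAlgebra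
variable (A : RealizabilityAlgebra M)

/-- The individual `ℷX = X × Π`. -/
def gimel (X : M) : M := compr fun z => ∃ x, x ∈ₘ X ∧ ∃ p : El A.Stk, z = pair x p.1

/-- The combinatory integer `0`, that is `K I`. -/
def num0 : El A.Lam := A.app A.cK A.cI

/-- The combinatory successor `(BW)(BB)`. -/
def sigma : El A.Lam := A.app (A.app A.cB A.cW) (A.app A.cB A.cB)

/-- `t` is the combinatory integer `σⁿ 0` for the integer `n` of `M`: the pair `(n, t)` lies in
every set of `M` that contains `(0, num0)` and is closed under `(k, s) ↦ (k + 1, σ s)`. -/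
def IsNumeral (n : M) (t : El A.Lam) : Prop :=
  ∀ g : M, pair (zero M) A.num0.1 ∈ₘ g →
    (∀ (k : M) (s : El A.Lam), pair k s.1 ∈ₘ g → pair (succ k) (A.app A.sigma s).1 ∈ₘ g) →
      pair n t.1 ∈ₘ g

/-- The set of integers of the realizability model: the pairs `(n, t · π)`, where `n` is an
integer of `M`, `t` is the corresponding combinatory integer and `π` is a stack. -/
def nat : M := compr fun z => ∃ n, n ∈ₘ omega M ∧ ∃ (t : El A.Lam) (p : El A.Stk),
  A.IsNumeral n t ∧ z = pair n (A.push t p).1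

end RealizabilityAlgebra

/-! ### Sets and maps inside the realizability model -/

/-- A set described inside the realizability model: a membership formula and a formula that says
when two individuals represent the same element. -/
structure Cls (A : RealizabilityAlgebra M) where
  mem : M → TV A
  eqv : M → M → TV A

namespace Cls
open TV
variable {A : RealizabilityAlgebra M}

/-- The strong elements of the individual `a`, with Leibniz equality. -/
def ofInd (a : M) : Cls A := ⟨fun x => x ε' a, fun x y => x ≐ y⟩

/-- `∀ x ∈ C, F x`. -/
def all (C : Cls A) (F : M → TV A) : TV A := TV.all fun x => C.mem x ⇾ F x

/-- `∃ x ∈ C, F x`. -/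
def ex (C : Cls A) (F : M → TV A) : TV A := TV.ex fun x => C.mem x ⩓ F x

/-- Cartesian product. -/
def prod (C D : Cls A) : Cls A where
  mem z := C.ex fun x => D.ex fun y => z ≐ pair x y
  eqv z w := TV.ex fun x => TV.ex fun y => TV.ex fun x' => TV.ex fun y' =>
    z ≐ pair x y ⩓ w ≐ pair x' y' ⩓ C.eqv x x' ⩓ D.eqv y y'

/-- Disjoint union `({0} × C) ∪ ({1} × D)`. -/
def sum (C D : Cls A) : Cls A where
  mem z := (C.ex fun x => z ≐ pair (zero M) x) ⩔ (D.ex fun y => z ≐ pair (one M) y)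
  eqv z w :=
    (TV.ex fun x => TV.ex fun x' =>
      z ≐ pair (zero M) x ⩓ w ≐ pair (zero M) x' ⩓ C.eqv x x') ⩔
    (TV.ex fun y => TV.ex fun y' =>
      z ≐ pair (one M) y ⩓ w ≐ pair (one M) y' ⩓ D.eqv y y')

/-- The relation between elements of `C` and of `D` whose graph is the individual `f`. -/
def rel (C D : Cls A) (f x y : M) : TV A :=
  TV.ex fun x' => TV.ex fun y' => C.eqv x x' ⩓ D.eqv y y' ⩓ pair x' y' ε' f

/-- `f` is a function from `C` to `D`. -/
def isFun (C D : Cls A) (f : M) : TV A :=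
  (C.all fun x => D.ex fun y => C.rel D f x y) ⩓
  (C.all fun x => D.all fun y => D.all fun y' =>
    C.rel D f x y ⇾ C.rel D f x y' ⇾ D.eqv y y')

/-- The values of `f` exhaust `D`. -/
def isOnto (C D : Cls A) (f : M) : TV A := D.all fun y => C.ex fun x => C.rel D f x y

/-- `f` takes different values at different elements of `C`. -/
def isInj (C D : Cls A) (f : M) : TV A :=
  C.all fun x => C.all fun x' => D.all fun y =>
    C.rel D f x y ⇾ C.rel D f x' y ⇾ C.eqv x x'

/-- There is a surjection from `C` onto `D`. -/
def surj (C D : Cls A) : TV A := TV.ex fun f => C.isFun D f ⩓ C.isOnto D f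

/-- There is an injection from `C` into `D`. -/
def inj (C D : Cls A) : TV A := TV.ex fun f => C.isFun D f ⩓ C.isInj D f

/-- `C` and `D` are equipotent. -/
def equip (C D : Cls A) : TV A := TV.ex fun f => C.isFun D f ⩓ C.isInj D f ⩓ C.isOnto D f

/-- There is a surjection from the set of integers onto `C` (`C` is countable, for `C ≠ ∅`). -/
def countable (C : Cls A) : TV A := (ofInd A.nat).surj C

/-- There is an injection from the set of integers into `C`. -/
def infinite (C : Cls A) : TV A := (ofInd A.nat).inj C

variable (A) in
/-- The set `ℝ`, that is `𝒫(ℕ)`: the individuals all of whose strong elements are integers, two of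
them being the same real when they have the same strong elements. -/
def real : Cls A where
  mem x := TV.all fun n => n ε' x ⇾ n ε' A.nat
  eqv x y := TV.all fun n => iff (n ε' x) (n ε' y)

/-- The subset of `ℝ` represented by the individual `S`: the reals equal, as reals, to a strong
element of `S`. -/
def realSubset (S : M) : Cls A where
  mem x := TV.ex fun y => y ε' S ⩓ (real A).eqv y x
  eqv := (real A).eqv

/-- `X` is (the graph of) a map from the strong elements of `a` into `𝒫(ℝ)`, where two subsets of
`ℝ` are equal when they have the same elements. -/
def isFamily (a X : M) : TV A :=
  (ofInd a).all fun i =>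
    (TV.ex fun S => pair i S ε' X) ⩓
    (TV.all fun S => pair i S ε' X ⇾ TV.all fun x => x ε' S ⇾ (real A).mem x) ⩓
    (TV.all fun S => TV.all fun S' => pair i S ε' X ⇾ pair i S' ε' X ⇾
      TV.all fun x => iff ((realSubset S).mem x) ((realSubset S').mem x))

/-- The value `X_i` at `i` of a map `X` into `𝒫(ℝ)`. -/
def valueAt (X i : M) : Cls A where
  mem x := TV.ex fun S => pair i S ε' X ⩓ (realSubset S).mem x
  eqv := (real A).eqv

/-- The union of the sets `X_j` for `j ε J`. -/
def unionOver (X J : M) : Cls A where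
  mem x := TV.ex fun j => j ε' J ⩓ (Cls.valueAt X j).mem x
  eqv := (real A).eqv

end Cls

/-- The order of the Boolean algebra `ℷ2`: `i ∧ j = i`. -/
def TV.le {A : RealizabilityAlgebra M} (i j : M) : TV A := TV.eq (meet i j) i

end

/-! Let `K = ω × support`. For `i` in `ℷ2` and `φ` in `ℷ𝒫(K)`, let `iφ` be `φ` where `i = 1` and `∅`
elsewhere (`sel`). If `ℷκ` is countable, so is `ℷ(K ∪ {0})`: in the ground model `K ∪ {0}` is an
image of `κ × κ`, and integers can be paired (`exists_codes`). Fix such an enumeration `e` and let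
the real `code φ` be the set of those `n` for which "`e(n) ∈ φ`" has a non-zero truth value in `ℷ2`.
Since `e` reaches every element of `ℷ(K ∪ {0})`, the code determines `φ` (`Codes.eqv_iff`). Take
`X_i = {code (iφ)}`. Questions about reals of `X_i` become questions about the sets `iφ`, which are
settled pointwise.

The positive items are then computations. Intersections follow from `i(jφ) = (i ∧ j)φ`. Squares are
handled by cutting `φ ⊆ ω × support` into its even and odd sections. For disjoint `i, j`, elements
of `X_i` and `X_j` are glued into one element of `X_{i ∨ j}`. `X_1` maps onto `ℝ` because every real
has the same elements as some subset of `K`, stacks being in `support`.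

The negative items come from one diagonal argument (`URealized.diagonal`, `exists_le_of_surj`). Let
`F(z, x, v)` say that a map `f` sends the element coded by `(z, x)` to the one coded by `v`. In the
ground model, let `Δ` be the set of pairs `(z, t)` of `K` that belong to no `v` such that `t`
realizes `F(z, 0, v)`. A term that realizes `F(z, 0, Δ)` also realizes `F(z, 0, v)` for some `v ≠
Δ`, which contradicts functionality. Hence `f` can take the value `iΔ` at `(z, jx)` only if `i ≤ j`.
This is why `K` must contain the pairs of an integer and a term. Uncountability is the case `j = 0`.
For item 8, the pairs `(code (iv), code (jv))` are determined by `(i ∨ j)v`, so a surjection from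
`X_i ⊕ X_j` would give `i ∨ j ≤ i` or `i ∨ j ≤ j`.

Almost no realizer is written by hand, thanks to a completeness theorem
(`realizes_of_forall_henkinTheory`): a formula is realized as soon as it holds in every maximal
consistent Henkin theory that contains the uniformly realized families. Formulas become families
indexed by worlds, which assign an individual to each Henkin name. The elements of the two-valued
model are the functions of finitely many coordinates of the world. Equality and membership in `ℷX`
hold when they hold along a filter of worlds (`holds_eq`, `holds_eps_gimel`). Every function of the
ground model, definable or not, thus acts on elements by composition. Definability is needed only to
produce individuals: separation, images, graphs of maps, and `Δ`. -/

set_option autoImplicit false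
set_option linter.unusedSectionVars false

/-! ### Uniform realizability and classical logic -/

section
variable {M : Type u} [langSet.Structure M] [Nonempty M] {A : RealizabilityAlgebra M}

open TV

namespace RealizabilityAlgebra

/-- The process `t ⋆ p` lies in the pole. -/
def Ok (A : RealizabilityAlgebra M) (t : El A.Lam) (p : El A.Stk) : Prop :=
  (A.star t p).1 ∈ₘ A.pole

variable {t s x y z : El A.Lam} {p q : El A.Stk}

theorem Ok.step {c d : El A.Proc} (h : A.Step c d) (hd : d.1 ∈ₘ A.pole) : c.1 ∈ₘ A.pole :=
  A.pole_closed c d (Relation.ReflTransGen.single h) hd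

theorem Ok.app (h : A.Ok x (A.push y p)) : A.Ok (A.app x y) p := Ok.step (.app x y p) h
theorem Ok.cI (h : A.Ok x p) : A.Ok A.cI (A.push x p) := Ok.step (.cI x p) h
theorem Ok.cK (h : A.Ok x p) : A.Ok A.cK (A.push x (A.push y p)) := Ok.step (.cK x y p) h
theorem Ok.cW (h : A.Ok x (A.push y (A.push y p))) : A.Ok A.cW (A.push x (A.push y p)) :=
  Ok.step (.cW x y p) h
theorem Ok.cC (h : A.Ok x (A.push z (A.push y p))) :
    A.Ok A.cC (A.push x (A.push y (A.push z p))) := Ok.step (.cC x y z p) h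
theorem Ok.cB (h : A.Ok x (A.push (A.app y z) p)) :
    A.Ok A.cB (A.push x (A.push y (A.push z p))) := Ok.step (.cB x y z p) h
theorem Ok.cc (h : A.Ok x (A.push (A.cont p) p)) : A.Ok A.cc (A.push x p) := Ok.step (.cc x p) h
theorem Ok.cont (h : A.Ok x p) : A.Ok (A.cont p) (A.push x q) := Ok.step (.cont x p q) h

end RealizabilityAlgebra

open RealizabilityAlgebra

namespace TV

/-- Membership of a stack in a falsity value. -/
def Mem (p : El A.Stk) (F : TV A) : Prop := p ∈ (show Set (El A.Stk) from F)

@[ext] theorem ext {F G : TV A} (h : ∀ p, Mem p F ↔ Mem p G) : F = G := Set.ext h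

theorem mem_all {p : El A.Stk} {F : M → TV A} : Mem p (all F) ↔ ∃ a, Mem p (F a) := Iff.rfl

theorem mem_neps {p : El A.Stk} {a b : M} : Mem p (neps a b) ↔ pair a p.1 ∈ₘ b := Iff.rfl

theorem Force.ok {t : El A.Lam} {F : TV A} (h : Force t F) {p} (hp : Mem p F) : A.Ok t p := h p hp

theorem force_imp {t : El A.Lam} {F G : TV A} :
    Force t (F ⇾ G) ↔ ∀ s p, Force s F → Mem p G → A.Ok t (A.push s p) :=
  ⟨fun h s p hs hp => h _ ⟨s, p, hs, hp, rfl⟩, by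
    rintro h _ ⟨s, p, hs, hp, rfl⟩; exact h s p hs hp⟩

theorem Force.app {t s : El A.Lam} {F G : TV A} (h : Force t (F ⇾ G)) (hs : Force s F) :
    Force (A.app t s) G := fun p hp => Ok.app (force_imp.1 h s p hs hp)

theorem force_all {t : El A.Lam} {F : M → TV A} : Force t (all F) ↔ ∀ a, Force t (F a) :=
  ⟨fun h a p hp => h p ⟨a, hp⟩, fun h p ⟨a, hp⟩ => h a p hp⟩

end TV

/-- The family `F` of formulas is uniformly realized. -/
def URealized {X : Type*} (F : X → TV A) : Prop := ∃ t : El A.Lam, t.1 ∈ₘ A.QP ∧ ∀ x, Force t (F x)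

namespace URealized
variable {X : Type*} {F G H : X → TV A}

theorem mp (h : URealized fun x => F x ⇾ G x) (hF : URealized F) : URealized G := by
  obtain ⟨t, ht, h⟩ := h
  obtain ⟨s, hs, hF⟩ := hF
  exact ⟨A.app t s, A.QP_app _ _ ht hs, fun x => (h x).app (hF x)⟩

theorem comp {Y : Type*} (h : URealized F) (g : Y → X) : URealized fun y => F (g y) := by
  obtain ⟨t, ht, h⟩ := h
  exact ⟨t, ht, fun y => h _⟩

theorem id : URealized fun x => F x ⇾ F x :=
  ⟨A.cI, A.QP_cI, fun _ => force_imp.2 fun _ _ hs hp => Ok.cI (hs.ok hp)⟩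

/-- A family of falsity values which decreases pointwise is realized by the identity. -/
theorem of_mem (h : ∀ x p, Mem p (G x) → Mem p (F x)) : URealized fun x => F x ⇾ G x :=
  ⟨A.cI, A.QP_cI, fun _ => force_imp.2 fun _ _ hs hp => Ok.cI (hs.ok (h _ _ hp))⟩

theorem efq : URealized fun x => bot ⇾ F x := of_mem fun _ _ _ => trivial

theorem k : URealized fun x => F x ⇾ G x ⇾ F x :=
  ⟨A.cK, A.QP_cK, fun _ => force_imp.2 fun _ _ hs hp => by
    obtain ⟨t, p, -, hp, rfl⟩ := hp
    exact Ok.cK (hs.ok hp)⟩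

/-- The term is Curry's `S = B(B(BW)C)(BB)`, for which `S f g t ≻ f t (g t)`. -/
theorem s : URealized fun x => (F x ⇾ G x ⇾ H x) ⇾ (F x ⇾ G x) ⇾ F x ⇾ H x := by
  refine ⟨A.app (A.app A.cB (A.app (A.app A.cB (A.app A.cB A.cW)) A.cC)) (A.app A.cB A.cB), ?_,
    fun x => force_imp.2 fun f q hf hq => ?_⟩
  · have hB := A.QP_cB
    have hC := A.QP_cC
    have hW := A.QP_cW
    exact A.QP_app _ _ (A.QP_app _ _ hB (A.QP_app _ _ (A.QP_app _ _ hB (A.QP_app _ _ hB hW)) hC))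
      (A.QP_app _ _ hB hB)
  · obtain ⟨g, q, hg, hq, rfl⟩ := hq
    obtain ⟨t, p, ht, hp, rfl⟩ := hq
    exact .app <| .app <| .cB <| .app <| .app <| .cB <| .app <| .cB <| .cW <| .app <| .app <|
      .cC <| .app <| .app <| .cB <| .cB <| force_imp.1 (hf.app ht) _ _ (hg.app ht) hp

/-- For `π ∈ ‖F‖`, the continuation `k_π` realizes `F → G` whatever `G` is, since it discards its
current stack. -/
theorem peirce : URealized fun x => ((F x ⇾ G x) ⇾ F x) ⇾ F x :=
  ⟨A.cc, A.QP_cc, fun _ => force_imp.2 fun _ _ hf hp => Ok.cc <| force_imp.1 hf _ _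
    (force_imp.2 fun _ _ hs _ => Ok.cont (hs.ok hp)) hp⟩

theorem all_elim {F : X → M → TV A} (a : X → M) : URealized fun x => all (F x) ⇾ F x (a x) :=
  of_mem fun x _ hp => ⟨a x, hp⟩

/-- The quantifier is not relativised to any set, so a term realizes `∀` exactly when it realizes
all instances. Quantification is therefore uniformity in one more parameter. -/
theorem all_intro {F : X → M → TV A} (h : URealized fun p : X × M => F p.1 p.2) :
    URealized fun x => all (F x) := by
  obtain ⟨t, ht, h⟩ := h
  exact ⟨t, ht, fun x => force_all.2 fun a => h (x, a)⟩

theorem all_imp {G : X → M → TV A} :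
    URealized fun x => (all fun a => F x ⇾ G x a) ⇾ F x ⇾ all (G x) :=
  of_mem fun x p hp => by
    obtain ⟨t, q, ht, ⟨a, ha⟩, rfl⟩ := hp
    exact ⟨a, _, _, ht, ha, rfl⟩

end URealized

/-! ### Propositional completeness: derivations and maximal theories -/

/-- Derivability from the hypotheses `S` and all uniformly realized families. -/
inductive Derivable {X : Type*} (S : Set (X → TV A)) : (X → TV A) → Prop
  | ax {F} : F ∈ S → Derivable S F
  | real {F} : URealized F → Derivable S F
  | mp {F G} : Derivable S (fun x => F x ⇾ G x) → Derivable S F → Derivable S G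

namespace Derivable
variable {X : Type*} {S S' : Set (X → TV A)} {F G H : X → TV A}

theorem mono (h : Derivable S F) (hS : S ⊆ S') : Derivable S' F := by
  induction h with
  | ax h => exact .ax (hS h)
  | real h => exact .real h
  | mp _ _ h1 h2 => exact .mp h1 h2

theorem deduction (h : Derivable (insert G S) F) : Derivable S fun x => G x ⇾ F x := by
  induction h with
  | ax h =>
    rcases h with rfl | h
    · exact .real .id
    · exact .mp (.real .k) (.ax h)
  | real h => exact .mp (.real .k) (.real h)
  | mp _ _ h1 h2 => exact .mp (.mp (.real .s) h1) h2

theorem uRealized (h : Derivable (∅ : Set (X → TV A)) F) : URealized F := by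
  induction h with
  | ax h => exact h.elim
  | real h => exact h
  | mp _ _ h1 h2 => exact h1.mp h2

theorem finite (h : Derivable S F) : ∃ T : Finset (X → TV A), (T : Set _) ⊆ S ∧ Derivable T F := by
  classical
  induction h with
  | ax h => exact ⟨{_}, by simpa using h, .ax (by simp)⟩
  | real h => exact ⟨∅, by simp, .real h⟩
  | mp _ _ h1 h2 =>
    obtain ⟨T1, hT1, h1⟩ := h1
    obtain ⟨T2, hT2, h2⟩ := h2
    exact ⟨T1 ∪ T2, by simp [hT1, hT2], .mp (h1.mono (by simp)) (h2.mono (by simp))⟩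

/-- Case analysis. -/
theorem cases (h1 : Derivable S fun x => (F x ⇾ G x) ⇾ H x) (h2 : Derivable S fun x => F x ⇾ H x) :
    Derivable S H := by
  refine .mp (.real (.peirce (G := G))) (deduction ?_)
  refine .mp (h1.mono (Set.subset_insert _ _)) (deduction ?_)
  refine .mp (.ax (F := fun x => H x ⇾ G x) (by simp)) ?_
  exact .mp (h2.mono fun _ h => by simp [h]) (.ax (by simp))

end Derivable

/-- A maximal consistent theory in the context `X`. -/
structure MaxTheory (A : RealizabilityAlgebra M) (X : Type*) where
  holds : (X → TV A) → Prop
  of_uRealized : ∀ {F}, URealized F → holds F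
  holds_imp' : ∀ F G, holds (fun x => F x ⇾ G x) ↔ (holds F → holds G)
  not_bot : ¬ holds fun _ => bot

/-- Zorn's lemma on the sets of hypotheses that do not derive `F`; chains have bounds because
derivations are finite. By maximality every underivable `G` implies `F`, and with classical case
analysis this makes implication two-valued. -/
theorem exists_maxTheory {X : Type*} {S : Set (X → TV A)} {F : X → TV A} (h : ¬ Derivable S F) :
    ∃ T : MaxTheory A X, (∀ G ∈ S, T.holds G) ∧ ¬ T.holds F := by
  obtain ⟨S', hSS', hmax⟩ := zorn_subset_nonempty {S' | ¬ Derivable S' F} (fun c hc hch hne => by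
    refine ⟨⋃₀ c, fun hd => ?_, fun s hs => Set.subset_sUnion_of_mem hs⟩
    obtain ⟨T, hT, hd⟩ := hd.finite
    obtain ⟨s, hs, hTs⟩ := DirectedOn.exists_mem_subset_of_finset_subset_biUnion
      (f := _root_.id) hne hch.directedOn (s := T) (by simpa [Set.sUnion_eq_biUnion] using hT)
    exact hc hs (hd.mono hTs)) S h
  have hn : ¬ Derivable S' F := hmax.prop
  have key : ∀ G, ¬ Derivable S' G → Derivable S' fun x => G x ⇾ F x := fun G hG => by
    by_contra hc
    have h1 : insert G S' ⊆ S' := hmax.le_of_ge (y := insert G S')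
      (fun hd => hc hd.deduction) (Set.subset_insert _ _)
    exact hG (.ax (h1 (Set.mem_insert _ _)))
  refine ⟨⟨Derivable S', .real, fun G G' => ⟨.mp, fun hi => ?_⟩, fun hb => hn (.mp (.real .efq) hb)⟩,
    fun G hG => .ax (hSS' hG), hn⟩
  by_cases hG : Derivable S' G
  · exact .mp (.real .k) (hi hG)
  · by_contra hc
    exact hn (.cases (key _ hc) (key _ hG))

/-- This replaces explicit combinators: a propositional consequence is checked by truth tables in an
arbitrary maximal theory. -/
theorem uRealized_of_forall_maxTheory {X : Type*} {F : X → TV A}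
    (h : ∀ T : MaxTheory A X, T.holds F) : URealized F := by
  by_contra hc
  obtain ⟨T, -, hT⟩ := exists_maxTheory (S := ∅) (F := F) fun hd => hc hd.uRealized
  exact hT (h T)

namespace MaxTheory
variable {X : Type*} (T : MaxTheory A X) {F G : X → TV A}

theorem holds_imp : T.holds (fun x => F x ⇾ G x) ↔ (T.holds F → T.holds G) := T.holds_imp' F G

theorem holds_bot : T.holds (fun _ => bot) ↔ False := iff_false_intro T.not_bot

theorem mp (h : URealized fun x => F x ⇾ G x) (hF : T.holds F) : T.holds G :=
  T.holds_imp.1 (T.of_uRealized h) hF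

theorem holds_neg : T.holds (fun x => neg (F x)) ↔ ¬ T.holds F := by
  simp only [neg, holds_imp, holds_bot]

theorem holds_and : T.holds (fun x => F x ⩓ G x) ↔ T.holds F ∧ T.holds G := by
  simp only [TV.and, holds_imp, holds_bot]; tauto

theorem holds_or : T.holds (fun x => F x ⩔ G x) ↔ T.holds F ∨ T.holds G := by
  simp only [TV.or, neg, holds_imp, holds_bot]; tauto

theorem holds_iff : T.holds (fun x => TV.iff (F x) (G x)) ↔ (T.holds F ↔ T.holds G) := by
  simp only [TV.iff, holds_and, holds_imp]; tauto

end MaxTheory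

theorem URealized.all_mono {X : Type*} (F G : X → M → TV A) :
    URealized fun x => (all fun a => F x a ⇾ G x a) ⇾ all (F x) ⇾ all (G x) := by
  let P : X → TV A := fun x => all fun a => F x a ⇾ G x a
  have h1 : URealized fun x => all fun a => P x ⇾ all (F x) ⇾ G x a := by
    refine .all_intro (uRealized_of_forall_maxTheory fun T => ?_)
    have h0 : T.holds fun p => P p.1 ⇾ F p.1 p.2 ⇾ G p.1 p.2 := T.of_uRealized (.all_elim _)
    have h1 : T.holds fun p => all (F p.1) ⇾ F p.1 p.2 := T.of_uRealized (.all_elim _)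
    simp only [T.holds_imp] at h0 h1 ⊢
    exact fun h h' => h0 h (h1 h')
  have h2 := URealized.all_imp.mp h1
  have h3 : URealized fun x => (all fun a => all (F x) ⇾ G x a) ⇾ all (F x) ⇾ all (G x) := .all_imp
  refine uRealized_of_forall_maxTheory fun T => ?_
  have h2 := T.of_uRealized h2
  have h3 := T.of_uRealized h3
  simp only [T.holds_imp] at h2 h3 ⊢
  exact fun h => h3 (h2 h)

/-- The instance `a` of a Henkin axiom implies `Ψ` for all `a` only if `Ψ` holds. -/
theorem uRealized_henkin {X : Type*} (G : X → M → TV A) (Q : X → TV A) :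
    URealized fun x => (all fun a => (ex (G x) ⇾ G x a) ⇾ Q x) ⇾ Q x := by
  let D : X → TV A := fun x => all fun a => (ex (G x) ⇾ G x a) ⇾ Q x
  -- Suppose `Q` fails. Each instance gives `¬(∃G → G a)`, hence `¬G a` for all `a`. Then `∃G`
  -- fails, so the Henkin axiom at `a₀` holds vacuously and yields `Q`.
  let a₀ : M := Classical.arbitrary M
  have h1 : URealized fun x => all fun a => D x ⇾ neg (Q x) ⇾ neg (G x a) := by
    refine .all_intro (uRealized_of_forall_maxTheory fun T => ?_)
    have h0 : T.holds fun p => D p.1 ⇾ (ex (G p.1) ⇾ G p.1 p.2) ⇾ Q p.1 :=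
      T.of_uRealized (.all_elim _)
    simp only [T.holds_imp, T.holds_neg] at h0 ⊢
    tauto
  have h2 : URealized fun x => D x ⇾ (ex (G x) ⇾ G x a₀) ⇾ Q x := .all_elim _
  have h3 : URealized fun x => (all fun a => neg (Q x) ⇾ neg (G x a)) ⇾ neg (Q x) ⇾
    all fun a => neg (G x a) := .all_imp
  have h4 := URealized.all_imp.mp h1
  refine uRealized_of_forall_maxTheory fun T => ?_
  have h2 := T.of_uRealized h2
  have h3 := T.of_uRealized h3
  have h4 := T.of_uRealized h4
  simp only [ex, T.holds_imp, T.holds_neg] at h2 h3 h4 ⊢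
  tauto

end

/-! ### Two-valued models of the realized formulas -/

section
variable {M : Type u} [langSet.Structure M] [Nonempty M] {A : RealizabilityAlgebra M}

open TV RealizabilityAlgebra

/-- Names of Henkin witnesses: the index `mk n G l` names an individual `a` such that `G a v` holds
(if there is one), where `v` is the tuple named by `l`. -/
inductive HenkinIndex (A : RealizabilityAlgebra M) : Type u
  | mk (n : ℕ) (G : M → (Fin n → M) → TV A) (l : Fin n → HenkinIndex A) : HenkinIndex A

namespace HenkinIndex

/-- The nesting depth of a name. -/
def depth : HenkinIndex A → ℕ
  | mk _ _ l => (Finset.univ.sup fun k => depth (l k)) + 1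

theorem depth_lt (n : ℕ) (G : M → (Fin n → M) → TV A) (l : Fin n → HenkinIndex A) (k : Fin n) :
    (l k).depth < (mk n G l).depth :=
  Nat.lt_succ_of_le (Finset.le_sup (f := fun k => depth (l k)) (Finset.mem_univ k))

end HenkinIndex

/-- Interpretations of the names of witnesses. -/
abbrev World (A : RealizabilityAlgebra M) : Type u := HenkinIndex A → M

/-- The Henkin axiom of a name. -/
def henkinAxiom : HenkinIndex A → World A → TV A
  | .mk n G l, ω => ex (fun a => G a fun k => ω (l k)) ⇾ G (ω (.mk n G l)) fun k => ω (l k)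

-- An axiom reads only its own coordinate and coordinates of strictly smaller depth.
open scoped Classical in
theorem henkinAxiom_update {i j : HenkinIndex A} (hij : j.depth ≤ i.depth) (hne : j ≠ i)
    (ω : World A) (a : M) : henkinAxiom j (Function.update ω i a) = henkinAxiom j ω := by
  cases j with
  | mk n G l =>
    have h1 : ∀ k, l k ≠ i := fun k h => by
      have := HenkinIndex.depth_lt n G l k
      rw [h] at this
      omega
    simp [henkinAxiom, Function.update_of_ne, h1, hne]

open scoped Classical in
theorem henkinAxiom_update_self (i : HenkinIndex A) :
    ∃ G : World A → M → TV A, ∀ ω a, henkinAxiom i (Function.update ω i a) =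
      (ex (G ω) ⇾ G ω a) := by
  cases i with
  | mk n G l =>
    have h1 : ∀ k, l k ≠ .mk n G l := fun k h => by
      have := HenkinIndex.depth_lt n G l k
      rw [h] at this
      omega
    refine ⟨fun ω a => G a fun k => ω (l k), fun ω a => ?_⟩
    simp [henkinAxiom, Function.update_of_ne, h1]

-- Generalisation over a coordinate that is not free in the hypotheses.
open scoped Classical in
theorem Derivable.generalize {S : Set (World A → TV A)} {F : World A → TV A} (i : HenkinIndex A)
    (hS : ∀ G ∈ S, ∀ ω a, G (Function.update ω i a) = G ω) (h : Derivable S F) :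
    Derivable S fun ω => all fun a => F (Function.update ω i a) := by
  induction h with
  | @ax F h =>
    refine .mp (.real (URealized.of_mem fun ω p hp => ?_)) (.ax h)
    obtain ⟨a, ha⟩ := mem_all.1 hp
    rwa [hS _ h] at ha
  | @real F h =>
    exact .real (.all_intro (F := fun ω a => F (Function.update ω i a))
      (h.comp fun p : World A × M => Function.update p.1 i p.2))
  | @mp F G _ _ h1 h2 => exact .mp (.mp (.real (.all_mono _ _)) h1) h2

/-- Henkin axioms can be eliminated from derivations. -/
theorem Derivable.realizes {Φ : TV A}
    (h : Derivable (Set.range (henkinAxiom (A := A))) fun _ => Φ) : A.Realizes Φ := by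
  classical
  -- Axioms are discharged by decreasing depth. The witness of the deepest one is not free in the
  -- others, so that axiom can be generalised over its witness and removed by `uRealized_henkin`.
  have key : ∀ s : Finset (HenkinIndex A), Derivable (henkinAxiom '' (s : Set (HenkinIndex A)))
      (fun _ => Φ) → A.Realizes Φ := by
    intro s
    refine Finset.induction_on_max_value HenkinIndex.depth s ?_ ?_
    · intro h
      rw [Finset.coe_empty, Set.image_empty] at h
      obtain ⟨t, ht, h⟩ := h.uRealized
      exact ⟨t, ht, h fun _ => Classical.arbitrary M⟩
    · intro i s hi hmax ih h
      rw [Finset.coe_insert, Set.image_insert_eq] at h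
      refine ih ?_
      have h2 := h.deduction.generalize i fun G hG ω a => by
        obtain ⟨j, hj, rfl⟩ := hG
        exact henkinAxiom_update (hmax j hj) (fun h => hi (h ▸ hj)) ω a
      obtain ⟨G, hG⟩ := henkinAxiom_update_self i
      simp only [hG] at h2
      exact .mp (.real (uRealized_henkin G fun _ => Φ)) h2
  obtain ⟨T, hT, hd⟩ := h.finite
  obtain ⟨s, -, rfl⟩ := Finset.subset_set_image_iff.1 (hT.trans Set.image_univ.symm.subset)
  exact key s (by rwa [Finset.coe_image] at hd)

/-- A maximal consistent theory that satisfies the Henkin axioms. -/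
structure HenkinTheory (A : RealizabilityAlgebra M) extends MaxTheory A (World A) where
  henkin : ∀ i, holds (henkinAxiom i)

theorem realizes_of_forall_henkinTheory {Φ : TV A}
    (h : ∀ T : HenkinTheory A, T.holds fun _ => Φ) : A.Realizes Φ := by
  by_contra hc
  obtain ⟨T, hT, hΦ⟩ := exists_maxTheory (S := Set.range (henkinAxiom (A := A))) (F := fun _ => Φ)
    fun hd => hc hd.realizes
  exact hΦ (h ⟨T, fun i => hT _ ⟨i, rfl⟩⟩)

/-! ### Generic individuals: the elements of the two-valued model -/

/-- Generic elements of the type `Y`: functions of finitely many Henkin witnesses. -/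
structure Gen (A : RealizabilityAlgebra M) (Y : Type*) where
  toFun : World A → Y
  finite : ∃ s : Finset (HenkinIndex A), ∀ ω ω', (∀ i ∈ s, ω i = ω' i) → toFun ω = toFun ω'

namespace Gen
variable {Y Z W : Type*}

instance : CoeFun (Gen A Y) fun _ => World A → Y := ⟨Gen.toFun⟩

/-- A standard element. -/
def const (y : Y) : Gen A Y := ⟨fun _ => y, ∅, fun _ _ _ => rfl⟩

/-- The image of a generic element. -/
def map (f : Y → Z) (g : Gen A Y) : Gen A Z :=
  ⟨fun ω => f (g ω), g.finite.imp fun _ h ω ω' hs => congrArg f (h ω ω' hs)⟩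

/-- Pairs of generic elements. -/
def prod (g : Gen A Y) (h : Gen A Z) : Gen A (Y × Z) :=
  ⟨fun ω => (g ω, h ω), by
    classical
    obtain ⟨s, hs⟩ := g.finite
    obtain ⟨t, ht⟩ := h.finite
    exact ⟨s ∪ t, fun ω ω' hst => Prod.ext
      (hs ω ω' fun i hi => hst i (Finset.mem_union_left _ hi))
      (ht ω ω' fun i hi => hst i (Finset.mem_union_right _ hi))⟩⟩

/-- The image of two generic elements. -/
def map₂ (f : Y → Z → W) (g : Gen A Y) (h : Gen A Z) : Gen A W := (g.prod h).map fun p => f p.1 p.2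

/-- The generic element named by a Henkin index. -/
def coord (i : HenkinIndex A) : Gen A M := ⟨fun ω => ω i, {i}, fun _ _ h => h i (by simp)⟩

end Gen

namespace HenkinTheory
variable (T : HenkinTheory A) {Y : Type*}

/-- If `∀x F` fails, the Henkin axiom for `¬F` names a coordinate at which an instance fails. A
Henkin name has finitely many parameters, which is why generic elements must have finite support. -/
theorem holds_all (F : Y → M → TV A) (g : Gen A Y) :
    T.holds (fun ω => all (F (g ω))) ↔ ∀ x : Gen A M, T.holds fun ω => F (g ω) (x ω) := by
  refine ⟨fun h x => T.mp (.all_elim (F := fun ω => F (g ω)) _) h, fun h => ?_⟩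
  obtain ⟨s, hs⟩ := g.finite
  obtain ⟨n, ⟨e⟩⟩ : ∃ n, Nonempty (Fin n ≃ s) := ⟨_, ⟨s.equivFin.symm⟩⟩
  classical
  have a₀ : M := Classical.arbitrary M
  -- `g` reads only the coordinates in `s`, so it can be recomputed from the `n` parameters of the
  -- name. The value `a₀` at the other coordinates does not matter.
  let r : (Fin n → M) → World A := fun v i => if hi : i ∈ s then v (e.symm ⟨i, hi⟩) else a₀
  have hr : ∀ ω : World A, g (r fun k => ω (e k)) = g ω := fun ω => hs _ _ fun i hi => by
    simp [r, hi]
  let i : HenkinIndex A := .mk n (fun a v => neg (F (g (r v)) a)) fun k => e k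
  have hx := h (Gen.coord i)
  have hi : T.holds fun ω => ex (fun a => neg (F (g (r fun k => ω (e k))) a)) ⇾
    neg (F (g (r fun k => ω (e k))) (ω i)) := T.henkin i
  simp only [hr, ex] at hi
  rw [T.holds_imp, T.holds_neg, T.holds_neg] at hi
  by_contra hc
  refine hi (fun h' => hc (T.mp (.mp (.all_mono _ _) (.all_intro ?_)) h')) hx
  refine uRealized_of_forall_maxTheory fun T => ?_
  simp only [T.holds_imp, T.holds_neg, not_not, imp_self]

end HenkinTheory

end

/-! ### Classes definable in the ground model -/

section
variable {M : Type u} [langSet.Structure M] [Nonempty M]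

noncomputable section Ctx
/-- Contexts: types whose elements are described by a sequence of individuals. -/
class Ctx (M : Type u) (Y : Type*) where
  coord : ℕ → Y → M

/-- Contexts are read as infinite sequences, so the empty one is padded with a constant. -/
instance : Ctx M PUnit.{u + 1} := ⟨fun _ _ => Classical.arbitrary M⟩

/-- De Bruijn order: the last variable introduced has index `0`. -/
instance {Y : Type*} [Ctx M Y] : Ctx M (Y × M) := ⟨fun n p => Nat.casesOn n p.2 fun k => Ctx.coord k p.1⟩

end Ctx
/-- The predicate `P` is first-order definable in `M` with parameters. -/
class DefPred (M : Type u) [langSet.Structure M] [Nonempty M] {Y : Type*} [Ctx M Y] (P : Y → Prop) :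
    Prop where
  out : ∃ S : Set (ℕ → M), Set.Definable Set.univ langSet S ∧
    ∀ y, P y ↔ (fun n => Ctx.coord n y) ∈ S

/-- The function `t` is first-order definable in `M` with parameters. -/
class DefFun {Y : Type*} [Ctx M Y] (t : Y → M) : Prop where
  out : DefPred M fun p : Y × M => p.2 = t p.1

/-- `f` forgets some of the last coordinates. -/
class CtxPath (M : Type u) {Y Z : Type*} [Ctx M Y] [Ctx M Z] (f : Z → Y) : Prop where
  out : ∃ k, ∀ n z, (Ctx.coord n (f z) : M) = Ctx.coord (n + k) z

/-- The coordinates of `f z` are coordinates of `z` or constants. -/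
class CtxMap (M : Type u) {Y Z : Type*} [Ctx M Y] [Ctx M Z] (f : Z → Y) : Prop where
  out : ∃ r : ℕ → ℕ ⊕ M, ∀ n z,
    (Ctx.coord n (f z) : M) = Sum.elim (fun k => Ctx.coord k z) id (r n)

theorem definable_subst {α β : Type} {S : Set (α → M)} (h : Set.Definable Set.univ langSet S)
    (σ : α → β ⊕ M) :
    Set.Definable Set.univ langSet {v : β → M | (fun n => Sum.elim v id (σ n)) ∈ S} := by
  obtain ⟨φ, rfl⟩ := h
  refine ⟨φ.subst fun n => Sum.elim (fun b => .var b)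
    (fun c => (langSet.con (⟨c, trivial⟩ : (Set.univ : Set M))).term) (σ n), ?_⟩
  ext v
  simp only [Set.mem_ofPred_eq, FirstOrder.Language.Formula.Realize,
    FirstOrder.Language.BoundedFormula.realize_subst]
  refine iff_of_eq (congrArg (fun w => FirstOrder.Language.Formula.Realize φ w)
    (funext fun n => ?_))
  cases σ n <;> simp

theorem definable_mem {α : Type} (a b : α) :
    Set.Definable Set.univ langSet {v : α → M | v a ∈ₘ v b} := by
  refine ⟨FirstOrder.Language.Relations.formula₂
    (L := langSet.withConstants (Set.univ : Set M)) (Sum.inl MemSymbol.mem) (.var a) (.var b), ?_⟩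
  ext v
  exact Iff.symm (FirstOrder.Language.Formula.realize_rel₂
    (L := langSet.withConstants (Set.univ : Set M)) (R := Sum.inl MemSymbol.mem))

theorem definable_eq {α : Type} (a b : α) :
    Set.Definable Set.univ langSet {v : α → M | v a = v b} := by
  refine ⟨FirstOrder.Language.Term.equal (.var a) (.var b), ?_⟩
  ext v
  simp

namespace DefPred
variable {Y Z : Type*} [Ctx M Y] [Ctx M Z] {P Q : Y → Prop}

theorem congr (h : DefPred M P) (hPQ : ∀ y, P y ↔ Q y) : DefPred M Q := by
  rwa [← funext fun y => propext (hPQ y)]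

theorem comp (h : DefPred M P) (f : Z → Y) [hf : CtxMap M f] : DefPred M fun z => P (f z) := by
  obtain ⟨S, hS, h⟩ := h
  obtain ⟨r, hr⟩ := hf
  exact ⟨_, definable_subst hS r, fun z => by simp [h, hr]⟩

instance const (c : Prop) : DefPred M fun _ : Y => c := by
  by_cases hc : c
  · exact ⟨_, Set.definable_univ, by simp [hc]⟩
  · exact ⟨_, Set.definable_empty, by simp [hc]⟩

instance and [hP : DefPred M P] [hQ : DefPred M Q] : DefPred M fun y => P y ∧ Q y := by
  obtain ⟨S, hS, hP⟩ := hP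
  obtain ⟨R, hR, hQ⟩ := hQ
  exact ⟨_, hS.inter hR, fun y => by simp [hP, hQ]⟩

instance or [hP : DefPred M P] [hQ : DefPred M Q] : DefPred M fun y => P y ∨ Q y := by
  obtain ⟨S, hS, hP⟩ := hP
  obtain ⟨R, hR, hQ⟩ := hQ
  exact ⟨_, hS.union hR, fun y => by simp [hP, hQ]⟩

instance not [hP : DefPred M P] : DefPred M fun y => ¬ P y := by
  obtain ⟨S, hS, hP⟩ := hP
  exact ⟨_, hS.compl, fun y => by simp [hP]⟩

instance imp [DefPred M P] [DefPred M Q] : DefPred M fun y => P y → Q y :=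
  congr (P := fun y => ¬ P y ∨ Q y) inferInstance fun y => by tauto

instance iff [DefPred M P] [DefPred M Q] : DefPred M fun y => P y ↔ Q y :=
  congr (P := fun y => (P y → Q y) ∧ (Q y → P y)) inferInstance fun y => by tauto

instance ex {P : Y → M → Prop} [hP : DefPred M fun p : Y × M => P p.1 p.2] :
    DefPred M fun y => ∃ x, P y x := by
  obtain ⟨S, hS, hP⟩ := hP
  have h1 := definable_subst (β := ℕ ⊕ Fin 1) hS fun n =>
    Sum.inl (Nat.casesOn n (Sum.inr 0) fun k => Sum.inl k)
  refine ⟨_, h1.image_comp_sumInl_fin 1, fun y => ?_⟩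
  constructor
  · rintro ⟨x, hx⟩
    refine ⟨Sum.elim (fun n => Ctx.coord n y) fun _ => x, ?_, rfl⟩
    refine Set.mem_ofPred_eq ▸ (?_ : _ ∈ S)
    have := (hP (y, x)).1 hx
    convert this using 2 with n
    cases n <;> rfl
  · rintro ⟨w, hw, hwy⟩
    refine ⟨w (Sum.inr 0), (hP (y, _)).2 ?_⟩
    have hw : _ ∈ S := hw
    convert hw using 2 with n
    cases n with
    | zero => rfl
    | succ n => exact (congrFun hwy n).symm

instance all {P : Y → M → Prop} [DefPred M fun p : Y × M => P p.1 p.2] :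
    DefPred M fun y => ∀ x, P y x :=
  congr (P := fun y => ¬ ∃ x, ¬ P y x) inferInstance fun y => by simp

end DefPred

namespace CtxPath
variable {Y Z : Type*} [Ctx M Y] [Ctx M Z]

instance id : CtxPath M fun y : Y => y := ⟨0, fun _ _ => rfl⟩

instance fst {f : Z → Y × M} [h : CtxPath M f] : CtxPath M fun z => (f z).1 := by
  obtain ⟨k, hk⟩ := h
  exact ⟨k + 1, fun n z => by
    rw [← add_assoc, add_right_comm, ← hk]; rfl⟩

end CtxPath

namespace CtxMap
variable {Y Z : Type*} [Ctx M Y] [Ctx M Z]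

instance path {f : Z → Y} [h : CtxPath M f] : CtxMap M f := by
  obtain ⟨k, hk⟩ := h
  exact ⟨fun n => Sum.inl (n + k), hk⟩

instance const (y : Y) : CtxMap M fun _ : Z => y := ⟨fun n => Sum.inr (Ctx.coord n y), fun _ _ => rfl⟩

instance prod {f : Z → Y} {W : Type*} [Ctx M W] {g : Z → W × M} [hf : CtxMap M f]
    [hg : CtxPath M g] : CtxMap M fun z => (f z, (g z).2) := by
  obtain ⟨r, hr⟩ := hf
  obtain ⟨k, hk⟩ := hg
  refine ⟨fun n => Nat.casesOn n (Sum.inl k) fun n => r n, fun n z => ?_⟩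
  cases n with
  | zero =>
    have := hk 0 z
    rw [zero_add] at this
    exact this
  | succ n => exact hr n z

instance prodConst {f : Z → Y} (c : M) [hf : CtxMap M f] : CtxMap M fun z => (f z, c) := by
  obtain ⟨r, hr⟩ := hf
  refine ⟨fun n => Nat.casesOn n (Sum.inr c) fun n => r n, fun n z => ?_⟩
  cases n with
  | zero => rfl
  | succ n => exact hr n z

theorem lift {f : Z → Y} (hf : CtxMap M f) : CtxMap M fun p : Z × M => (f p.1, p.2) := by
  obtain ⟨r, hr⟩ := hf
  refine ⟨fun n => Nat.casesOn n (Sum.inl 0) fun n => Sum.map (· + 1) id (r n), fun n z => ?_⟩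
  cases n with
  | zero => rfl
  | succ n =>
    refine (hr n z.1).trans ?_
    change _ = Sum.elim _ _ (Sum.map _ _ (r n))
    cases r n <;> rfl

end CtxMap

namespace DefFun
variable {Y Z : Type*} [Ctx M Y] [Ctx M Z] {t s : Y → M}

instance snd {f : Z → Y × M} [h : CtxPath M f] : DefFun fun z => (f z).2 := by
  obtain ⟨k, hk⟩ := h
  refine ⟨⟨_, definable_eq 0 (k + 1), fun p => ?_⟩⟩
  have := hk 0 p.1
  rw [zero_add] at this
  exact (iff_of_eq (congrArg (p.2 = ·) this))

instance const (c : M) : DefFun fun _ : Y => c := by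
  have := definable_subst (definable_eq (M := M) (0 : Fin 2) 1)
    (β := ℕ) ![Sum.inl 0, Sum.inr c]
  exact ⟨⟨_, this, fun p => Iff.rfl⟩⟩

end DefFun

namespace DefPred
variable {Y Z : Type*} [Ctx M Y] [Ctx M Z] {t s : Y → M}

theorem subst {P : Y → M → Prop} (hP : DefPred M fun p : Y × M => P p.1 p.2) (t : Y → M)
    [ht : DefFun t] : DefPred M fun y => P y (t y) :=
  have := ht.out
  congr (P := fun y => ∃ x, x = t y ∧ P y x) inferInstance fun y => by simp

instance mem [ht : DefFun t] [hs : DefFun s] : DefPred M fun y => t y ∈ₘ s y := by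
  have h0 : DefPred M fun p : (Y × M) × M => p.1.2 ∈ₘ p.2 := ⟨_, definable_mem 1 0, fun _ => Iff.rfl⟩
  have hs' : DefFun fun p : Y × M => s p.1 := ⟨hs.out.comp fun p : (Y × M) × M => (p.1.1, p.2)⟩
  have h1 : DefPred M fun p : Y × M => p.2 ∈ₘ s p.1 :=
    subst (P := fun (p : Y × M) x => p.2 ∈ₘ x) h0 _
  exact subst (P := fun y x => x ∈ₘ s y) h1 t

instance eq [ht : DefFun t] [hs : DefFun s] : DefPred M fun y => t y = s y :=
  subst (P := fun y x => x = s y) hs.out t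

end DefPred

theorem DefFun.comp {Y Z : Type*} [Ctx M Y] [Ctx M Z] {t : Y → M} (ht : DefFun t) (f : Z → Y)
    [hf : CtxMap M f] : DefFun fun z => t (f z) := by
  have : CtxMap M fun p : Z × M => (f p.1, p.2) := hf.lift
  exact ⟨ht.out.comp fun p : Z × M => (f p.1, p.2)⟩

theorem DefFun.of_pred {Y : Type*} [Ctx M Y] {t : Y → M} {P : Y → M → Prop}
    [h : DefPred M fun p : Y × M => P p.1 p.2] (ht : ∀ y x, x = t y ↔ P y x) : DefFun t :=
  ⟨h.congr fun p => (ht p.1 p.2).symm⟩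

/-- A definable function of one variable. -/
abbrev DefFun₁ (f : M → M) : Prop := DefFun fun p : PUnit.{u + 1} × M => f p.2

/-- A definable function of two variables. -/
abbrev DefFun₂ (f : M → M → M) : Prop := DefFun fun p : (PUnit.{u + 1} × M) × M => f p.1.2 p.2

theorem DefFun₁.comp {Y : Type*} [Ctx M Y] {f : M → M} (hf : DefFun₁ f) (t : Y → M) [ht : DefFun t] :
    DefFun fun y => f (t y) :=
  have : DefFun fun p : Y × M => t p.1 := ht.comp _
  ⟨.subst (P := fun (p : Y × M) x => p.2 = f x)
    (hf.out.comp fun q : (Y × M) × M => ((PUnit.unit, q.2), q.1.2)) fun p => t p.1⟩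

theorem DefFun₂.comp {Y : Type*} [Ctx M Y] {f : M → M → M} (hf : DefFun₂ f) (t s : Y → M)
    [ht : DefFun t] [hs : DefFun s] : DefFun fun y => f (t y) (s y) := by
  have : DefFun fun p : Y × M => s p.1 := hs.comp _
  have : DefFun fun p : (Y × M) × M => t p.1.1 := ht.comp _
  have h1 : DefPred M fun q : (Y × M) × M => q.1.2 = f (t q.1.1) q.2 :=
    .subst (P := fun (q : (Y × M) × M) x => q.1.2 = f x q.2)
      (hf.out.comp fun q : ((Y × M) × M) × M => (((PUnit.unit, q.2), q.1.2), q.1.1.2))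
      fun p => t p.1.1
  exact ⟨.subst (P := fun (p : Y × M) x => p.2 = f (t p.1) x) h1 fun p => s p.1⟩

end

/-! ### Set theory in the ground model -/

section
variable {M : Type u} [langSet.Structure M] [Nonempty M] [hM : Fact (IsModelZFC M)]

namespace GroundModel

theorem ext {a b : M} (h : ∀ x, x ∈ₘ a ↔ x ∈ₘ b) : a = b := hM.out.extensionality a b h

theorem mem_compr {P : M → Prop} (h : ∃ s : M, ∀ x, x ∈ₘ s ↔ P x) {x : M} :
    x ∈ₘ compr P ↔ P x := Classical.epsilon_spec h x

theorem mem_compr_of_subset {P : M → Prop} [hP : DefPred M fun p : PUnit.{u + 1} × M => P p.2] (a : M)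
    (ha : ∀ x, P x → x ∈ₘ a) {x : M} : x ∈ₘ compr P ↔ P x := by
  refine mem_compr ?_
  obtain ⟨S, hS, hP⟩ := hP
  have h1 := definable_subst (β := Fin 1) hS fun n =>
    Nat.casesOn n (Sum.inl 0) fun _ => Sum.inr (Classical.arbitrary M)
  have h2 : ∀ x, P x ↔ x ∈ {x : M | (fun n => Sum.elim (fun _ : Fin 1 => x) id
      (Nat.casesOn n (Sum.inl 0) fun _ => Sum.inr (Classical.arbitrary M) : Fin 1 ⊕ M)) ∈ S} := by
    intro x
    rw [hP (PUnit.unit, x), Set.mem_ofPred_eq]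
    refine iff_of_eq (congrArg (· ∈ S) (funext fun n => ?_))
    cases n <;> rfl
  obtain ⟨b, hb⟩ := hM.out.separation {x | P x} (by
    unfold Set.Definable₁
    refine (congrArg _ (Set.ext fun v => ?_)).mpr h1
    simp only [Set.mem_ofPred_eq, h2]
    refine iff_of_eq (congrArg (· ∈ S) (funext fun n => ?_))
    cases n <;> simp) a
  exact ⟨b, fun x => (hb x).trans ⟨fun h => h.2, fun h => ⟨ha x h, h⟩⟩⟩

theorem mem_upair {x y z : M} : z ∈ₘ upair x y ↔ z = x ∨ z = y :=
  mem_compr (hM.out.pairing x y)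

theorem upair_left_inj {x y y' : M} (h : upair x y = upair x y') : y = y' := by
  have h1 : y ∈ₘ upair x y' := h ▸ mem_upair.2 (Or.inr rfl)
  have h2 : y' ∈ₘ upair x y := h ▸ mem_upair.2 (Or.inr rfl)
  rw [mem_upair] at h1 h2
  grind

theorem pair_inj {x y x' y' : M} : pair x y = pair x' y' ↔ x = x' ∧ y = y' := by
  refine ⟨fun h => ?_, fun ⟨h1, h2⟩ => h1 ▸ h2 ▸ rfl⟩
  have hx : x = x' := by
    have h1 : upair x x ∈ₘ pair x' y' := h ▸ mem_upair.2 (Or.inl rfl)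
    have h2 : x' ∈ₘ upair x x := by
      rcases mem_upair.1 h1 with h1 | h1 <;> rw [h1] <;> exact mem_upair.2 (Or.inl rfl)
    rcases mem_upair.1 h2 with h2 | h2 <;> exact h2.symm
  subst hx
  exact ⟨rfl, upair_left_inj (upair_left_inj h)⟩

theorem not_mem_zero (x : M) : ¬ x ∈ₘ zero M := by
  have h : ∃ s : M, ∀ x, x ∈ₘ s ↔ False := by
    obtain ⟨-, ⟨e, -, he⟩, -⟩ := hM.out.infinity
    exact ⟨e, fun x => iff_false_intro (he x)⟩
  exact (mem_compr h).1

/-- The union of the elements of `a`. -/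
noncomputable def sUnion (a : M) : M := compr fun x => ∃ y, y ∈ₘ a ∧ x ∈ₘ y

theorem mem_sUnion {a x : M} : x ∈ₘ sUnion a ↔ ∃ y, y ∈ₘ a ∧ x ∈ₘ y :=
  mem_compr (hM.out.union a)

/-- The power set. -/
noncomputable def pow (a : M) : M := compr fun x => ∀ z, z ∈ₘ x → z ∈ₘ a

theorem mem_pow {a x : M} : x ∈ₘ pow a ↔ ∀ z, z ∈ₘ x → z ∈ₘ a :=
  mem_compr (hM.out.powerset a)

theorem zero_mem_pow (a : M) : zero M ∈ₘ pow a := mem_pow.2 fun _ h => (not_mem_zero _ h).elim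

theorem exists_union (a b : M) : ∃ c : M, ∀ x, x ∈ₘ c ↔ x ∈ₘ a ∨ x ∈ₘ b :=
  ⟨sUnion (upair a b), fun x => by simp [mem_sUnion, mem_upair]⟩

theorem mem_succ {x y : M} : y ∈ₘ succ x ↔ y ∈ₘ x ∨ y = x := by
  obtain ⟨c, hc⟩ := exists_union x (upair x x)
  exact mem_compr ⟨c, fun z => by simp [hc, mem_upair]⟩

theorem mem_one {x : M} : x ∈ₘ one M ↔ x = zero M := by
  simp [one, mem_succ, not_mem_zero]

theorem mem_two {x : M} : x ∈ₘ two M ↔ x = zero M ∨ x = one M := by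
  rw [two, mem_succ, mem_one]

theorem one_ne_zero : one M ≠ zero M := fun h => by
  have h1 : zero M ∈ₘ one M := mem_one.2 rfl
  exact not_mem_zero _ (h ▸ h1)

theorem pair_ne_zero (x y : M) : pair x y ≠ zero M := fun h =>
  not_mem_zero (upair x x) (h ▸ mem_upair.2 (Or.inl rfl))

theorem not_mem_and_mem {x y : M} (h1 : x ∈ₘ y) (h2 : y ∈ₘ x) : False := by
  obtain ⟨z, hz, h⟩ := hM.out.foundation (upair x y) ⟨x, mem_upair.2 (Or.inl rfl)⟩
  rcases mem_upair.1 hz with rfl | rfl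
  · exact h y (mem_upair.2 (Or.inr rfl)) h2
  · exact h x (mem_upair.2 (Or.inl rfl)) h1

theorem succ_inj {x y : M} (h : succ x = succ y) : x = y := by
  have h1 : x ∈ₘ succ y := h ▸ mem_succ.2 (Or.inr rfl)
  have h2 : y ∈ₘ succ x := h ▸ mem_succ.2 (Or.inr rfl)
  rcases mem_succ.1 h1 with h1 | h1
  · rcases mem_succ.1 h2 with h2 | h2
    · exact (not_mem_and_mem h1 h2).elim
    · exact h2.symm
  · exact h1

theorem succ_ne_zero (x : M) : succ x ≠ zero M := fun h =>
  not_mem_zero x (h ▸ mem_succ.2 (Or.inr rfl))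

theorem eq_iff {a b : M} : a = b ↔ ∀ x, x ∈ₘ a ↔ x ∈ₘ b := ⟨fun h _ => h ▸ Iff.rfl, ext⟩

section definability
variable {Y : Type*} [Ctx M Y] {t s : Y → M} [ht : DefFun t] [hs : DefFun s]

theorem DefFun.of_mem {t : Y → M} {P : Y → M → Prop} [hP : DefPred M fun p : Y × M => P p.1 p.2]
    (h : ∀ y x, x ∈ₘ t y ↔ P y x) : DefFun t := by
  have : DefPred M fun p : (Y × M) × M => P p.1.1 p.2 :=
    hP.comp fun p : (Y × M) × M => (p.1.1, p.2)
  exact DefFun.of_pred (P := fun y z => ∀ x, x ∈ₘ z ↔ P y x) fun y z => by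
    simp only [eq_iff, h]

theorem defFun_weaken (ht : DefFun t) : DefFun fun p : Y × M => t p.1 := ht.comp _

instance instDefFunUpair : DefFun fun y => upair (t y) (s y) :=
  have := defFun_weaken ht
  have := defFun_weaken hs
  .of_mem (P := fun y x => x = t y ∨ x = s y) fun _ _ => mem_upair

instance instDefFunPair : DefFun fun y => pair (t y) (s y) :=
  inferInstanceAs (DefFun fun y => upair (upair (t y) (t y)) (upair (t y) (s y)))

instance instDefFunSucc : DefFun fun y => succ (t y) :=
  have := defFun_weaken ht
  .of_mem (P := fun y x => x ∈ₘ t y ∨ x = t y) fun _ _ => mem_succ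

instance instDefFunIte {P : Y → Prop} [hP : DefPred M P] [∀ y, Decidable (P y)] :
    DefFun fun y => if P y then t y else s y :=
  have := defFun_weaken ht
  have := defFun_weaken hs
  have : DefPred M fun p : Y × M => P p.1 := hP.comp _
  .of_pred (P := fun y x => (P y ∧ x = t y) ∨ (¬ P y ∧ x = s y)) fun y x => by
    by_cases h : P y <;> simp [h]

end definability

end GroundModel
end

/-! ### Replacement, products, induction and iteration on `ω` -/

noncomputable section
variable {M : Type u} [langSet.Structure M] [Nonempty M] [hM : Fact (IsModelZFC M)]

namespace GroundModel

/-- The image of the set `a` under a function. -/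
def image (t : M → M) (a : M) : M := compr fun y => ∃ x, x ∈ₘ a ∧ y = t x

theorem mem_image {t : M → M} [ht : DefFun₁ t] {a y : M} :
    y ∈ₘ image t a ↔ ∃ x, x ∈ₘ a ∧ y = t x := by
  refine mem_compr ?_
  obtain ⟨S, hS, hP⟩ := ht.out
  have h1 := definable_subst (β := Fin 2) hS fun n =>
    Nat.casesOn n (Sum.inl 1) fun n => Nat.casesOn n (Sum.inl 0) fun _ =>
      Sum.inr (Classical.arbitrary M)
  obtain ⟨b, hb⟩ := hM.out.replacement {p | p.2 = t p.1} (by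
    unfold Set.Definable₂
    refine (congrArg _ (Set.ext fun v => ?_)).mpr h1
    simp only [Set.mem_ofPred_eq]
    rw [hP ((PUnit.unit, v 0), v 1)]
    refine iff_of_eq (congrArg (· ∈ S) (funext fun n => ?_))
    rcases n with _ | _ | n <;> rfl) a (fun x _ y z h1 h2 => h1.trans h2.symm)
  exact ⟨b, hb⟩

theorem mem_sep {P : M → Prop} [DefPred M fun p : PUnit.{u + 1} × M => P p.2] {a x : M} :
    x ∈ₘ compr (fun x => x ∈ₘ a ∧ P x) ↔ x ∈ₘ a ∧ P x :=
  mem_compr_of_subset a fun _ h => h.1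

/-- Cartesian product. -/
def times (a b : M) : M := compr fun z => ∃ x, x ∈ₘ a ∧ ∃ y, y ∈ₘ b ∧ z = pair x y

theorem mem_times {a b z : M} : z ∈ₘ times a b ↔ ∃ x, x ∈ₘ a ∧ ∃ y, y ∈ₘ b ∧ z = pair x y := by
  obtain ⟨c, hc⟩ := exists_union a b
  refine mem_compr_of_subset (pow (pow c)) fun z hz => ?_
  obtain ⟨x, hx, y, hy, rfl⟩ := hz
  refine mem_pow.2 fun w hw => mem_pow.2 fun v hv => (hc v).2 ?_
  rcases mem_upair.1 hw with rfl | rfl <;> rcases mem_upair.1 hv with rfl | rfl <;> simp [hx, hy]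

theorem pair_mem_times {a b x y : M} : pair x y ∈ₘ times a b ↔ x ∈ₘ a ∧ y ∈ₘ b := by
  rw [mem_times]
  constructor
  · rintro ⟨x', hx, y', hy, h⟩
    obtain ⟨rfl, rfl⟩ := pair_inj.1 h
    exact ⟨hx, hy⟩
  · exact fun ⟨hx, hy⟩ => ⟨x, hx, y, hy, rfl⟩

theorem mem_omega {n : M} : n ∈ₘ omega M ↔
    ∀ a : M, zero M ∈ₘ a → (∀ x, x ∈ₘ a → succ x ∈ₘ a) → n ∈ₘ a := by
  obtain ⟨a, ⟨e, he, he0⟩, hs⟩ := hM.out.infinity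
  refine mem_compr_of_subset a fun n hn => hn a ?_ fun x hx => ?_
  · rwa [ext (a := zero M) (b := e) fun x => iff_of_false (not_mem_zero x) (he0 x)]
  · obtain ⟨s, hsa, h⟩ := hs x hx
    rwa [ext (a := succ x) (b := s) fun z => by rw [mem_succ, h]]

theorem zero_mem_omega : zero M ∈ₘ omega M := mem_omega.2 fun _ h _ => h

theorem succ_mem_omega {n : M} (h : n ∈ₘ omega M) : succ n ∈ₘ omega M :=
  mem_omega.2 fun a h0 hs => hs _ (mem_omega.1 h a h0 hs)

theorem one_mem_omega : one M ∈ₘ omega M := succ_mem_omega zero_mem_omega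

theorem omega_induction {P : M → Prop} [DefPred M fun p : PUnit.{u + 1} × M => P p.2]
    (h0 : P (zero M)) (hs : ∀ n, n ∈ₘ omega M → P n → P (succ n)) {n : M} (hn : n ∈ₘ omega M) :
    P n := by
  refine (mem_sep.1 (mem_omega.1 hn (compr fun x => x ∈ₘ omega M ∧ P x) ?_ fun x hx => ?_)).2
  · exact mem_sep.2 ⟨zero_mem_omega, h0⟩
  · obtain ⟨h1, h2⟩ := mem_sep.1 hx
    exact mem_sep.2 ⟨succ_mem_omega h1, hs x h1 h2⟩

theorem omega_cases {n : M} (hn : n ∈ₘ omega M) : n = zero M ∨ ∃ m, m ∈ₘ omega M ∧ n = succ m :=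
  omega_induction (P := fun n => n = zero M ∨ ∃ m, m ∈ₘ omega M ∧ n = succ m) (.inl rfl)
    (fun n hn _ => .inr ⟨n, hn, rfl⟩) hn

/-- The pair `(n, y)` belongs to every relation that contains `(0, x₀)` and is closed under
`(k, x) ↦ (k + 1, s x)` for `x ∈ X`. -/
def IterRel (X : M) (s : M → M) (x₀ n y : M) : Prop :=
  ∀ g : M, pair (zero M) x₀ ∈ₘ g →
    (∀ k x, x ∈ₘ X → pair k x ∈ₘ g → pair (succ k) (s x) ∈ₘ g) → pair n y ∈ₘ g

open scoped Classical in
/-- The `n`-th iterate of `s : X → X` at `x₀`. -/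
def iter (X : M) (s : M → M) (x₀ n : M) : M :=
  if n ∈ₘ omega M ∧ x₀ ∈ₘ X then Classical.epsilon fun y => y ∈ₘ X ∧ IterRel X s x₀ n y else zero M

section iter
variable {X x₀ n y : M} {s : M → M}

theorem IterRel.zero : IterRel X s x₀ (zero M) x₀ := fun _ h _ => h

theorem IterRel.succ (hy : y ∈ₘ X) (h : IterRel X s x₀ n y) : IterRel X s x₀ (succ n) (s y) :=
  fun g h0 hs => hs n y hy (h g h0 hs)

variable [hs : DefFun₁ s] (hsX : ∀ x, x ∈ₘ X → s x ∈ₘ X)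
include hsX

/-- The pairs satisfying `P` form a set, by separation inside `ω × X`, and this set is closed under
the defining clauses. The bound `X` on the values is what makes them a set. -/
theorem IterRel.induction (hx : x₀ ∈ₘ X) {P : M → M → Prop}
    [DefPred M fun p : (PUnit.{u + 1} × M) × M => P p.1.2 p.2] (h0 : P (GroundModel.zero M) x₀)
    (h1 : ∀ k x, k ∈ₘ omega M → x ∈ₘ X → P k x → P (GroundModel.succ k) (s x))
    (h : IterRel X s x₀ n y) : P n y := by
  have hd : DefPred M fun p : PUnit.{u + 1} × M => ∃ k x, k ∈ₘ omega M ∧ x ∈ₘ X ∧ P k x ∧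
      p.2 = pair k x := by
    have : DefPred M fun p : ((PUnit.{u + 1} × M) × M) × M => P p.1.2 p.2 :=
      DefPred.comp ‹_› fun p : ((PUnit.{u + 1} × M) × M) × M => ((PUnit.unit, p.1.2), p.2)
    infer_instance
  have hm : ∀ k x, pair k x ∈ₘ compr (fun z => ∃ k x, k ∈ₘ omega M ∧ x ∈ₘ X ∧ P k x ∧
      z = pair k x) ↔ k ∈ₘ omega M ∧ x ∈ₘ X ∧ P k x := fun k x => by
    rw [mem_compr_of_subset (times (omega M) X)]
    · constructor
      · rintro ⟨k', x', h1, h2, h3, h⟩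
        obtain ⟨rfl, rfl⟩ := pair_inj.1 h
        exact ⟨h1, h2, h3⟩
      · exact fun ⟨h1, h2, h3⟩ => ⟨k, x, h1, h2, h3, rfl⟩
    · rintro _ ⟨k, x, h1, h2, h3, rfl⟩
      exact pair_mem_times.2 ⟨h1, h2⟩
  refine ((hm n y).1 (h _ ((hm _ _).2 ⟨zero_mem_omega, hx, h0⟩) fun k x hx hk => ?_)).2.2
  obtain ⟨h2, h3, h4⟩ := (hm _ _).1 hk
  exact (hm _ _).2 ⟨succ_mem_omega h2, hsX _ h3, h1 _ _ h2 h3 h4⟩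

instance {Y : Type*} [Ctx M Y] {t n y : Y → M} [DefFun t] [DefFun n] [DefFun y] :
    DefPred M fun z => IterRel X s (t z) (n z) (y z) := by
  have : DefFun fun p : Y × M => t p.1 := .comp ‹_› _
  have : DefFun fun p : Y × M => n p.1 := .comp ‹_› _
  have : DefFun fun p : Y × M => y p.1 := .comp ‹_› _
  have : DefFun fun p : ((Y × M) × M) × M => s p.2 := hs.comp _
  unfold IterRel
  infer_instance

theorem iterRel_zero (hx : x₀ ∈ₘ X) (h : IterRel X s x₀ (zero M) y) : y = x₀ := by
  refine IterRel.induction hsX hx (P := fun n y => n = GroundModel.zero M → y = x₀)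
    (fun _ => rfl) (fun k x _ _ _ h => (succ_ne_zero _ h).elim) h rfl

theorem iterRel_succ (hx : x₀ ∈ₘ X) (h : IterRel X s x₀ (succ n) y) :
    ∃ x, x ∈ₘ X ∧ IterRel X s x₀ n x ∧ y = s x := by
  have : DefFun fun p : ((PUnit.{u + 1} × M) × M) × M => s p.2 := hs.comp _
  have : DefFun fun p : (((PUnit.{u + 1} × M) × M) × M) × M => s p.2 := hs.comp _
  -- `IterRel` itself is carried along in the induction, so that at a successor stage the preceding
  -- pair is known to be in the relation.
  refine (IterRel.induction hsX hx (P := fun n y => IterRel X s x₀ n y ∧ ∀ m, n = succ m →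
    ∃ x, x ∈ₘ X ∧ IterRel X s x₀ m x ∧ y = s x) ⟨.zero, fun m h => (succ_ne_zero _ h.symm).elim⟩
    (fun k x _ hx h => ⟨h.1.succ hx, fun m hm => ⟨x, hx, succ_inj hm ▸ h.1, rfl⟩⟩) h).2 n rfl

theorem iterRel_existsUnique (hx : x₀ ∈ₘ X) (hn : n ∈ₘ omega M) :
    ∃ y, (y ∈ₘ X ∧ IterRel X s x₀ n y) ∧ ∀ z, IterRel X s x₀ n z → z = y := by
  refine omega_induction (P := fun n => ∃ y, (y ∈ₘ X ∧ IterRel X s x₀ n y) ∧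
    ∀ z, IterRel X s x₀ n z → z = y) ?_ ?_ hn
  · exact ⟨x₀, ⟨hx, .zero⟩, fun z hz => iterRel_zero hsX hx hz⟩
  · rintro n hn ⟨y, ⟨hy, h⟩, huniq⟩
    refine ⟨s y, ⟨hsX _ hy, h.succ hy⟩, fun z hz => ?_⟩
    obtain ⟨x, -, hx, rfl⟩ := iterRel_succ hsX hx hz
    rw [huniq x hx]

theorem iter_spec (hx : x₀ ∈ₘ X) (hn : n ∈ₘ omega M) :
    iter X s x₀ n ∈ₘ X ∧ ∀ z, IterRel X s x₀ n z ↔ z = iter X s x₀ n := by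
  obtain ⟨y, hy, huniq⟩ := iterRel_existsUnique hsX hx hn
  have h := Classical.epsilon_spec (p := fun y => y ∈ₘ X ∧ IterRel X s x₀ n y) ⟨y, hy⟩
  rw [iter, if_pos ⟨hn, hx⟩]
  refine ⟨h.1, fun z => ⟨fun hz => ?_, fun hz => hz ▸ h.2⟩⟩
  rw [huniq z hz, huniq _ h.2]

theorem iter_mem (hx : x₀ ∈ₘ X) (hn : n ∈ₘ omega M) : iter X s x₀ n ∈ₘ X :=
  (iter_spec hsX hx hn).1

theorem iter_zero (hx : x₀ ∈ₘ X) : iter X s x₀ (zero M) = x₀ :=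
  (((iter_spec hsX hx zero_mem_omega).2 _).1 .zero).symm

theorem iter_succ (hx : x₀ ∈ₘ X) (hn : n ∈ₘ omega M) :
    iter X s x₀ (succ n) = s (iter X s x₀ n) :=
  (((iter_spec hsX hx (succ_mem_omega hn)).2 _).1
    ((((iter_spec hsX hx hn).2 _).2 rfl).succ (iter_mem hsX hx hn))).symm

theorem defFun_iter {Y : Type*} [Ctx M Y] (t n : Y → M) [DefFun t] [DefFun n] :
    DefFun fun y => iter X s (t y) (n y) := by
  have : DefFun fun p : Y × M => t p.1 := .comp ‹_› _
  have : DefFun fun p : Y × M => n p.1 := .comp ‹_› _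
  refine .of_pred (P := fun y x => ((n y ∈ₘ omega M ∧ t y ∈ₘ X) ∧ IterRel X s (t y) (n y) x) ∨
    (¬ (n y ∈ₘ omega M ∧ t y ∈ₘ X) ∧ x = zero M)) fun y x => ?_
  by_cases h : n y ∈ₘ omega M ∧ t y ∈ₘ X
  · simp only [h, (iter_spec hsX h.2 h.1).2, and_self, not_true_eq_false, false_and, or_false,
      true_and]
  · simp only [iter, h, if_false, false_and, false_or, true_and, not_false_eq_true]

end iter

/-! Doubling and pairing of integers. -/

variable (M) in
theorem succ_succ_mem_omega : ∀ x : M, x ∈ₘ omega M → succ (succ x) ∈ₘ omega M :=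
  fun _ h => succ_mem_omega (succ_mem_omega h)

/-- `2 n`. -/
def double (n : M) : M := iter (omega M) (fun x => succ (succ x)) (zero M) n

instance {Y : Type*} [Ctx M Y] {t : Y → M} [DefFun t] : DefFun fun y => double (t y) :=
  defFun_iter (succ_succ_mem_omega M) (fun _ => zero M) t

theorem double_mem {n : M} (hn : n ∈ₘ omega M) : double n ∈ₘ omega M :=
  iter_mem (succ_succ_mem_omega M) zero_mem_omega hn

theorem double_zero : double (zero M) = zero M :=
  iter_zero (succ_succ_mem_omega M) zero_mem_omega

theorem double_succ {n : M} (hn : n ∈ₘ omega M) : double (succ n) = succ (succ (double n)) :=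
  iter_succ (succ_succ_mem_omega M) zero_mem_omega hn

theorem double_ne_succ_double {n m : M} (hn : n ∈ₘ omega M) (hm : m ∈ₘ omega M) :
    double n ≠ succ (double m) := by
  refine omega_induction (P := fun n => ∀ m, m ∈ₘ omega M → double n ≠ succ (double m)) ?_ ?_ hn m hm
  · intro m _ h
    rw [double_zero] at h
    exact succ_ne_zero _ h.symm
  · intro n hn ih m hm h
    rw [double_succ hn] at h
    have h := succ_inj h
    rcases omega_cases hm with rfl | ⟨k, hk, rfl⟩
    · exact succ_ne_zero _ (h.trans double_zero)
    · rw [double_succ hk] at h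
      exact ih k hk (succ_inj h)

theorem double_inj {n m : M} (hn : n ∈ₘ omega M) (hm : m ∈ₘ omega M) (h : double n = double m) :
    n = m := by
  refine omega_induction (P := fun n => ∀ m, m ∈ₘ omega M → double n = double m → n = m)
    ?_ ?_ hn m hm h
  · intro m hm h
    rcases omega_cases hm with rfl | ⟨k, hk, rfl⟩
    · rfl
    · rw [double_zero, double_succ hk] at h
      exact (succ_ne_zero _ h.symm).elim
  · intro n hn ih m hm h
    rcases omega_cases hm with rfl | ⟨k, hk, rfl⟩
    · rw [double_zero, double_succ hn] at h
      exact (succ_ne_zero _ h).elim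
    · rw [double_succ hk, double_succ hn] at h
      rw [ih k hk (succ_inj (succ_inj h))]

theorem exists_double {n : M} (hn : n ∈ₘ omega M) :
    ∃ m, m ∈ₘ omega M ∧ (n = double m ∨ n = succ (double m)) := by
  refine omega_induction (P := fun n => ∃ m, m ∈ₘ omega M ∧ (n = double m ∨ n = succ (double m)))
    ?_ ?_ hn
  · exact ⟨_, zero_mem_omega, .inl double_zero.symm⟩
  · rintro n hn ⟨m, hm, rfl | rfl⟩
    · exact ⟨m, hm, .inr rfl⟩
    · exact ⟨succ m, succ_mem_omega hm, .inl (double_succ hm).symm⟩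

/-- The injective pairing `(a, b) ↦ 2ᵃ (2 b + 1)` of integers. -/
def pairing (a b : M) : M := iter (omega M) double (succ (double b)) a

instance {Y : Type*} [Ctx M Y] {t s : Y → M} [DefFun t] [DefFun s] :
    DefFun fun y => pairing (t y) (s y) :=
  defFun_iter (fun _ => double_mem) (fun y => succ (double (s y))) t

theorem pairing_zero {b : M} (hb : b ∈ₘ omega M) : pairing (zero M) b = succ (double b) :=
  iter_zero (fun _ => double_mem) (succ_mem_omega (double_mem hb))

theorem pairing_succ {a b : M} (ha : a ∈ₘ omega M) (hb : b ∈ₘ omega M) :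
    pairing (succ a) b = double (pairing a b) :=
  iter_succ (fun _ => double_mem) (succ_mem_omega (double_mem hb)) ha

theorem pairing_mem {a b : M} (ha : a ∈ₘ omega M) (hb : b ∈ₘ omega M) : pairing a b ∈ₘ omega M :=
  iter_mem (fun _ => double_mem) (succ_mem_omega (double_mem hb)) ha

theorem pairing_inj {a b a' b' : M} (ha : a ∈ₘ omega M) (hb : b ∈ₘ omega M) (ha' : a' ∈ₘ omega M)
    (hb' : b' ∈ₘ omega M) (h : pairing a b = pairing a' b') : a = a' ∧ b = b' := by
  refine omega_induction (P := fun a => ∀ a', a' ∈ₘ omega M → pairing a b = pairing a' b' →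
    a = a' ∧ b = b') ?_ ?_ ha a' ha' h
  · intro a' ha' h
    rcases omega_cases ha' with rfl | ⟨k, hk, rfl⟩
    · rw [pairing_zero hb, pairing_zero hb'] at h
      exact ⟨rfl, double_inj hb hb' (succ_inj h)⟩
    · rw [pairing_zero hb, pairing_succ hk hb'] at h
      exact (double_ne_succ_double (pairing_mem hk hb') hb h.symm).elim
  · intro a ha ih a' ha' h
    rcases omega_cases ha' with rfl | ⟨k, hk, rfl⟩
    · rw [pairing_zero hb', pairing_succ ha hb] at h
      exact (double_ne_succ_double (pairing_mem ha hb) hb' h).elim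
    · rw [pairing_succ ha hb, pairing_succ hk hb'] at h
      obtain ⟨rfl, h2⟩ := ih k hk (double_inj (pairing_mem ha hb) (pairing_mem hk hb') h)
      exact ⟨rfl, h2⟩

end GroundModel
end

/-! ### Definable families of formulas -/

noncomputable section
variable {M : Type u} [langSet.Structure M] [Nonempty M] {A : RealizabilityAlgebra M}

open TV

namespace TV

/-- The individual `t` is a term which realizes `F`. -/
def ForceM (t : M) (F : TV A) : Prop := ∃ h : t ∈ₘ A.Lam, Force ⟨t, h⟩ F

/-- The individual `p` is a stack in the falsity value `F`. -/
def MemM (p : M) (F : TV A) : Prop := ∃ h : p ∈ₘ A.Stk, Mem ⟨p, h⟩ F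

theorem memM_coe {p : El A.Stk} {F : TV A} : MemM p.1 F ↔ Mem p F := ⟨fun ⟨_, h⟩ => h, fun h => ⟨p.2, h⟩⟩

theorem forceM_coe {t : El A.Lam} {F : TV A} : ForceM t.1 F ↔ Force t F :=
  ⟨fun ⟨_, h⟩ => h, fun h => ⟨t.2, h⟩⟩

/-- The falsity value `⊥` if `c`, and `⊤` otherwise: it refutes `c`. -/
def refute (c : Prop) : TV A := {_p : El A.Stk | c}

/-- The formula which is equivalent to `⊤` if `c`, and is `⊤ → ⊥` otherwise. -/
def prop (c : Prop) : TV A := neg (refute c)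

/-- The falsity value `F` if `c`, and `⊤` otherwise. -/
def guard (c : Prop) (F : TV A) : TV A := {p : El A.Stk | c ∧ Mem p F}

theorem neps_eq_refute {a b : M} {c : Prop} (h : ∀ p : El A.Stk, pair a p.1 ∈ₘ b ↔ c) :
    (neps a b : TV A) = refute c := ext h

end TV

/-- A definable family of formulas. -/
class DefTV {Y : Type*} [Ctx M Y] (F : Y → TV A) : Prop where
  out : DefPred M fun p : Y × M => MemM p.2 (F p.1)

namespace DefTV
variable {Y Z : Type*} [Ctx M Y] [Ctx M Z] {F G : Y → TV A} {t s : Y → M}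

theorem comp (h : DefTV F) (f : Z → Y) [hf : CtxMap M f] : DefTV fun z => F (f z) := by
  have : CtxMap M fun p : Z × M => (f p.1, p.2) := hf.lift
  exact ⟨h.out.comp fun p : Z × M => (f p.1, p.2)⟩

end DefTV

namespace DefPred
variable {Y : Type*} [Ctx M Y] {F : Y → TV A} {t : Y → M}

variable [hM : Fact (IsModelZFC M)]

instance memM [hF : DefTV F] [DefFun t] : DefPred M fun y => MemM (t y) (F y) :=
  subst (P := fun y x => MemM x (F y)) hF.out t

/-- The operation `⋆` and the pole are individuals of the ground model, so realizing a definable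
formula is definable there. Inductions on numerals and the diagonal set rely on this. -/
instance forceM [hF : DefTV F] [DefFun t] : DefPred M fun y => ForceM (t y) (F y) := by
  obtain ⟨g, hg⟩ := A.star_internal
  have : DefTV fun p : (Y × M) × M => F p.1.1 := hF.comp _
  have h : DefPred M fun p : Y × M => p.2 ∈ₘ A.Lam ∧ ∀ q, MemM q (F p.1) →
      ∃ r, r ∈ₘ A.Proc ∧ r ∈ₘ A.pole ∧ pair (pair p.2 q) r ∈ₘ g := inferInstance
  refine subst (P := fun y x => ForceM x (F y)) (h.congr fun p => ?_) t
  constructor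
  · rintro ⟨h1, h2⟩
    refine ⟨h1, fun q hq => ?_⟩
    obtain ⟨r, h3, h4, h5⟩ := h2 q.1 (memM_coe.2 hq)
    rw [hg ⟨p.2, h1⟩ q ⟨r, h3⟩] at h5
    rwa [h5]
  · rintro ⟨h1, h2⟩
    refine ⟨h1, fun q ⟨hq, hq'⟩ => ?_⟩
    exact ⟨_, (A.star ⟨p.2, h1⟩ ⟨q, hq⟩).2, h2 _ hq',
      (hg ⟨p.2, h1⟩ ⟨q, hq⟩ (A.star ⟨p.2, h1⟩ ⟨q, hq⟩)).2 rfl⟩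

end DefPred

namespace DefTV
variable {Y : Type*} [Ctx M Y] {F G : Y → TV A} {t s : Y → M}

instance bot : DefTV fun _ : Y => (TV.bot : TV A) :=
  ⟨DefPred.congr (P := fun p => p.2 ∈ₘ A.Stk) inferInstance fun _ => ⟨fun h => ⟨h, trivial⟩, fun h => h.1⟩⟩

variable [hM : Fact (IsModelZFC M)]

instance imp [hF : DefTV F] [hG : DefTV G] : DefTV fun y => F y ⇾ G y := by
  obtain ⟨g, hg⟩ := A.push_internal
  have : DefTV fun p : ((Y × M) × M) × M => F p.1.1.1 := hF.comp _
  have : DefTV fun p : ((Y × M) × M) × M => G p.1.1.1 := hG.comp _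
  refine ⟨DefPred.congr (P := fun q : Y × M => ∃ t p, ForceM t (F q.1) ∧ MemM p (G q.1) ∧ q.2 ∈ₘ A.Stk ∧
    pair (pair t p) q.2 ∈ₘ g) inferInstance fun q => ?_⟩
  constructor
  · rintro ⟨t, p, ⟨ht, ht'⟩, ⟨hp, hp'⟩, hq, h⟩
    exact ⟨hq, ⟨t, ht⟩, ⟨p, hp⟩, ht', hp', ((hg ⟨t, ht⟩ ⟨p, hp⟩ ⟨q.2, hq⟩).1 h).symm⟩
  · rintro ⟨hq, t, p, ht, hp, h⟩
    exact ⟨t.1, p.1, forceM_coe.2 ht, memM_coe.2 hp, hq, (hg t p ⟨q.2, hq⟩).2 h.symm⟩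

instance all {F : Y → M → TV A} [hF : DefTV fun p : Y × M => F p.1 p.2] :
    DefTV fun y => TV.all (F y) := by
  have : DefTV fun p : (Y × M) × M => F p.1.1 p.2 :=
    hF.comp fun p : (Y × M) × M => (p.1.1, p.2)
  refine ⟨DefPred.congr (P := fun q : Y × M => ∃ a, MemM q.2 (F q.1 a)) inferInstance fun q => ?_⟩
  exact ⟨fun ⟨a, h, h'⟩ => ⟨h, a, h'⟩, fun ⟨h, a, h'⟩ => ⟨a, h, h'⟩⟩

instance neps [ht : DefFun t] [hs : DefFun s] : DefTV fun y => (TV.neps (t y) (s y) : TV A) :=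
  have : DefFun fun p : Y × M => t p.1 := ht.comp _
  have : DefFun fun p : Y × M => s p.1 := hs.comp _
  ⟨DefPred.congr (P := fun q : Y × M => q.2 ∈ₘ A.Stk ∧ pair (t q.1) q.2 ∈ₘ s q.1) inferInstance
    fun _ => exists_prop.symm⟩

instance refute {P : Y → Prop} [hP : DefPred M P] : DefTV fun y => (TV.refute (P y) : TV A) :=
  have : DefPred M fun p : Y × M => P p.1 := hP.comp _
  ⟨DefPred.congr (P := fun q : Y × M => q.2 ∈ₘ A.Stk ∧ P q.1) inferInstance
    fun _ => exists_prop.symm⟩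

instance guard {P : Y → Prop} [hP : DefPred M P] [hF : DefTV F] :
    DefTV fun y => TV.guard (P y) (F y) :=
  have : DefPred M fun p : Y × M => P p.1 := hP.comp _
  have : DefTV fun p : Y × M => F p.1 := hF.comp _
  ⟨DefPred.congr (P := fun q : Y × M => P q.1 ∧ MemM q.2 (F q.1)) inferInstance
    fun _ => ⟨fun ⟨h, h1, h2⟩ => ⟨h1, h, h2⟩, fun ⟨h1, h, h2⟩ => ⟨h, h1, h2⟩⟩⟩

instance neg [DefTV F] : DefTV fun y => TV.neg (F y) :=
  inferInstanceAs (DefTV fun y => F y ⇾ TV.bot)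

instance prop {P : Y → Prop} [DefPred M P] : DefTV fun y => (TV.prop (P y) : TV A) :=
  inferInstanceAs (DefTV fun y => TV.neg (TV.refute (P y)))

instance and [DefTV F] [DefTV G] : DefTV fun y => F y ⩓ G y :=
  inferInstanceAs (DefTV fun y => (F y ⇾ G y ⇾ TV.bot) ⇾ TV.bot)

instance or [DefTV F] [DefTV G] : DefTV fun y => F y ⩔ G y :=
  inferInstanceAs (DefTV fun y => TV.neg (F y) ⇾ TV.neg (G y) ⇾ TV.bot)

instance iff [DefTV F] [DefTV G] : DefTV fun y => TV.iff (F y) (G y) :=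
  inferInstanceAs (DefTV fun y => (F y ⇾ G y) ⩓ (G y ⇾ F y))

instance ex {F : Y → M → TV A} [DefTV fun p : Y × M => F p.1 p.2] :
    DefTV fun y => TV.ex (F y) :=
  inferInstanceAs (DefTV fun y => TV.neg (TV.all fun x => TV.neg (F y x)))

instance eps [DefFun t] [DefFun s] : DefTV fun y => (t y ε' s y : TV A) :=
  inferInstanceAs (DefTV fun y => TV.neg (TV.neps (t y) (s y)))

instance eq [ht : DefFun t] [hs : DefFun s] : DefTV fun y => (t y ≐ s y : TV A) :=
  have : DefFun fun p : Y × M => t p.1 := ht.comp _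
  have : DefFun fun p : Y × M => s p.1 := hs.comp _
  inferInstanceAs (DefTV fun y => TV.all fun z => TV.neps (t y) z ⇾ TV.neps (s y) z)

end DefTV

end

/-! ### Atomic formulas -/

noncomputable section
variable {M : Type u} [langSet.Structure M] [Nonempty M] {A : RealizabilityAlgebra M}

open TV RealizabilityAlgebra

namespace URealized
variable {X : Type*} {F G : X → TV A} {p q r : X → Prop}

theorem prop_intro (h : ∀ x, p x) : URealized fun x => (prop (p x) : TV A) :=
  of_mem fun x _ _ => h x

/-- `refute c` has no stack unless `c` holds, so each premise may be assumed true while the argument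
of its realizer is checked; `B` only composes the two realizers. -/
theorem prop_mono₂ (h : ∀ x, p x → q x → r x) :
    URealized fun x => (prop (p x) ⇾ prop (q x) ⇾ prop (r x) : TV A) := by
  refine ⟨A.cB, A.QP_cB, fun x => force_imp.2 fun s π hs hπ => ?_⟩
  obtain ⟨t, π, ht, ⟨v, π, hv, -, rfl⟩, rfl⟩ := hπ
  refine Ok.cB (force_imp.1 hs _ _ ?_ trivial)
  intro π' hp
  refine Ok.app (force_imp.1 ht v π' ?_ trivial)
  intro π'' hq
  exact hv π'' (h x hp hq)

theorem guard_elim : URealized fun x => guard (p x) (F x) ⇾ neg (F x) ⇾ refute (p x) := by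
  refine ⟨A.app A.cC A.cI, A.QP_app _ _ A.QP_cC A.QP_cI, fun x => force_imp.2 fun s π hs hπ => ?_⟩
  obtain ⟨t, π, ht, hp, rfl⟩ := hπ
  refine Ok.app (Ok.cC (Ok.cI (force_imp.1 ht s π ?_ trivial)))
  exact fun π' hπ' => hs π' ⟨hp, hπ'⟩

theorem guard_intro : URealized fun x => (prop (p x) ⇾ F x) ⇾ guard (p x) (F x) := by
  refine ⟨A.app (A.app A.cC A.cI) A.cI, A.QP_app _ _ (A.QP_app _ _ A.QP_cC A.QP_cI) A.QP_cI,
    fun x => force_imp.2 fun s π hs hπ => ?_⟩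
  refine Ok.app (Ok.app (Ok.cC (Ok.cI (force_imp.1 hs _ π ?_ hπ.2))))
  exact force_imp.2 fun t π' ht _ => Ok.cI (ht π' hπ.1)

end URealized

namespace MaxTheory
variable {X : Type*} (T : MaxTheory A X) {F G : X → TV A} {p q : X → Prop}

theorem holds_prop_mono₂ {r : X → Prop} (h : ∀ x, p x → q x → r x)
    (hp : T.holds fun x => prop (p x)) (hq : T.holds fun x => prop (q x)) :
    T.holds fun x => prop (r x) :=
  T.holds_imp.1 (T.mp (.prop_mono₂ h) hp) hq

/-- The filter of the classes of worlds which are valid according to `T`. -/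
def filter : Filter X where
  sets := {s | T.holds fun x => prop (x ∈ s)}
  univ_sets := T.of_uRealized (.prop_intro fun _ => trivial)
  sets_of_superset := fun h hst => T.holds_prop_mono₂ (fun _ h _ => hst h) h h
  inter_sets := fun h h' => T.holds_prop_mono₂ (fun _ h h' => ⟨h, h'⟩) h h'

theorem holds_prop : T.holds (fun x => prop (p x)) ↔ ∀ᶠ x in T.filter, p x := Iff.rfl

theorem holds_refute : T.holds (fun x => refute (p x)) ↔ ¬ ∀ᶠ x in T.filter, p x := by
  rw [← holds_prop]
  simp only [prop, holds_neg, not_not]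

theorem holds_guard : T.holds (fun x => guard (p x) (F x)) ↔
    ((∀ᶠ x in T.filter, p x) → T.holds F) := by
  constructor
  · intro h hp
    by_contra hF
    have := T.holds_imp.1 (T.mp .guard_elim h) (T.holds_neg.2 hF)
    exact T.holds_refute.1 this hp
  · exact fun h => T.mp .guard_intro (T.holds_imp.2 h)

/-- Substitution for arbitrary families of formulas. Where `g = h` the falsity values agree, and
elsewhere the guarded formula has an empty falsity value, so the identity realizes the passage from
one to the other. -/
theorem holds_congr {Y : Type*} (F : Y → TV A) {g h : X → Y} (hgh : ∀ᶠ x in T.filter, g x = h x) :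
    T.holds (fun x => F (g x)) ↔ T.holds fun x => F (h x) := by
  have key : ∀ g h : X → Y, (∀ᶠ x in T.filter, g x = h x) → T.holds (fun x => F (g x)) →
      T.holds fun x => F (h x) := fun g h hgh hg => by
    refine T.holds_guard.1 (T.mp ?_ hg) hgh
    exact .of_mem fun x p hp => by rw [hp.1]; exact hp.2
  exact ⟨key g h hgh, key h g (hgh.mono fun _ h => h.symm)⟩

end MaxTheory

section
variable [hM : Fact (IsModelZFC M)]

theorem pair_mem_gimel {X a : M} (p : El A.Stk) : pair a p.1 ∈ₘ A.gimel X ↔ a ∈ₘ X := by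
  have : ∀ z, (∃ x, x ∈ₘ X ∧ ∃ p : El A.Stk, z = pair x p.1) ↔ z ∈ₘ times X A.Stk := fun z => by
    rw [mem_times]
    exact exists_congr fun x => and_congr_right fun _ =>
      ⟨fun ⟨p, h⟩ => ⟨p.1, p.2, h⟩, fun ⟨p, hp, h⟩ => ⟨⟨p, hp⟩, h⟩⟩
  rw [gimel, mem_compr ⟨times X A.Stk, fun z => (this z).symm⟩, this, pair_mem_times]
  exact and_iff_left p.2

theorem eps_gimel (a X : M) : (a ε' A.gimel X : TV A) = prop (a ∈ₘ X) := by
  rw [eps, neps_eq_refute fun p => pair_mem_gimel p]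
  rfl

variable {X : Type*} (T : MaxTheory A X)

theorem MaxTheory.holds_eps_gimel (x a : X → M) :
    T.holds (fun ω => x ω ε' A.gimel (a ω)) ↔ ∀ᶠ ω in T.filter, x ω ∈ₘ a ω := by
  simp only [eps_gimel, holds_prop]

/-- Leibniz equality is tested on the individual `ℷ{y}`, for which non-membership is a `refute`; the
converse is substitution. -/
theorem MaxTheory.holds_eq (x y : X → M) :
    T.holds (fun ω => x ω ≐ y ω) ↔ ∀ᶠ ω in T.filter, x ω = y ω := by
  constructor
  · intro h
    have h1 : T.holds fun ω => neps (x ω) (A.gimel (upair (y ω) (y ω))) ⇾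
      neps (y ω) (A.gimel (upair (y ω) (y ω))) := T.mp (.all_elim _) h
    have h2 : ∀ a b : M, (neps a (A.gimel (upair b b)) : TV A) = refute (a = b) := fun a b =>
      neps_eq_refute fun p => by rw [pair_mem_gimel, mem_upair, or_self]
    simp only [h2, T.holds_imp, T.holds_refute] at h1
    by_contra hc
    exact h1 hc (.of_forall fun _ => trivial)
  · intro h
    refine (T.holds_congr (fun p : M × M => p.1 ≐ p.2) (g := fun ω => (x ω, x ω)) (h := fun ω => (x ω, y ω))
      (h.mono fun _ h => by rw [h])).1 (T.of_uRealized (.all_intro .id))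

/-! Separation. -/

/-- The individual that represents `{x ε a | F x}`. -/
def sepInd (F : M → TV A) (a : M) : M :=
  compr fun z => ∃ x p, z = pair x p ∧ MemM p (F x ⇾ neps x a)

theorem mem_sepInd {F : M → TV A} [hF : DefTV fun p : PUnit.{u + 1} × M => F p.2] {a z : M} :
    z ∈ₘ sepInd F a ↔ ∃ x p, z = pair x p ∧ MemM p (F x ⇾ neps x a) := by
  have : DefTV fun p : (PUnit.{u + 1} × M) × M => F p.2 :=
    hF.comp fun p : (PUnit.{u + 1} × M) × M => (PUnit.unit, p.2)
  have : DefTV fun p : ((PUnit.{u + 1} × M) × M) × M => F p.1.2 :=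
    hF.comp fun p : ((PUnit.{u + 1} × M) × M) × M => (PUnit.unit, p.1.2)
  -- `{x} ∈ (x, q) ∈ a`, so `x` lies in `⋃⋃a`, and the class is bounded by a set.
  refine mem_compr_of_subset (times (sUnion (sUnion a)) A.Stk) ?_
  rintro _ ⟨x, p, rfl, h, t, q, -, hq, -⟩
  refine pair_mem_times.2 ⟨mem_sUnion.2 ⟨upair x x, mem_sUnion.2 ⟨_, hq, ?_⟩, ?_⟩, h⟩ <;>
    exact mem_upair.2 (.inl rfl)

theorem neps_sepInd {F : M → TV A} [hF : DefTV fun p : PUnit.{u + 1} × M => F p.2] {a x : M} :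
    (neps x (sepInd F a) : TV A) = (F x ⇾ neps x a) := by
  ext p
  rw [mem_neps, mem_sepInd]
  constructor
  · rintro ⟨x', p', h, hp⟩
    obtain ⟨rfl, rfl⟩ := pair_inj.1 h
    exact memM_coe.1 hp
  · exact fun h => ⟨x, p.1, rfl, memM_coe.2 h⟩

theorem DefTV.at {Y : Type*} [Ctx M Y] {F : Y → M → TV A} (hF : DefTV fun p : Y × M => F p.1 p.2)
    (y : Y) : DefTV fun p : PUnit.{u + 1} × M => F y p.2 :=
  hF.comp fun p : PUnit.{u + 1} × M => (y, p.2)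

instance {Y : Type*} [Ctx M Y] {F : Y → M → TV A} {a : Y → M}
    [hF : DefTV fun p : Y × M => F p.1 p.2] [ha : DefFun a] :
    DefFun fun y => sepInd (F y) (a y) := by
  have : DefTV fun p : ((Y × M) × M) × M => F p.1.1.1 p.1.2 :=
    hF.comp fun p : ((Y × M) × M) × M => (p.1.1.1, p.1.2)
  have : DefFun fun p : ((Y × M) × M) × M => a p.1.1.1 := ha.comp _
  refine .of_mem (P := fun y z => ∃ x p, z = pair x p ∧ MemM p (F y x ⇾ TV.neps x (a y)))
    fun y z => ?_
  have := hF.at y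
  exact mem_sepInd

theorem MaxTheory.holds_eps_sepInd {Y : Type*} [Ctx M Y] {F : Y → M → TV A}
    [hF : DefTV fun p : Y × M => F p.1 p.2] (g : X → Y) (x a : X → M) :
    T.holds (fun ω => x ω ε' sepInd (F (g ω)) (a ω)) ↔
      T.holds (fun ω => F (g ω) (x ω)) ∧ T.holds fun ω => x ω ε' a ω := by
  have : ∀ y x a, (neps x (sepInd (F y) a) : TV A) = (F y x ⇾ neps x a) := fun y x a =>
    have := hF.at y
    neps_sepInd
  simp only [eps, this, holds_neg, holds_imp]
  tauto

/-! Projections of ordered pairs. -/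

open scoped Classical in
/-- The first component of a pair. -/
def fst (z : M) : M := if h : ∃ x y, z = pair x y then h.choose else zero M

open scoped Classical in
/-- The second component of a pair. -/
def snd (z : M) : M := if h : ∃ y x, z = pair x y then h.choose else zero M

theorem fst_pair (x y : M) : fst (pair x y) = x := by
  have h : ∃ x' y', pair x y = pair x' y' := ⟨x, y, rfl⟩
  rw [fst, dif_pos h]
  obtain ⟨y', h'⟩ := h.choose_spec
  exact (pair_inj.1 h').1.symm

theorem snd_pair (x y : M) : snd (pair x y) = y := by
  have h : ∃ y' x', pair x y = pair x' y' := ⟨y, x, rfl⟩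
  rw [snd, dif_pos h]
  obtain ⟨x', h'⟩ := h.choose_spec
  exact (pair_inj.1 h').2.symm

instance {Y : Type*} [Ctx M Y] {t : Y → M} [ht : DefFun t] : DefFun fun y => fst (t y) := by
  have : DefFun fun p : ((Y × M) × M) × M => t p.1.1.1 := ht.comp _
  have : DefFun fun p : (Y × M) × M => t p.1.1 := ht.comp _
  refine .of_pred (P := fun y x => (∃ v, t y = pair x v) ∨ (¬ ∃ w v, t y = pair w v) ∧ x = zero M)
    fun y x => ?_
  by_cases h : ∃ w v, t y = pair w v
  · obtain ⟨w, v, h⟩ := h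
    rw [h, fst_pair]
    constructor
    · rintro rfl
      exact .inl ⟨v, rfl⟩
    · rintro (⟨v', h'⟩ | ⟨h', -⟩)
      · exact (pair_inj.1 h').1.symm
      · exact (h' ⟨w, v, rfl⟩).elim
  · have h' : ¬ ∃ v, t y = pair x v := fun h' => h ⟨x, h'⟩
    simp only [fst, h, h', dif_neg, not_false_eq_true, true_and, false_or]

instance {Y : Type*} [Ctx M Y] {t : Y → M} [ht : DefFun t] : DefFun fun y => snd (t y) := by
  have : DefFun fun p : ((Y × M) × M) × M => t p.1.1.1 := ht.comp _
  have : DefFun fun p : (Y × M) × M => t p.1.1 := ht.comp _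
  refine .of_pred (P := fun y x => (∃ v, t y = pair v x) ∨ (¬ ∃ w v, t y = pair v w) ∧ x = zero M)
    fun y x => ?_
  by_cases h : ∃ w v, t y = pair v w
  · obtain ⟨w, v, h⟩ := h
    rw [h, snd_pair]
    constructor
    · rintro rfl
      exact .inl ⟨v, rfl⟩
    · rintro (⟨v', h'⟩ | ⟨h', -⟩)
      · exact (pair_inj.1 h').2.symm
      · exact (h' ⟨w, v, rfl⟩).elim
  · have h' : ¬ ∃ v, t y = pair v x := fun h' => h ⟨x, h'⟩
    simp only [snd, h, h', dif_neg, not_false_eq_true, true_and, false_or]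

/-! Images. -/

variable (A) in
/-- The individual that represents `{t x | x ε a}`. -/
def imgInd (t : M → M) (a : M) : M :=
  image (fun z => pair (t (fst z)) (snd z))
    (compr fun z => z ∈ₘ a ∧ ∃ x p, p ∈ₘ A.Stk ∧ z = pair x p)

theorem mem_imgInd {t : M → M} [ht : DefFun₁ t] {a z : M} :
    z ∈ₘ imgInd A t a ↔ ∃ x p, p ∈ₘ A.Stk ∧ pair x p ∈ₘ a ∧ z = pair (t x) p := by
  have : DefFun₁ fun z => pair (t (fst z)) (snd z) := by
    have : DefFun fun p : PUnit.{u + 1} × M => t (fst p.2) :=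
      DefFun₁.comp ht fun p : PUnit.{u + 1} × M => fst p.2
    infer_instance
  rw [imgInd, mem_image]
  constructor
  · rintro ⟨z, hz, rfl⟩
    obtain ⟨hz, x, p, hp, rfl⟩ := mem_sep.1 hz
    exact ⟨x, p, hp, hz, by rw [fst_pair, snd_pair]⟩
  · rintro ⟨x, p, hp, h, rfl⟩
    exact ⟨pair x p, mem_sep.2 ⟨h, x, p, hp, rfl⟩, by rw [fst_pair, snd_pair]⟩

theorem neps_imgInd {t : M → M} [ht : DefFun₁ t] {a w : M} :
    (neps w (imgInd A t a) : TV A) = TV.all fun x => guard (w = t x) (neps x a) := by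
  ext p
  rw [mem_neps, mem_imgInd, mem_all]
  constructor
  · rintro ⟨x, p', hp, hx, h⟩
    obtain ⟨rfl, rfl⟩ := pair_inj.1 h
    exact ⟨x, rfl, hx⟩
  · rintro ⟨x, rfl, hx⟩
    exact ⟨x, p.1, p.2, hx, rfl⟩

theorem DefFun.at {Y : Type*} [Ctx M Y] {t : Y → M → M} (ht : DefFun fun p : Y × M => t p.1 p.2)
    (y : Y) : DefFun₁ fun x => t y x :=
  ht.comp fun p : PUnit.{u + 1} × M => (y, p.2)

theorem defFun_imgInd {Y : Type*} [Ctx M Y] (t : Y → M → M) (a : Y → M)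
    [ht : DefFun fun p : Y × M => t p.1 p.2] [ha : DefFun a] :
    DefFun fun y => imgInd A (t y) (a y) := by
  have : DefFun fun p : ((Y × M) × M) × M => t p.1.1.1 p.1.2 :=
    ht.comp fun p : ((Y × M) × M) × M => (p.1.1.1, p.1.2)
  have : DefFun fun p : ((Y × M) × M) × M => a p.1.1.1 := ha.comp _
  refine .of_mem (P := fun y z => ∃ x p, p ∈ₘ A.Stk ∧ pair x p ∈ₘ a y ∧ z = pair (t y x) p)
    fun y z => ?_
  have := ht.at y
  exact mem_imgInd

/-- The falsity value of `w ∉ image` is a union over all candidate preimages, that is, a universal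
quantifier; when it fails, the preimage is provided by a Henkin witness. -/
theorem HenkinTheory.holds_eps_imgInd (T : HenkinTheory A) {Y : Type*} [Ctx M Y] (t : Y → M → M)
    [ht : DefFun fun p : Y × M => t p.1 p.2] (g : Gen A Y) (w a : Gen A M) :
    T.holds (fun ω => w ω ε' imgInd A (t (g ω)) (a ω)) ↔
      ∃ x : Gen A M, T.holds (fun ω => x ω ε' a ω) ∧ ∀ᶠ ω in T.filter, w ω = t (g ω) (x ω) := by
  have : ∀ y w a, (neps w (imgInd A (t y) a) : TV A) =
      TV.all fun x => guard (w = t y x) (neps x a) := fun y w a =>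
    have := ht.at y
    neps_imgInd
  simp only [eps, this, T.holds_neg]
  refine (not_congr (T.holds_all (fun (p : (Y × M) × M) x =>
    guard (p.1.2 = t p.1.1 x) (neps x p.2)) ((g.prod w).prod a))).trans ?_
  push Not
  refine exists_congr fun x => ?_
  rw [T.holds_guard]
  change ¬ ((∀ᶠ ω in T.filter, w ω = t (g ω) (x ω)) → T.holds fun ω => neps (x ω) (a ω)) ↔ _
  tauto

end

end

/-! ### Integers of the realizability model -/

noncomputable section
variable {M : Type u} [langSet.Structure M] [Nonempty M] {A : RealizabilityAlgebra M}
variable [hM : Fact (IsModelZFC M)]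

open TV RealizabilityAlgebra

open scoped Classical in
variable (A) in
/-- Application of terms, extended to all individuals. -/
def appM (x y : M) : M :=
  if h : x ∈ₘ A.Lam ∧ y ∈ₘ A.Lam then (A.app ⟨x, h.1⟩ ⟨y, h.2⟩).1 else zero M

theorem appM_coe (x y : El A.Lam) : appM A x.1 y.1 = (A.app x y).1 := dif_pos ⟨x.2, y.2⟩

instance {Y : Type*} [Ctx M Y] {t s : Y → M} [ht : DefFun t] [hs : DefFun s] :
    DefFun fun y => appM A (t y) (s y) := by
  obtain ⟨g, hg⟩ := A.app_internal
  have : DefFun fun p : Y × M => t p.1 := ht.comp _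
  have : DefFun fun p : Y × M => s p.1 := hs.comp _
  refine .of_pred (P := fun y x => ((t y ∈ₘ A.Lam ∧ s y ∈ₘ A.Lam) ∧ x ∈ₘ A.Lam ∧
    pair (pair (t y) (s y)) x ∈ₘ g) ∨ (¬ (t y ∈ₘ A.Lam ∧ s y ∈ₘ A.Lam) ∧ x = zero M)) fun y x => ?_
  by_cases h : t y ∈ₘ A.Lam ∧ s y ∈ₘ A.Lam
  · rw [appM_coe ⟨t y, h.1⟩ ⟨s y, h.2⟩]
    simp only [h, true_and, not_true_eq_false, false_and, or_false, and_self]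
    constructor
    · rintro rfl
      exact ⟨(A.app _ _).2, (hg ⟨t y, h.1⟩ ⟨s y, h.2⟩ _).2 rfl⟩
    · rintro ⟨hx, h'⟩
      rw [(hg ⟨t y, h.1⟩ ⟨s y, h.2⟩ ⟨x, hx⟩).1 h']
  · simp only [appM, h, dif_neg, false_and, false_or, true_and, not_false_eq_true]

theorem isNumeral_iff {n : M} {t : El A.Lam} : A.IsNumeral n t ↔
    ∀ g : M, pair (zero M) A.num0.1 ∈ₘ g → (∀ k s, s ∈ₘ A.Lam → pair k s ∈ₘ g →
      pair (succ k) (appM A A.sigma.1 s) ∈ₘ g) → pair n t.1 ∈ₘ g := by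
  refine forall_congr' fun g => imp_congr_right fun _ => imp_congr_left ?_
  refine forall_congr' fun k => ⟨fun h s hs => ?_, fun h s => ?_⟩
  · have := h ⟨s, hs⟩
    rwa [← appM_coe] at this
  · rw [← appM_coe]
    exact h s.1 s.2

instance {Y : Type*} [Ctx M Y] {n t : Y → M} [hn : DefFun n] [ht : DefFun t] :
    DefPred M fun y => ∀ g : M, pair (zero M) A.num0.1 ∈ₘ g → (∀ k s, s ∈ₘ A.Lam → pair k s ∈ₘ g →
      pair (succ k) (appM A A.sigma.1 s) ∈ₘ g) → pair (n y) (t y) ∈ₘ g := by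
  have : DefFun fun p : Y × M => n p.1 := hn.comp _
  have : DefFun fun p : Y × M => t p.1 := ht.comp _
  infer_instance

theorem mem_nat {z : M} : z ∈ₘ A.nat ↔ ∃ n, n ∈ₘ omega M ∧ ∃ (t : El A.Lam) (p : El A.Stk),
    A.IsNumeral n t ∧ z = pair n (A.push t p).1 := by
  obtain ⟨g, hg⟩ := A.push_internal
  have h1 : ∀ z, (∃ n, n ∈ₘ omega M ∧ ∃ (t : El A.Lam) (p : El A.Stk),
      A.IsNumeral n t ∧ z = pair n (A.push t p).1) ↔ ∃ n, n ∈ₘ omega M ∧ ∃ t p q : M,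
      t ∈ₘ A.Lam ∧ p ∈ₘ A.Stk ∧ q ∈ₘ A.Stk ∧ (∀ g : M, pair (zero M) A.num0.1 ∈ₘ g →
        (∀ k s, s ∈ₘ A.Lam → pair k s ∈ₘ g → pair (succ k) (appM A A.sigma.1 s) ∈ₘ g) →
        pair n t ∈ₘ g) ∧ pair (pair t p) q ∈ₘ g ∧ z = pair n q := fun z => by
    refine exists_congr fun n => and_congr_right fun _ => ⟨?_, ?_⟩
    · rintro ⟨t, p, ht, rfl⟩
      exact ⟨t.1, p.1, _, t.2, p.2, (A.push t p).2, isNumeral_iff.1 ht, (hg t p _).2 rfl, rfl⟩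
    · rintro ⟨t, p, q, ht, hp, hq, h, h', rfl⟩
      refine ⟨⟨t, ht⟩, ⟨p, hp⟩, isNumeral_iff.2 h, ?_⟩
      rw [(hg ⟨t, ht⟩ ⟨p, hp⟩ ⟨q, hq⟩).1 h']
  rw [RealizabilityAlgebra.nat, funext fun z => propext (h1 z), h1]
  refine mem_compr_of_subset (times (omega M) A.Stk) ?_
  rintro _ ⟨n, hn, t, p, q, -, -, hq, -, -, rfl⟩
  exact pair_mem_times.2 ⟨hn, hq⟩

theorem mem_neps_nat {n : M} {q : El A.Stk} : Mem q (neps n A.nat) ↔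
    n ∈ₘ omega M ∧ ∃ (t : El A.Lam) (p : El A.Stk), A.IsNumeral n t ∧ q = A.push t p := by
  rw [mem_neps, mem_nat]
  constructor
  · rintro ⟨n', hn, t, p, h, h'⟩
    obtain ⟨rfl, hq⟩ := pair_inj.1 h'
    exact ⟨hn, t, p, h, Subtype.ext hq⟩
  · rintro ⟨hn, t, p, h, rfl⟩
    exact ⟨n, hn, t, p, h, rfl⟩

theorem num0_mem_QP : A.num0.1 ∈ₘ A.QP := A.QP_app _ _ A.QP_cK A.QP_cI

theorem sigma_mem_QP : A.sigma.1 ∈ₘ A.QP :=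
  A.QP_app _ _ (A.QP_app _ _ A.QP_cB A.QP_cW) (A.QP_app _ _ A.QP_cB A.QP_cB)

/-- The individual `{(k, p) | k ∈ ω, p ∈ ‖F k‖}`. -/
theorem exists_graph (F : M → TV A) [hF : DefTV fun p : PUnit.{u + 1} × M => F p.2] :
    ∃ h : M, ∀ k, k ∈ₘ omega M → (neps k h : TV A) = F k := by
  have : DefTV fun p : ((PUnit.{u + 1} × M) × M) × M => F p.1.2 :=
    hF.comp fun p : ((PUnit.{u + 1} × M) × M) × M => (PUnit.unit, p.1.2)
  refine ⟨compr fun z => ∃ k p, k ∈ₘ omega M ∧ MemM p (F k) ∧ z = pair k p, fun k hk => ?_⟩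
  ext p
  rw [mem_neps, mem_compr_of_subset (times (omega M) A.Stk)]
  · constructor
    · rintro ⟨k', p', -, hp, h⟩
      obtain ⟨rfl, rfl⟩ := pair_inj.1 h
      exact memM_coe.1 hp
    · exact fun h => ⟨k, p.1, hk, memM_coe.2 h, rfl⟩
  · rintro _ ⟨k, p, hk, ⟨hp, -⟩, rfl⟩
    exact pair_mem_times.2 ⟨hk, hp⟩

variable (A) in
/-- The formula "`h` is inductive". -/
def inductiveTV (h : M) : TV A :=
  TV.all fun k => guard (k ∈ₘ omega M) (neps k h ⇾ neps (succ k) h)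

/-- Numerals iterate like Church numerals. The formula is represented by an individual `h`, so that
"for every `h`" is definable and the induction takes place in the ground model. The guard `k ∈ ω` is
there because `exists_graph` controls falsity values only at integers. -/
theorem IsNumeral.force_neps {n : M} {t : El A.Lam} (ht : A.IsNumeral n t) :
    n ∈ₘ omega M ∧ ∀ h, Force t (inductiveTV A h ⇾ neps (zero M) h ⇾ neps n h) := by
  let Q : M → M → Prop := fun n t => n ∈ₘ omega M ∧
    ∀ h, ForceM t ((TV.all fun k => guard (k ∈ₘ omega M) (neps k h ⇾ neps (succ k) h)) ⇾
      neps (zero M) h ⇾ neps n h : TV A)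
  have hm : ∀ n t, pair n t ∈ₘ compr (fun z => ∃ n t, Q n t ∧ z = pair n t) ↔ Q n t := fun n t => by
    rw [mem_compr_of_subset (times (omega M) A.Lam)]
    · constructor
      · rintro ⟨n', t', hQ, h⟩
        obtain ⟨rfl, rfl⟩ := pair_inj.1 h
        exact hQ
      · exact fun h => ⟨n, t, h, rfl⟩
    · rintro _ ⟨n, t, ⟨hn, hQ⟩, rfl⟩
      exact pair_mem_times.2 ⟨hn, (hQ n).1⟩
  have := (hm _ _).1 (ht _ ((hm _ _).2 ?_) fun k s hk => (hm _ _).2 ?_)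
  · exact ⟨this.1, fun h => forceM_coe.1 (this.2 h)⟩
  · refine ⟨zero_mem_omega, fun h => forceM_coe.2 (force_imp.2 fun f p _ hp => ?_)⟩
    obtain ⟨a, p, ha, hp, rfl⟩ := hp
    exact .app (.cK (.cI (ha _ hp)))
  · obtain ⟨hk, hs⟩ := (hm _ _).1 hk
    refine ⟨succ_mem_omega hk, fun h => forceM_coe.2 (force_imp.2 fun f p hf hp => ?_)⟩
    obtain ⟨a, p, ha, hp, rfl⟩ := hp
    -- `σ s f a ≻ s f (f a)`. The hypothesis on `s` is applied to the shift `h'` of `h`, whose value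
    -- at `k` is that of `h` at `k + 1`. The base case for `h'` is then realized by `f a`.
    obtain ⟨h', hh'⟩ := exists_graph fun k => (neps (succ k) h : TV A)
    refine .app <| .app <| .app <| .cB <| .cW <| .app <| .app <| .cB <| .cB <| .app ?_
    refine force_imp.1 (forceM_coe.1 (hs h')) f _ (force_all.2 fun k => ?_) ⟨_, p, ?_, ?_, rfl⟩
    · rintro q ⟨hk, hq⟩
      rw [hh' k hk, hh' _ (succ_mem_omega hk)] at hq
      exact force_all.1 hf (succ k) q ⟨succ_mem_omega hk, hq⟩
    · rw [hh' _ zero_mem_omega]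
      refine Force.app (fun q hq => ?_) ha
      exact force_all.1 hf (zero M) q ⟨zero_mem_omega, hq⟩
    · rwa [hh' k hk]

/-- A numeral iterates realizers. -/
theorem IsNumeral.force {n : M} {t : El A.Lam} (ht : A.IsNumeral n t) {F : M → TV A}
    [hF : DefTV fun p : PUnit.{u + 1} × M => F p.2] :
    Force t ((TV.all fun k => F k ⇾ F (succ k)) ⇾ F (zero M) ⇾ F n) := by
  obtain ⟨h, hh⟩ := exists_graph F
  obtain ⟨hn, ht⟩ := IsNumeral.force_neps ht
  have ht := ht h
  rw [hh n hn, hh _ zero_mem_omega] at ht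
  refine force_imp.2 fun f p hf hp => force_imp.1 ht f p (force_all.2 fun k q hq => ?_) hp
  rw [hh k hq.1, hh _ (succ_mem_omega hq.1)] at hq
  exact force_all.1 hf k q hq.2

namespace MaxTheory
variable {X : Type*} (T : MaxTheory A X)

theorem mem_omega_of_eps_nat {n : X → M} (h : T.holds fun ω => n ω ε' A.nat) :
    ∀ᶠ ω in T.filter, n ω ∈ₘ omega M := by
  simp only [eps, T.holds_neg] at h
  by_contra hc
  refine h (T.mp ?_ (T.holds_refute.2 hc))
  exact .of_mem fun ω p hp => (mem_neps_nat.1 hp).1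

theorem zero_eps_nat : T.holds fun _ => zero M ε' A.nat := by
  refine T.of_uRealized ⟨A.app (A.app A.cC A.cI) A.num0,
    A.QP_app _ _ (A.QP_app _ _ A.QP_cC A.QP_cI) num0_mem_QP, fun x => force_imp.2 fun s π hs _ => ?_⟩
  exact Ok.app (Ok.app (Ok.cC (Ok.cI
    (hs _ (mem_neps_nat.2 ⟨zero_mem_omega, _, _, fun _ h _ => h, rfl⟩)))))

theorem succ_eps_nat {n : X → M} (h : T.holds fun ω => n ω ε' A.nat) :
    T.holds fun ω => succ (n ω) ε' A.nat := by
  simp only [eps, T.holds_neg] at h ⊢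
  refine fun hs => h (T.mp ⟨A.app (A.app A.cC A.cB) A.sigma,
    A.QP_app _ _ (A.QP_app _ _ A.QP_cC A.QP_cB) sigma_mem_QP, fun x => force_imp.2 fun s π hs hπ => ?_⟩
    hs)
  obtain ⟨hn, t, p, ht, rfl⟩ := mem_neps_nat.1 hπ
  exact Ok.app (Ok.app (Ok.cC (Ok.cB (hs _ (mem_neps_nat.2 ⟨succ_mem_omega hn, _, _,
    fun g h0 h1 => h1 _ _ (ht g h0 h1), rfl⟩)))))

/-- A stack `t · π` in `‖n ∉ ℕ‖` carries a numeral `t`, which by `IsNumeral.force` realizes the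
induction principle at `n`. So `‖n ∉ ℕ‖` is contained in the falsity value of the negation of that
principle, and the identity realizes the implication. -/
theorem nat_induction' {Y : Type*} [Ctx M Y] (F : Y → M → TV A)
    [hF : DefTV fun p : Y × M => F p.1 p.2] (g : X → Y) {n : X → M}
    (hn : T.holds fun ω => n ω ε' A.nat) (h0 : T.holds fun ω => F (g ω) (zero M))
    (hs : T.holds fun ω => TV.all fun k => F (g ω) k ⇾ F (g ω) (succ k)) :
    T.holds fun ω => F (g ω) (n ω) := by
  by_contra hc
  simp only [eps, T.holds_neg] at hn
  refine hn (T.mp (F := fun ω => neg ((TV.all fun k => F (g ω) k ⇾ F (g ω) (succ k)) ⇾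
    F (g ω) (zero M) ⇾ F (g ω) (n ω))) (.of_mem fun ω p hp => ?_) ?_)
  · obtain ⟨hn, t, p, ht, rfl⟩ := mem_neps_nat.1 hp
    have := hF.at (g ω)
    exact ⟨t, p, IsNumeral.force ht, trivial, rfl⟩
  · rw [T.holds_neg, T.holds_imp, T.holds_imp]
    exact fun h => hc (h hs h0)

end MaxTheory

end

/-! ### The diagonal argument -/

noncomputable section
variable {M : Type u} [langSet.Structure M] [Nonempty M] {A : RealizabilityAlgebra M}
variable [hM : Fact (IsModelZFC M)]

open TV RealizabilityAlgebra

open scoped Classical in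
/-- The product `i x` for `i ∈ {0, 1}`. -/
def sel (i x : M) : M := if i = one M then x else zero M

theorem sel_one (x : M) : sel (one M) x = x := if_pos rfl

theorem sel_of_ne {i : M} (h : i ≠ one M) (x : M) : sel i x = zero M := if_neg h

theorem sel_zero (x : M) : sel (zero M) x = zero M := sel_of_ne one_ne_zero.symm x

theorem meet_one_one : meet (one M) (one M) = one M := if_pos ⟨rfl, rfl⟩

theorem meet_of_ne_left {i j : M} (h : i ≠ one M) : meet i j = zero M := if_neg fun h' => h h'.1

theorem meet_of_ne_right {i j : M} (h : j ≠ one M) : meet i j = zero M := if_neg fun h' => h h'.2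

/-- A subset of `K` that differs from every `v` such that, for some `(z, t) ∈ K`, the term `t`
realizes `F z v`. -/
def diagonal (K : M) (F : M → M → TV A) : M :=
  compr fun k => k ∈ₘ K ∧ ∀ z t, k = pair z t → ∀ v, ForceM t (F z v) → ¬ k ∈ₘ v

theorem mem_diagonal {K : M} {F : M → M → TV A}
    [hF : DefTV fun p : (PUnit.{u + 1} × M) × M => F p.1.2 p.2] {k : M} :
    k ∈ₘ diagonal K F ↔ k ∈ₘ K ∧ ∀ z t, k = pair z t → ∀ v, ForceM t (F z v) → ¬ k ∈ₘ v := by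
  have : DefTV fun p : (((PUnit.{u + 1} × M) × M) × M) × M => F p.1.1.2 p.2 :=
    hF.comp fun p : (((PUnit.{u + 1} × M) × M) × M) × M => ((PUnit.unit, p.1.1.2), p.2)
  exact mem_sep

/-- The pair `k = (z, t)` cannot be in the diagonal set, since `t` realizes `F` at that very set.
Being in `K`, it was excluded because of some `v ∋ k` at which `t` also realizes `F`; this `v`
differs from the diagonal set at `k`. -/
theorem exists_ne_diagonal {K z : M} {t : El A.Lam} {F : M → M → TV A}
    [hF : DefTV fun p : (PUnit.{u + 1} × M) × M => F p.1.2 p.2] (hK : pair z t.1 ∈ₘ K)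
    (h : Force t (F z (diagonal K F))) : ∃ v, Force t (F z v) ∧ v ≠ diagonal K F := by
  by_cases hk : pair z t.1 ∈ₘ diagonal K F
  · exact ((mem_diagonal.1 hk).2 z t.1 rfl _ (forceM_coe.2 h) hk).elim
  · rw [mem_diagonal] at hk
    push Not at hk
    obtain ⟨z', t', h', v, hv, hkv⟩ := hk hK
    obtain ⟨rfl, rfl⟩ := pair_inj.1 h'
    refine ⟨v, forceM_coe.1 hv, fun he => ?_⟩
    rw [he] at hkv
    exact (mem_diagonal.1 hkv).2 z t.1 rfl _ (forceM_coe.2 h) hkv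

/-- If `F z x` has at most one value, then the diagonal set is not a value of `F z (j x)`, at least
outside of `j`. -/
theorem URealized.diagonal {X : Type*} (F : X → M → M → M → TV A) (K : M)
    (hK : ∀ z t, z ∈ₘ omega M → t ∈ₘ A.Lam → pair z t ∈ₘ K)
    (hF : ∀ a, DefTV fun p : (PUnit.{u + 1} × M) × M => F a p.1.2 (zero M) p.2) (i z j x : X → M) :
    URealized fun a => (TV.all fun z => TV.all fun x => TV.all fun v => TV.all fun v' =>
      F a z x v ⇾ F a z x v' ⇾ prop (v = v')) ⇾
      F a (z a) (sel (j a) (x a)) (sel (i a) (diagonal K fun z v => F a z (zero M) v)) ⇾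
      prop (i a ∈ₘ two M → z a ∈ₘ omega M → meet (i a) (j a) = i a) := by
  refine ⟨A.cW, A.QP_cW, fun a => force_imp.2 fun f p hf hp => ?_⟩
  obtain ⟨t, p, ht, ⟨r, p, hr, -, rfl⟩, rfl⟩ := hp
  have hf : ∀ v v', Force f (F a (z a) (sel (j a) (x a)) v ⇾ F a (z a) (sel (j a) (x a)) v' ⇾
      prop (v = v')) := fun v v' =>
    force_all.1 (force_all.1 (force_all.1 (force_all.1 hf (z a)) (sel (j a) (x a))) v) v'
  -- `W f t ≻ f t t`: the same `t` serves as realizer for `v` and for `i Δ`, and `f` then asserts `v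
  -- = i Δ`. Any `v` realized by `t` will do, provided that this equality would entail the
  -- conclusion.
  suffices h : ∃ v, Force t (F a (z a) (sel (j a) (x a)) v) ∧
      (v = sel (i a) (_root_.diagonal K fun z v => F a z (zero M) v) →
        i a ∈ₘ two M → z a ∈ₘ omega M → meet (i a) (j a) = i a) by
    obtain ⟨v, hv, h⟩ := h
    exact Ok.cW (force_imp.1 (hf v _) t _ hv
      ⟨t, _, ht, ⟨r, p, fun q hq => hr q (h hq), trivial, rfl⟩, rfl⟩)
  by_cases hc : i a ∈ₘ two M → z a ∈ₘ omega M → meet (i a) (j a) = i a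
  · exact ⟨_, ht, fun _ => hc⟩
  · push Not at hc
    obtain ⟨hi, hz, hm⟩ := hc
    rcases mem_two.1 hi with hi | hi
    · exact (hm (by rw [hi, meet_of_ne_left one_ne_zero.symm])).elim
    · have hj : j a ≠ one M := fun hj => hm (by rw [hi, hj, meet_one_one])
      -- The bad case is `i = 1`, `j ≠ 1`. The argument `j x` collapses to `0` whatever `x` is, so
      -- `t` realizes `F` at `z`, `0` and the diagonal set itself.
      rw [hi, sel_one, sel_of_ne hj] at ht ⊢
      have := hF a
      obtain ⟨v, hv, hne⟩ := exists_ne_diagonal (hK _ _ hz t.2) ht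
      exact ⟨v, hv, fun h => (hne h).elim⟩

end

/-! ### Sets and maps in the two-valued model -/

noncomputable section
variable {M : Type u} [langSet.Structure M] [Nonempty M] {A : RealizabilityAlgebra M}
variable [hM : Fact (IsModelZFC M)]

open TV RealizabilityAlgebra

namespace HenkinTheory
variable (T : HenkinTheory A) {Y : Type*}

/-- Strong membership of generic individuals. -/
def Eps (x a : Gen A M) : Prop := T.holds fun ω => x ω ε' a ω

/-- Leibniz equality of generic individuals. -/
def Eqv (x y : Gen A M) : Prop := ∀ᶠ ω in T.filter, x ω = y ω

/-- Validity of a formula at a generic tuple of parameters. -/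
def Sat (F : Y → TV A) (g : Gen A Y) : Prop := T.holds fun ω => F (g ω)

variable {T} {F G : Y → TV A} {g : Gen A Y}

theorem sat_imp : T.Sat (fun y => F y ⇾ G y) g ↔ (T.Sat F g → T.Sat G g) := T.holds_imp
theorem sat_neg : T.Sat (fun y => neg (F y)) g ↔ ¬ T.Sat F g := T.holds_neg
theorem sat_and : T.Sat (fun y => F y ⩓ G y) g ↔ T.Sat F g ∧ T.Sat G g := T.holds_and
theorem sat_or : T.Sat (fun y => F y ⩔ G y) g ↔ T.Sat F g ∨ T.Sat G g := T.holds_or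
theorem sat_iff : T.Sat (fun y => TV.iff (F y) (G y)) g ↔ (T.Sat F g ↔ T.Sat G g) := T.holds_iff

theorem sat_all {F : Y → M → TV A} : T.Sat (fun y => TV.all (F y)) g ↔
    ∀ x : Gen A M, T.Sat (fun p : Y × M => F p.1 p.2) (g.prod x) := T.holds_all F g

theorem sat_ex {F : Y → M → TV A} : T.Sat (fun y => TV.ex (F y)) g ↔
    ∃ x : Gen A M, T.Sat (fun p : Y × M => F p.1 p.2) (g.prod x) := by
  simp only [TV.ex, sat_neg, sat_all, not_forall, not_not]

theorem sat_eq {t s : Y → M} : T.Sat (fun y => t y ≐ s y) g ↔ T.Eqv (g.map t) (g.map s) :=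
  T.holds_eq _ _

theorem sat_eps {t s : Y → M} : T.Sat (fun y => t y ε' s y) g ↔ T.Eps (g.map t) (g.map s) := Iff.rfl

theorem sat_prop {P : Y → Prop} : T.Sat (fun y => TV.prop (P y)) g ↔ ∀ᶠ ω in T.filter, P (g ω) :=
  Iff.rfl

theorem Eqv.symm {x y : Gen A M} (h : T.Eqv x y) : T.Eqv y x := h.mono fun _ h => h.symm
theorem Eqv.trans {x y z : Gen A M} (h : T.Eqv x y) (h' : T.Eqv y z) : T.Eqv x z := by
  filter_upwards [h, h'] with ω h h' using h.trans h'
theorem Eqv.refl (x : Gen A M) : T.Eqv x x := .of_forall fun _ => rfl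

theorem Eps.congr {x a x' a' : Gen A M} (h : T.Eps x a) (hx : T.Eqv x x') (ha : T.Eqv a a') :
    T.Eps x' a' := by
  refine (T.holds_congr (fun p : M × M => p.1 ε' p.2) (g := fun ω => (x ω, a ω))
    (h := fun ω => (x' ω, a' ω)) ?_).1 h
  filter_upwards [hx, ha] with ω h h' using by rw [h, h']

theorem eps_gimel_iff {x a : Gen A M} :
    T.Eps x (a.map A.gimel) ↔ ∀ᶠ ω in T.filter, x ω ∈ₘ a ω := T.holds_eps_gimel _ _

/-- Ordered pairs of generic individuals. -/
abbrev _root_.Gen.pair (x y : Gen A M) : Gen A M := Gen.map₂ GroundModel.pair x y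

theorem eqv_pair {x y x' y' : Gen A M} : T.Eqv (x.pair y) (x'.pair y') ↔ T.Eqv x x' ∧ T.Eqv y y' := by
  refine Iff.trans ?_ Filter.eventually_and
  exact Filter.eventually_congr (.of_forall fun ω => pair_inj)

end HenkinTheory

/-- The interpretation of a `Cls`. -/
structure SCls (A : RealizabilityAlgebra M) where
  mem : Gen A M → Prop
  eqv : Gen A M → Gen A M → Prop

/-- The interpretation of a `Cls` in the model given by `T`. -/
def HenkinTheory.cls (T : HenkinTheory A) (C : Gen A (Cls A)) : SCls A where
  mem x := T.holds fun ω => (C ω).mem (x ω)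
  eqv x y := T.holds fun ω => (C ω).eqv (x ω) (y ω)

namespace SCls
variable (T : HenkinTheory A) (C D : SCls A)

/-- Interpretation of `Cls.rel`. -/
def Rel (f x y : Gen A M) : Prop :=
  ∃ x' y', C.eqv x x' ∧ D.eqv y y' ∧ T.Eps (x'.pair y') f

/-- Interpretation of `Cls.isFun`. -/
def IsFun (f : Gen A M) : Prop :=
  (∀ x, C.mem x → ∃ y, D.mem y ∧ C.Rel T D f x y) ∧
  ∀ x, C.mem x → ∀ y, D.mem y → ∀ y', D.mem y' → C.Rel T D f x y → C.Rel T D f x y' → D.eqv y y'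

/-- Interpretation of `Cls.isOnto`. -/
def IsOnto (f : Gen A M) : Prop := ∀ y, D.mem y → ∃ x, C.mem x ∧ C.Rel T D f x y

/-- Interpretation of `Cls.isInj`. -/
def IsInj (f : Gen A M) : Prop :=
  ∀ x, C.mem x → ∀ x', C.mem x' → ∀ y, D.mem y → C.Rel T D f x y → C.Rel T D f x' y → C.eqv x x'

/-- Interpretation of `Cls.prod`. -/
def prod : SCls A where
  mem z := ∃ x, C.mem x ∧ ∃ y, D.mem y ∧ T.Eqv z (x.pair y)
  eqv z w := ∃ x y x' y', T.Eqv z (x.pair y) ∧ T.Eqv w (x'.pair y') ∧ C.eqv x x' ∧ D.eqv y y'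

end SCls

namespace HenkinTheory
variable (T : HenkinTheory A) (C D : Gen A (Cls A))

theorem holds_surj : T.holds (fun ω => (C ω).surj (D ω)) ↔
    ∃ f, (T.cls C).IsFun T (T.cls D) f ∧ (T.cls C).IsOnto T (T.cls D) f := by
  change T.Sat (fun p : Cls A × Cls A => p.1.surj p.2) (C.prod D) ↔ _
  simp only [Cls.surj, Cls.isFun, Cls.isOnto, Cls.rel, Cls.all, Cls.ex, sat_ex, sat_all, sat_and,
    sat_imp, sat_eps]
  rfl

theorem holds_inj : T.holds (fun ω => (C ω).inj (D ω)) ↔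
    ∃ f, (T.cls C).IsFun T (T.cls D) f ∧ (T.cls C).IsInj T (T.cls D) f := by
  change T.Sat (fun p : Cls A × Cls A => p.1.inj p.2) (C.prod D) ↔ _
  simp only [Cls.inj, Cls.isFun, Cls.isInj, Cls.rel, Cls.all, Cls.ex, sat_ex, sat_all, sat_and,
    sat_imp, sat_eps]
  rfl

theorem holds_equip : T.holds (fun ω => (C ω).equip (D ω)) ↔
    ∃ f, (T.cls C).IsFun T (T.cls D) f ∧ (T.cls C).IsInj T (T.cls D) f ∧
      (T.cls C).IsOnto T (T.cls D) f := by
  change T.Sat (fun p : Cls A × Cls A => p.1.equip p.2) (C.prod D) ↔ _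
  simp only [Cls.equip, Cls.isFun, Cls.isInj, Cls.isOnto, Cls.rel, Cls.all, Cls.ex, sat_ex, sat_all,
    sat_and, sat_imp, sat_eps]
  rfl

theorem cls_prod : T.cls (Gen.map₂ Cls.prod C D) = (T.cls C).prod T (T.cls D) := by
  have h1 : ∀ z, (T.cls (Gen.map₂ Cls.prod C D)).mem z ↔ ((T.cls C).prod T (T.cls D)).mem z := by
    intro z
    change T.Sat (fun p : (Cls A × Cls A) × M => (p.1.1.prod p.1.2).mem p.2) ((C.prod D).prod z) ↔ _
    simp only [Cls.prod, Cls.ex, sat_ex, sat_and, sat_eq]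
    rfl
  have h2 : ∀ z w, (T.cls (Gen.map₂ Cls.prod C D)).eqv z w ↔
      ((T.cls C).prod T (T.cls D)).eqv z w := by
    intro z w
    change T.Sat (fun p : ((Cls A × Cls A) × M) × M => (p.1.1.1.prod p.1.1.2).eqv p.1.2 p.2)
      (((C.prod D).prod z).prod w) ↔ _
    simp only [Cls.prod, sat_ex, sat_and, sat_eq]
    rfl
  rw [SCls.mk.injEq]
  exact ⟨funext fun z => propext (h1 z), funext fun z => funext fun w => propext (h2 z w)⟩

theorem holds_rel (f x y : Gen A M) : T.holds (fun ω => (C ω).rel (D ω) (f ω) (x ω) (y ω)) ↔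
    (T.cls C).Rel T (T.cls D) f x y := by
  change T.Sat (fun p : (((Cls A × Cls A) × M) × M) × M => p.1.1.1.1.rel p.1.1.1.2 p.1.1.2 p.1.2 p.2)
    ((((C.prod D).prod f).prod x).prod y) ↔ _
  simp only [Cls.rel, sat_ex, sat_and, sat_eps]
  rfl

end HenkinTheory

end

/-! ### Arithmetic in the two-valued model -/

noncomputable section
variable {M : Type u} [langSet.Structure M] [Nonempty M] {A : RealizabilityAlgebra M}
variable [hM : Fact (IsModelZFC M)]

open TV RealizabilityAlgebra

namespace HenkinTheory
variable (T : HenkinTheory A) {Y : Type*}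

/-- The generic individual `n` is an integer. -/
def Nat (n : Gen A M) : Prop := T.Eps n (Gen.const A.nat)

variable {T} {n m : Gen A M}

theorem Nat.mem_omega (hn : T.Nat n) : ∀ᶠ ω in T.filter, n ω ∈ₘ omega M := T.mem_omega_of_eps_nat hn

theorem Nat.succ (hn : T.Nat n) : T.Nat (n.map succ) := T.succ_eps_nat hn

theorem Nat.congr (hn : T.Nat n) (h : T.Eqv n m) : T.Nat m := Eps.congr hn h (.refl _)

theorem Nat.induction [Ctx M Y] (F : Y → M → TV A) [hF : DefTV fun p : Y × M => F p.1 p.2]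
    (g : Gen A Y) (h0 : T.holds fun ω => F (g ω) (GroundModel.zero M))
    (hs : ∀ k, T.Nat k → T.holds (fun ω => F (g ω) (k ω)) →
      T.holds fun ω => F (g ω) (GroundModel.succ (k ω))) (hn : T.Nat n) :
    T.holds fun ω => F (g ω) (n ω) := by
  -- The induction is run on "`k` is an integer and `F k`", so that the step need only be proved at
  -- integers.
  refine (T.holds_and.1 (T.nat_induction' (fun y k => (k ε' A.nat) ⩓ F y k) g hn
    (T.holds_and.2 ⟨T.zero_eps_nat, h0⟩) ?_)).2
  refine (T.holds_all (fun y k => (k ε' A.nat) ⩓ F y k ⇾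
    (GroundModel.succ k ε' A.nat) ⩓ F y (GroundModel.succ k)) g).2 fun k => ?_
  rw [T.holds_imp, T.holds_and, T.holds_and]
  exact fun ⟨h1, h2⟩ => ⟨T.succ_eps_nat h1, hs k h1 h2⟩

theorem Nat.double (hn : T.Nat n) : T.Nat (n.map double) := by
  refine Nat.induction (fun (_ : PUnit.{u + 1}) k => (GroundModel.double k ε' A.nat : TV A))
    (Gen.const PUnit.unit) ?_ (fun k hk h => ?_) hn
  · simp only [double_zero]
    exact T.zero_eps_nat
  · change T.Nat ((k.map GroundModel.succ).map GroundModel.double)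
    refine Nat.congr (Nat.succ (Nat.succ (n := k.map GroundModel.double) h)) ?_
    filter_upwards [hk.mem_omega] with ω hω
    exact (double_succ hω).symm

theorem Nat.pairing (hn : T.Nat n) (hm : T.Nat m) : T.Nat (Gen.map₂ pairing n m) := by
  refine Nat.induction (fun (y : PUnit.{u + 1} × M) k => (GroundModel.pairing k y.2 ε' A.nat : TV A))
    ((Gen.const PUnit.unit).prod m) ?_ (fun k hk h => ?_) hn
  · change T.Nat (Gen.map₂ GroundModel.pairing (Gen.const (GroundModel.zero M)) m)
    refine Nat.congr hm.double.succ ?_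
    filter_upwards [hm.mem_omega] with ω hω
    exact (pairing_zero hω).symm
  · change T.Nat (Gen.map₂ GroundModel.pairing (k.map GroundModel.succ) m)
    refine Nat.congr (Nat.double (n := Gen.map₂ GroundModel.pairing k m) h) ?_
    filter_upwards [hk.mem_omega, hm.mem_omega] with ω hk hm
    exact (pairing_succ hk hm).symm

theorem Nat.cases (hn : T.Nat n) : T.Eqv n (Gen.const (GroundModel.zero M)) ∨
    ∃ k, T.Nat k ∧ T.Eqv n (k.map GroundModel.succ) := by
  have : T.holds fun ω => (n ω ≐ GroundModel.zero M) ⩔ TV.ex fun k => (k ε' A.nat) ⩓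
      n ω ≐ GroundModel.succ k := by
    refine Nat.induction (fun (_ : PUnit.{u + 1}) n => ((n ≐ GroundModel.zero M) ⩔ TV.ex fun k =>
      (k ε' A.nat) ⩓ n ≐ GroundModel.succ k : TV A)) (Gen.const PUnit.unit) ?_ (fun k hk _ => ?_) hn
    · exact T.holds_or.2 (.inl ((T.holds_eq _ _).2 (.of_forall fun _ => rfl)))
    · refine T.holds_or.2 (.inr ?_)
      refine (sat_ex (g := k) (F := fun x k => (k ε' A.nat) ⩓ GroundModel.succ x ≐ GroundModel.succ k)).2
        ⟨k, sat_and.2 ⟨hk, sat_eq.2 (.refl _)⟩⟩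
  refine (T.holds_or.1 this).imp (T.holds_eq _ _).1 fun h => ?_
  obtain ⟨k, hk⟩ := (sat_ex (g := n) (F := fun x k => (k ε' A.nat) ⩓ x ≐ GroundModel.succ k)).1 h
  obtain ⟨h1, h2⟩ := sat_and.1 hk
  exact ⟨k, h1, sat_eq.1 h2⟩

/-- For general individuals the truth value of `n = m` may lie strictly between `0` and `1` in `ℷ2`.
For integers it is decided, by induction on both arguments. -/
theorem Nat.eqv_or_ne (hn : T.Nat n) (hm : T.Nat m) :
    T.Eqv n m ∨ ∀ᶠ ω in T.filter, n ω ≠ m ω := by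
  have key : ∀ n, T.Sat (fun n => TV.all fun m => (m ε' A.nat) ⇾ prop (n = m) ⩔ prop (n ≠ m)) n ↔
      ∀ m, T.Nat m → T.Eqv n m ∨ ∀ᶠ ω in T.filter, n ω ≠ m ω := fun n => by
    simp only [sat_all, sat_imp, sat_or, sat_prop]
    rfl
  refine (key n).1 (Nat.induction (fun (_ : PUnit.{u + 1}) n =>
    (TV.all fun m => (m ε' A.nat) ⇾ prop (n = m) ⩔ prop (n ≠ m) : TV A)) (Gen.const PUnit.unit)
    ((key (Gen.const _)).2 fun m hm => ?_) (fun k hk h => ?_) hn) m hm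
  · rcases hm.cases with h | ⟨m', -, h⟩
    · exact .inl h.symm
    · refine .inr (h.mono fun ω h => ?_)
      rw [h]
      exact (succ_ne_zero _).symm
  · refine (key (k.map GroundModel.succ)).2 fun m hm => ?_
    rcases hm.cases with h' | ⟨m', hm', h'⟩
    · refine .inr (h'.mono fun ω h => ?_)
      rw [h]
      exact succ_ne_zero _
    · refine ((key k).1 h m' hm').imp (fun h => ?_) fun h => ?_
      · filter_upwards [h, h'] with ω h h'
        rw [h']
        exact congrArg GroundModel.succ h
      · filter_upwards [h, h'] with ω h h' hc
        rw [h'] at hc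
        exact h (succ_inj hc)

end HenkinTheory

/-! ### Enumerations -/

namespace HenkinTheory
variable (T : HenkinTheory A)

/-- The interpretation of the class of the strong elements of `a`. -/
def ind (a : Gen A M) : SCls A := ⟨fun x => T.Eps x a, T.Eqv⟩

theorem cls_ofInd (a : Gen A M) : T.cls (a.map Cls.ofInd) = T.ind a := by
  rw [ind, cls, SCls.mk.injEq]
  exact ⟨rfl, funext fun x => funext fun y => propext (T.holds_eq _ _)⟩

variable {T}

theorem ind_rel {a b f x y : Gen A M} :
    (T.ind a).Rel T (T.ind b) f x y ↔ T.Eps (x.pair y) f :=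
  ⟨fun ⟨_, _, hx, hy, h⟩ => h.congr (eqv_pair.2 ⟨hx.symm, hy.symm⟩) (.refl _),
    fun h => ⟨x, y, .refl _, .refl _, h⟩⟩

variable (T) in
/-- The relation `e` enumerates the elements of the set `Z` by integers. -/
structure Enumerates (Z : M) (e : Gen A M) : Prop where
  eqv : ∀ n a a', T.Nat n → T.Eps (n.pair a) e → T.Eps (n.pair a') e → T.Eqv a a'
  exists_nat : ∀ a : Gen A M, (∀ᶠ ω in T.filter, a ω ∈ₘ Z) → ∃ n, T.Nat n ∧ T.Eps (n.pair a) e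

/-- The formula that defines the enumeration of the values of `t` deduced from the enumeration
`f` of `κ`. -/
def enumTV (t : M → M → M) (κ f z : M) : TV A :=
  TV.ex fun n => TV.ex fun a => TV.ex fun n' => TV.ex fun a' => (n ε' A.nat) ⩓ (n' ε' A.nat) ⩓
    (a ε' A.gimel κ) ⩓ (a' ε' A.gimel κ) ⩓ (pair n a ε' f) ⩓ (pair n' a' ε' f) ⩓
    z ≐ pair (pairing n n') (t a a')

/-- If `n` and `n'` number `a` and `a'`, then `pairing n n'` numbers `t a a'`. The result is a
partial function on the integers, which is all that coding requires. -/
theorem exists_enumerates {κ Z : M} (t : M → M → M) [ht : DefFun₂ t]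
    (hZ : ∀ z, z ∈ₘ Z → ∃ a a', a ∈ₘ κ ∧ a' ∈ₘ κ ∧ z = t a a') {f : Gen A M}
    (hf : (T.ind (Gen.const A.nat)).IsFun T (T.ind (Gen.const (A.gimel κ))) f)
    (hf' : (T.ind (Gen.const A.nat)).IsOnto T (T.ind (Gen.const (A.gimel κ))) f) :
    ∃ e, T.Enumerates Z e := by
  have hd : DefTV fun p : (PUnit.{u + 1} × M) × M => enumTV (A := A) t κ p.1.2 p.2 := by
    have : DefFun fun p : (((((PUnit.{u + 1} × M) × M) × M) × M) × M) × M => t p.1.1.2 p.2 :=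
      DefFun₂.comp ht _ _
    unfold enumTV
    set_option synthInstance.maxHeartbeats 200000 in
    set_option synthInstance.maxSize 1000 in
    infer_instance
  have key : ∀ z : Gen A M, T.holds (fun ω => z ω ε' sepInd (enumTV (A := A) t κ (f ω))
      (A.gimel (times (omega M) Z))) ↔ (∃ n a n' a', T.Nat n ∧ T.Nat n' ∧
        (∀ᶠ ω in T.filter, a ω ∈ₘ κ) ∧ (∀ᶠ ω in T.filter, a' ω ∈ₘ κ) ∧ T.Eps (n.pair a) f ∧
        T.Eps (n'.pair a') f ∧ T.Eqv z (Gen.pair (Gen.map₂ pairing n n') (Gen.map₂ t a a'))) ∧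
      ∀ᶠ ω in T.filter, z ω ∈ₘ times (omega M) Z := fun z => by
    refine (T.holds_eps_sepInd (F := fun p : PUnit.{u + 1} × M => enumTV t κ p.2)
      (fun ω => (PUnit.unit, f ω)) z fun _ => A.gimel (times (omega M) Z)).trans
      (and_congr ?_ (T.holds_eps_gimel _ _))
    change T.Sat (fun p : M × M => enumTV t κ p.1 p.2) (f.prod z) ↔ _
    simp only [enumTV, sat_ex, sat_and, sat_eps, sat_eq, eps_gimel, sat_prop]
    rfl
  refine ⟨f.map fun f => sepInd (enumTV (A := A) t κ f) (A.gimel (times (omega M) Z)), ?_, ?_⟩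
  · intro n a a' hn ha ha'
    obtain ⟨⟨n1, a1, n2, a2, hn1, hn2, ha1, ha2, h1, h2, h⟩, -⟩ := (key _).1 ha
    obtain ⟨⟨m1, b1, m2, b2, hm1, hm2, hb1, hb2, h1', h2', h'⟩, -⟩ := (key _).1 ha'
    rw [eqv_pair] at h h'
    have hp : ∀ᶠ ω in T.filter, n1 ω = m1 ω ∧ n2 ω = m2 ω := by
      filter_upwards [hn1.mem_omega, hn2.mem_omega, hm1.mem_omega, hm2.mem_omega, h.1, h'.1]
        with ω hn1 hn2 hm1 hm2 h h'
      exact pairing_inj hn1 hn2 hm1 hm2 (h.symm.trans h')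
    have e1 := hf.2 n1 hn1 a1 (eps_gimel_iff (a := Gen.const κ) |>.2 ha1) b1
      (eps_gimel_iff (a := Gen.const κ) |>.2 hb1) (ind_rel.2 h1)
      (ind_rel.2 (h1'.congr (eqv_pair.2 ⟨hp.mono fun _ h => h.1.symm, .refl _⟩) (.refl _)))
    have e2 := hf.2 n2 hn2 a2 (eps_gimel_iff (a := Gen.const κ) |>.2 ha2) b2
      (eps_gimel_iff (a := Gen.const κ) |>.2 hb2) (ind_rel.2 h2)
      (ind_rel.2 (h2'.congr (eqv_pair.2 ⟨hp.mono fun _ h => h.2.symm, .refl _⟩) (.refl _)))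
    filter_upwards [h.2, h'.2, e1, e2] with ω h h' e1 e2
    rw [h, h']
    exact congrArg₂ t e1 e2
  · intro a ha
    classical
    -- Preimages under `t` are chosen in the ground model by functions that need not be definable:
    -- they act on `a` by composition.
    let t1 : M → M := fun z => if h : ∃ a a', a ∈ₘ κ ∧ a' ∈ₘ κ ∧ z = t a a' then h.choose else zero M
    let t2 : M → M := fun z => if h : ∃ a a', a ∈ₘ κ ∧ a' ∈ₘ κ ∧ z = t a a' then
      h.choose_spec.choose else zero M
    have ht12 : ∀ z, z ∈ₘ Z → t1 z ∈ₘ κ ∧ t2 z ∈ₘ κ ∧ z = t (t1 z) (t2 z) := fun z hz => by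
      have h := hZ z hz
      simp only [t1, t2, dif_pos h]
      exact h.choose_spec.choose_spec
    obtain ⟨n1, hn1, h1⟩ := hf' (a.map t1) (eps_gimel_iff (a := Gen.const κ) |>.2
      (ha.mono fun ω h => (ht12 _ h).1))
    obtain ⟨n2, hn2, h2⟩ := hf' (a.map t2) (eps_gimel_iff (a := Gen.const κ) |>.2
      (ha.mono fun ω h => (ht12 _ h).2.1))
    have hn1 : T.Nat n1 := hn1
    have hn2 : T.Nat n2 := hn2
    refine ⟨_, hn1.pairing hn2, (key _).2 ⟨⟨n1, _, n2, _, hn1, hn2, ha.mono fun ω h => (ht12 _ h).1,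
      ha.mono fun ω h => (ht12 _ h).2.1, ind_rel.1 h1, ind_rel.1 h2, eqv_pair.2 ⟨.refl _, ?_⟩⟩, ?_⟩⟩
    · exact ha.mono fun ω h => (ht12 _ h).2.2
    · filter_upwards [ha, hn1.mem_omega, hn2.mem_omega] with ω ha h1 h2
      exact pair_mem_times.2 ⟨pairing_mem h1 h2, ha⟩

end HenkinTheory

end

/-! ### Interpretation of sets of reals -/

noncomputable section
variable {M : Type u} [langSet.Structure M] [Nonempty M] {A : RealizabilityAlgebra M}
variable [hM : Fact (IsModelZFC M)]

open TV RealizabilityAlgebra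

instance MaxTheory.filter_neBot {X : Type*} (T : MaxTheory A X) : T.filter.NeBot := by
  rw [← Filter.eventually_false_iff_eq_bot.not.trans Filter.neBot_iff.symm, ← T.holds_refute]
  exact T.of_uRealized ⟨A.cI, A.QP_cI, fun _ _ h => h.elim⟩

namespace SCls
variable (T : HenkinTheory A) (C D : SCls A)

/-- The equality of a class is an equivalence relation. -/
structure IsSetoid : Prop where
  refl : ∀ {x}, C.mem x → C.eqv x x
  symm : ∀ {x y}, C.eqv x y → C.eqv y x
  trans : ∀ {x y z}, C.eqv x y → C.eqv y z → C.eqv x z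
  congr : ∀ {x y z}, C.eqv x y → T.Eqv y z → C.eqv x z

variable {T C D}

theorem IsSetoid.rel_congr (hC : C.IsSetoid T) (hD : D.IsSetoid T) {f x y x' y' : Gen A M}
    (h : C.Rel T D f x y) (hx : C.eqv x x') (hy : D.eqv y y') : C.Rel T D f x' y' := by
  obtain ⟨x₁, y₁, h1, h2, h3⟩ := h
  exact ⟨x₁, y₁, hC.trans (hC.symm hx) h1, hD.trans (hD.symm hy) h2, h3⟩

theorem prod_eqv_iff (hC : C.IsSetoid T) (hD : D.IsSetoid T) {x y x' y' : Gen A M} :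
    (C.prod T D).eqv (x.pair y) (x'.pair y') ↔ C.eqv x x' ∧ D.eqv y y' := by
  constructor
  · rintro ⟨x₁, y₁, x₂, y₂, h1, h2, h3, h4⟩
    rw [HenkinTheory.eqv_pair] at h1 h2
    exact ⟨hC.symm (hC.congr (hC.symm (hC.congr h3 h2.1.symm)) h1.1.symm),
      hD.symm (hD.congr (hD.symm (hD.congr h4 h2.2.symm)) h1.2.symm)⟩
  · exact fun h => ⟨x, y, x', y', .refl _, .refl _, h.1, h.2⟩

theorem IsSetoid.prod (hC : C.IsSetoid T) (hD : D.IsSetoid T) : (C.prod T D).IsSetoid T where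
  refl := fun ⟨x, hx, y, hy, h⟩ => ⟨x, y, x, y, h, h, hC.refl hx, hD.refl hy⟩
  symm := fun ⟨x, y, x', y', h1, h2, h3, h4⟩ => ⟨x', y', x, y, h2, h1, hC.symm h3, hD.symm h4⟩
  trans := by
    rintro z₁ z₂ z₃ ⟨x, y, x', y', h1, h2, h3, h4⟩ ⟨x₁, y₁, x₁', y₁', h1', h2', h3', h4'⟩
    have h := HenkinTheory.eqv_pair.1 (h2.symm.trans h1')
    refine ⟨x, y, x₁', y₁', h1, h2', hC.trans (hC.congr h3 h.1) h3', hD.trans (hD.congr h4 h.2) h4'⟩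
  congr := fun ⟨x, y, x', y', h1, h2, h3, h4⟩ h => ⟨x, y, x', y', h1, h.symm.trans h2, h3, h4⟩

variable (T C D) in
/-- Interpretation of `Cls.sum`. -/
def sum : SCls A where
  mem z := (∃ x, C.mem x ∧ T.Eqv z (Gen.pair (Gen.const (zero M)) x)) ∨
    ∃ y, D.mem y ∧ T.Eqv z (Gen.pair (Gen.const (one M)) y)
  eqv z w := (∃ x x', T.Eqv z (Gen.pair (Gen.const (zero M)) x) ∧
      T.Eqv w (Gen.pair (Gen.const (zero M)) x') ∧ C.eqv x x') ∨
    ∃ y y', T.Eqv z (Gen.pair (Gen.const (one M)) y) ∧ T.Eqv w (Gen.pair (Gen.const (one M)) y') ∧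
      D.eqv y y'

end SCls

namespace HenkinTheory
variable (T : HenkinTheory A) {Y : Type*} {C D : Y → Cls A} {g : Gen A Y}

theorem cls_ext {C : Gen A (Cls A)} {S : SCls A} (h1 : ∀ x, (T.cls C).mem x ↔ S.mem x)
    (h2 : ∀ x y, (T.cls C).eqv x y ↔ S.eqv x y) : T.cls C = S := by
  obtain ⟨m, e⟩ := S
  rw [cls, SCls.mk.injEq]
  exact ⟨funext fun x => propext (h1 x), funext fun x => funext fun y => propext (h2 x y)⟩

theorem cls_sum (C D : Gen A (Cls A)) :
    T.cls (Gen.map₂ Cls.sum C D) = (T.cls C).sum T (T.cls D) := by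
  refine T.cls_ext (fun z => ?_) fun z w => ?_
  · change T.Sat (fun p : (Cls A × Cls A) × M => (p.1.1.sum p.1.2).mem p.2) ((C.prod D).prod z) ↔ _
    simp only [Cls.sum, Cls.ex, sat_or, sat_ex, sat_and, sat_eq]
    rfl
  · change T.Sat (fun p : ((Cls A × Cls A) × M) × M => (p.1.1.1.sum p.1.1.2).eqv p.1.2 p.2)
      (((C.prod D).prod z).prod w) ↔ _
    simp only [Cls.sum, sat_or, sat_ex, sat_and, sat_eq]
    rfl

variable {T}

theorem sat_surj : T.Sat (fun y => (C y).surj (D y)) g ↔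
    ∃ f, (T.cls (g.map C)).IsFun T (T.cls (g.map D)) f ∧
      (T.cls (g.map C)).IsOnto T (T.cls (g.map D)) f := T.holds_surj (g.map C) (g.map D)

theorem sat_inj : T.Sat (fun y => (C y).inj (D y)) g ↔
    ∃ f, (T.cls (g.map C)).IsFun T (T.cls (g.map D)) f ∧
      (T.cls (g.map C)).IsInj T (T.cls (g.map D)) f := T.holds_inj (g.map C) (g.map D)

theorem sat_equip : T.Sat (fun y => (C y).equip (D y)) g ↔
    ∃ f, (T.cls (g.map C)).IsFun T (T.cls (g.map D)) f ∧
      (T.cls (g.map C)).IsInj T (T.cls (g.map D)) f ∧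
      (T.cls (g.map C)).IsOnto T (T.cls (g.map D)) f := T.holds_equip (g.map C) (g.map D)

theorem sat_mem {t : Y → M} : T.Sat (fun y => (C y).mem (t y)) g ↔
    (T.cls (g.map C)).mem (g.map t) := Iff.rfl

theorem sat_eqv {t s : Y → M} : T.Sat (fun y => (C y).eqv (t y) (s y)) g ↔
    (T.cls (g.map C)).eqv (g.map t) (g.map s) := Iff.rfl

theorem sat_rel {f t s : Y → M} : T.Sat (fun y => (C y).rel (D y) (f y) (t y) (s y)) g ↔
    (T.cls (g.map C)).Rel T (T.cls (g.map D)) (g.map f) (g.map t) (g.map s) :=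
  T.holds_rel (g.map C) (g.map D) (g.map f) (g.map t) (g.map s)

theorem cls_map_ofInd {t : Y → M} : T.cls (g.map fun y => Cls.ofInd (t y)) = T.ind (g.map t) :=
  T.cls_ofInd (g.map t)

theorem cls_map_prod : T.cls (g.map fun y => (C y).prod (D y)) =
    (T.cls (g.map C)).prod T (T.cls (g.map D)) := T.cls_prod (g.map C) (g.map D)

theorem cls_map_sum : T.cls (g.map fun y => (C y).sum (D y)) =
    (T.cls (g.map C)).sum T (T.cls (g.map D)) := T.cls_sum (g.map C) (g.map D)

theorem ind_isSetoid (a : Gen A M) : (T.ind a).IsSetoid T := ⟨fun _ => .refl _, .symm, .trans, .trans⟩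

/-! Reals. -/

variable (T) in
/-- Interpretation of `Cls.real`. -/
def reals : SCls A where
  mem x := ∀ n, T.Eps n x → T.Nat n
  eqv x y := ∀ n, T.Eps n x ↔ T.Eps n y

theorem cls_real : T.cls (g.map fun _ => Cls.real A) = T.reals := by
  refine T.cls_ext (fun x => ?_) fun x y => ?_
  · change T.Sat (fun p : M => (Cls.real A).mem p) x ↔ _
    simp only [Cls.real, sat_all, sat_imp, sat_eps]
    rfl
  · change T.Sat (fun p : M × M => (Cls.real A).eqv p.1 p.2) (x.prod y) ↔ _
    simp only [Cls.real, sat_all, sat_iff, sat_eps]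
    rfl

theorem real_symm {x y : Gen A M} (h : T.reals.eqv x y) : T.reals.eqv y x := fun n => (h n).symm
theorem real_trans {x y z : Gen A M} (h : T.reals.eqv x y) (h' : T.reals.eqv y z) :
    T.reals.eqv x z := fun n => (h n).trans (h' n)
theorem real_of_eqv {x y : Gen A M} (h : T.Eqv x y) : T.reals.eqv x y :=
  fun _ => ⟨fun hx => hx.congr (.refl _) h, fun hx => hx.congr (.refl _) h.symm⟩

theorem isSetoid_of_eqv {C : SCls A} (hC : C.eqv = T.reals.eqv) : C.IsSetoid T where
  refl := by rw [hC]; exact fun _ _ => Iff.rfl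
  symm := by rw [hC]; exact real_symm
  trans := by rw [hC]; exact real_trans
  congr := by rw [hC]; exact fun h h' => real_trans h (real_of_eqv h')

variable (T) in
/-- Interpretation of `Cls.valueAt`. -/
def valueAt (X i : Gen A M) : SCls A where
  mem x := ∃ S, T.Eps (i.pair S) X ∧ ∃ y, T.Eps y S ∧ T.reals.eqv y x
  eqv := T.reals.eqv

theorem cls_valueAt {X i : Y → M} :
    T.cls (g.map fun y => Cls.valueAt (X y) (i y)) = T.valueAt (g.map X) (g.map i) := by
  refine T.cls_ext (fun x => ?_) fun x y => ?_
  · change T.Sat (fun p : Y × M => (Cls.valueAt (X p.1) (i p.1)).mem p.2) (g.prod x) ↔ _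
    simp only [Cls.valueAt, Cls.realSubset, sat_ex, sat_and, sat_eps, sat_eqv, cls_real]
    rfl
  · change T.Sat (fun p : M × M => (Cls.real A).eqv p.1 p.2) (x.prod y) ↔ _
    rw [sat_eqv, cls_real]
    rfl

variable (T) in
/-- Interpretation of `Cls.unionOver`. -/
def unionOver (X J : Gen A M) : SCls A where
  mem x := ∃ j, T.Eps j J ∧ (T.valueAt X j).mem x
  eqv := T.reals.eqv

theorem cls_unionOver {X J : Y → M} :
    T.cls (g.map fun y => Cls.unionOver (X y) (J y)) = T.unionOver (g.map X) (g.map J) := by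
  refine T.cls_ext (fun x => ?_) fun x y => ?_
  · change T.Sat (fun p : Y × M => (Cls.unionOver (X p.1) (J p.1)).mem p.2) (g.prod x) ↔ _
    simp only [Cls.unionOver, sat_ex, sat_and, sat_eps, sat_mem, cls_valueAt]
    rfl
  · change T.Sat (fun p : M × M => (Cls.real A).eqv p.1 p.2) (x.prod y) ↔ _
    rw [sat_eqv, cls_real]
    rfl

end HenkinTheory

end

/-! ### The family of sets of reals -/

noncomputable section
variable {M : Type u} [langSet.Structure M] [Nonempty M] {A : RealizabilityAlgebra M}
variable [hM : Fact (IsModelZFC M)]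

open TV RealizabilityAlgebra

instance {Y : Type*} [Ctx M Y] {t s : Y → M} [DefFun t] [DefFun s] :
    DefFun fun y => sel (t y) (s y) := by
  unfold sel
  infer_instance

instance {Y : Type*} [Ctx M Y] {t s : Y → M} [DefFun t] [DefFun s] :
    DefFun fun y => join (t y) (s y) := by
  unfold join
  infer_instance

theorem sel_sel (i j x : M) : sel i (sel j x) = sel (meet i j) x := by
  by_cases hi : i = one M
  · by_cases hj : j = one M
    · rw [hi, hj, meet_one_one, sel_one]
    · rw [meet_of_ne_right hj, sel_zero, sel_of_ne hj, hi, sel_one]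
  · rw [meet_of_ne_left hi, sel_zero, sel_of_ne hi]

theorem sel_idem (i x : M) : sel i (sel i x) = sel i x := by
  by_cases hi : i = one M
  · rw [hi, sel_one, sel_one]
  · rw [sel_of_ne hi, sel_of_ne hi]

theorem sel_mem_pow {K i x : M} (h : x ∈ₘ pow K) : sel i x ∈ₘ pow K := by
  by_cases hi : i = one M
  · rwa [hi, sel_one]
  · rw [sel_of_ne hi]
    exact zero_mem_pow K

theorem meet_mem_two (i j : M) : meet i j ∈ₘ two M := by
  unfold meet
  split_ifs <;> simp [mem_two]

theorem join_mem_two (i j : M) : join i j ∈ₘ two M := by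
  unfold join
  split_ifs <;> simp [mem_two]

variable (A) in
/-- The real that codes the set `φ` by means of the enumeration `e`: the set of the integers whose
image belongs to `φ`. -/
def codeReal (e φ : M) : M :=
  sepInd (fun n => (TV.ex fun a => (pair n a ε' e) ⩓ neg (prop (¬ a ∈ₘ φ)) : TV A)) A.nat

instance {Y : Type*} [Ctx M Y] {t s : Y → M} [ht : DefFun t] [hs : DefFun s] :
    DefFun fun y => codeReal A (t y) (s y) := by
  have : DefFun fun p : (Y × M) × M => t p.1.1 := ht.comp _
  have : DefFun fun p : (Y × M) × M => s p.1.1 := hs.comp _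
  unfold codeReal
  infer_instance

variable (A) in
/-- The individual that represents `{codeReal e (i φ) | φ ∈ E}`. -/
def valueInd (E e i : M) : M := imgInd A (fun φ => codeReal A e (sel i φ)) (A.gimel E)

instance {E : M} {Y : Type*} [Ctx M Y] {t s : Y → M} [ht : DefFun t] [hs : DefFun s] :
    DefFun fun y => valueInd A E (t y) (s y) := by
  have : DefFun fun p : Y × M => t p.1 := ht.comp _
  have : DefFun fun p : Y × M => s p.1 := hs.comp _
  exact defFun_imgInd (fun y φ => codeReal A (t y) (sel (s y) φ)) _

variable (A) in
/-- The individual that represents the family `i ↦ {codeReal e (i φ) | φ ∈ E}`. -/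
def familyInd (E e : M) : M :=
  imgInd A (fun i => pair i (valueInd A E e i)) (A.gimel (two M))

namespace HenkinTheory
variable {T : HenkinTheory A}

/-- Generic version of `codeReal`. -/
abbrev _root_.Gen.codeReal (e φ : Gen A M) : Gen A M := Gen.map₂ (_root_.codeReal A) e φ

/-- Generic version of `sel`. -/
abbrev _root_.Gen.sel (i x : Gen A M) : Gen A M := Gen.map₂ _root_.sel i x

/-- Membership in `φ` is required with non-zero truth value, not value `1`. If `i ≠ 1`, no
individual belongs to `iφ` with value `1`, so the stricter reading would give every `iφ` the empty
code. -/
theorem eps_codeReal {n e φ : Gen A M} : T.Eps n (e.codeReal φ) ↔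
    T.Nat n ∧ ∃ a, T.Eps (n.pair a) e ∧ ¬ ∀ᶠ ω in T.filter, ¬ a ω ∈ₘ φ ω := by
  refine (T.holds_eps_sepInd (F := fun (y : (PUnit.{u + 1} × M) × M) n => TV.ex fun a =>
    (pair n a ε' y.1.2) ⩓ neg (prop (¬ a ∈ₘ y.2))) (fun ω => ((PUnit.unit, e ω), φ ω)) n
    (fun _ => A.nat)).trans ?_
  rw [and_comm]
  refine and_congr Iff.rfl ?_
  change T.Sat (fun y : (M × M) × M => TV.ex fun a => (pair y.2 a ε' y.1.1) ⩓ neg (prop (¬ a ∈ₘ y.1.2)))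
    ((e.prod φ).prod n) ↔ _
  simp only [sat_ex, sat_and, sat_neg, sat_prop]
  rfl

theorem eps_familyInd {E : M} {e i S : Gen A M} : T.Eps (i.pair S) (e.map (familyInd A E)) ↔
    (∀ᶠ ω in T.filter, i ω ∈ₘ two M) ∧ T.Eqv S (Gen.map₂ (valueInd A E) e i) := by
  refine (T.holds_eps_imgInd (fun (y : PUnit.{u + 1} × M) i => pair i (valueInd A E y.2 i))
    ((Gen.const PUnit.unit).prod e) (i.pair S) (Gen.const (A.gimel (two M)))).trans ?_
  simp only [T.holds_eps_gimel, Gen.const]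
  constructor
  · rintro ⟨x, hx, h⟩
    have h : ∀ᶠ ω in T.filter, i ω = x ω ∧ S ω = valueInd A E (e ω) (x ω) :=
      h.mono fun ω h => pair_inj.1 h
    constructor
    · filter_upwards [hx, h] with ω hx h
      rwa [h.1]
    · filter_upwards [h] with ω h
      refine h.2.trans ?_
      rw [← h.1]
      rfl
  · rintro ⟨h1, h2⟩
    exact ⟨i, h1, h2.mono fun ω h => congrArg (pair (i ω)) h⟩

theorem eps_valueInd {E : M} {e i y : Gen A M} : T.Eps y (Gen.map₂ (valueInd A E) e i) ↔
    ∃ φ : Gen A M, (∀ᶠ ω in T.filter, φ ω ∈ₘ E) ∧ T.Eqv y (e.codeReal (i.sel φ)) := by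
  refine (T.holds_eps_imgInd (fun (y : (PUnit.{u + 1} × M) × M) φ => codeReal A y.1.2 (sel y.2 φ))
    (((Gen.const PUnit.unit).prod e).prod i) y (Gen.const (A.gimel E))).trans ?_
  simp only [T.holds_eps_gimel, Gen.const]
  rfl

variable (T) in
/-- The set of the reals that code a set `i φ` with `φ ∈ E`. -/
def value (E : M) (e i : Gen A M) : SCls A where
  mem x := ∃ φ : Gen A M, (∀ᶠ ω in T.filter, φ ω ∈ₘ E) ∧ T.reals.eqv x (e.codeReal (i.sel φ))
  eqv := T.reals.eqv

theorem valueAt_familyInd {E : M} {e i : Gen A M} (hi : ∀ᶠ ω in T.filter, i ω ∈ₘ two M) :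
    T.valueAt (e.map (familyInd A E)) i = T.value E e i := by
  rw [valueAt, value, SCls.mk.injEq]
  refine ⟨funext fun x => propext ?_, rfl⟩
  constructor
  · rintro ⟨S, hS, y, hy, hyx⟩
    obtain ⟨φ, hφ, h⟩ := eps_valueInd.1 (hy.congr (.refl _) (eps_familyInd.1 hS).2)
    exact ⟨φ, hφ, real_trans (real_symm hyx) (real_of_eqv h)⟩
  · rintro ⟨φ, hφ, h⟩
    exact ⟨_, eps_familyInd.2 ⟨hi, .refl _⟩, _, eps_valueInd.2 ⟨φ, hφ, .refl _⟩, real_symm h⟩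

/-- The hypotheses on a set `K` of the ground model and on an enumeration `e` that ensure that the
subsets of `K` are coded by reals. -/
structure Codes (T : HenkinTheory A) (K : M) (e : Gen A M) : Prop where
  zero_not_mem : ¬ zero M ∈ₘ K
  enumerates : ∃ Z, (∀ z, z ∈ₘ Z ↔ z ∈ₘ K ∨ z = zero M) ∧ T.Enumerates Z e

/-- A number of a generic counterexample `d` to `φ ⊆ ψ` cannot be in the code of `ψ`, because `d ∉
ψ` everywhere. Hence it is not in the code of `φ` either, so `d ∉ φ` along the filter, which means
that there is no counterexample. -/
theorem Codes.subset_of {K : M} {e : Gen A M} (he : T.Codes K e) {φ ψ : Gen A M}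
    (hφ : ∀ᶠ ω in T.filter, φ ω ∈ₘ pow K) (hψ : ∀ᶠ ω in T.filter, ψ ω ∈ₘ pow K)
    (h : ∀ n, T.Eps n (e.codeReal φ) → T.Eps n (e.codeReal ψ)) :
    ∀ᶠ ω in T.filter, ∀ a, a ∈ₘ φ ω → a ∈ₘ ψ ω := by
  classical
  obtain ⟨Z, hZ, hn, hz⟩ := he.enumerates
  -- Where `x ⊆ y`, the value of `d` is `0`, which is outside `K` and hence outside every subset of
  -- `K`. This is why `e` enumerates `K ∪ {0}`.
  let d : M → M → M := fun x y => if h : ∃ a, a ∈ₘ x ∧ ¬ a ∈ₘ y then h.choose else zero M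
  have hd : ∀ x y, x ∈ₘ pow K → y ∈ₘ pow K → d x y ∈ₘ Z ∧ ¬ d x y ∈ₘ y ∧
      (¬ d x y ∈ₘ x → ∀ a, a ∈ₘ x → a ∈ₘ y) := fun x y hx hy => by
    by_cases h : ∃ a, a ∈ₘ x ∧ ¬ a ∈ₘ y
    · simp only [d, dif_pos h]
      exact ⟨(hZ _).2 (.inl (mem_pow.1 hx _ h.choose_spec.1)), h.choose_spec.2,
        fun h' => (h' h.choose_spec.1).elim⟩
    · simp only [d, dif_neg h]
      refine ⟨(hZ _).2 (.inr rfl), fun h' => he.zero_not_mem (mem_pow.1 hy _ h'), fun _ a ha => ?_⟩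
      by_contra hc
      exact h ⟨a, ha, hc⟩
  obtain ⟨n, hnat, hne⟩ := hz (Gen.map₂ d φ ψ) (by
    filter_upwards [hφ, hψ] with ω h1 h2 using (hd _ _ h1 h2).1)
  by_contra hc
  obtain ⟨-, a, ha, hna⟩ := eps_codeReal.1 (h n (eps_codeReal.2 ⟨hnat, _, hne, fun hx => hc (by
    filter_upwards [hφ, hψ, hx] with ω h1 h2 hx using (hd _ _ h1 h2).2.2 hx)⟩))
  refine hna ?_
  filter_upwards [hφ, hψ, hn n _ _ hnat ha hne] with ω h1 h2 h3
  rw [h3]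
  exact (hd _ _ h1 h2).2.1

theorem Codes.eqv_iff {K : M} {e : Gen A M} (he : T.Codes K e) {φ ψ : Gen A M}
    (hφ : ∀ᶠ ω in T.filter, φ ω ∈ₘ pow K) (hψ : ∀ᶠ ω in T.filter, ψ ω ∈ₘ pow K) :
    T.reals.eqv (e.codeReal φ) (e.codeReal ψ) ↔ T.Eqv φ ψ := by
  constructor
  · intro h
    filter_upwards [he.subset_of hφ hψ fun n => (h n).1, he.subset_of hψ hφ fun n => (h n).2]
      with ω h1 h2
    exact ext fun a => ⟨h1 a, h2 a⟩
  · refine fun h => real_of_eqv (h.mono fun ω h => ?_)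
    exact congrArg (codeReal A (e ω)) h

theorem eventually_sel_mem_pow {K : M} {i φ : Gen A M} (hφ : ∀ᶠ ω in T.filter, φ ω ∈ₘ pow K) :
    ∀ᶠ ω in T.filter, i.sel φ ω ∈ₘ pow K := hφ.mono fun _ h => sel_mem_pow h

theorem value_isSetoid {E : M} {e i : Gen A M} : (T.value E e i).IsSetoid T := isSetoid_of_eqv rfl

/-! ### Maps given by a parametrization of their graphs -/

variable (T) in
/-- The individual `f` represents the relation `{(α w, β w) | w ε a}`. -/
def IsGraph (C D : SCls A) (a : Gen A M) (α β : Gen A M → Gen A M) (f : Gen A M) : Prop :=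
  ∀ x y, C.Rel T D f x y ↔ ∃ w, T.Eps w a ∧ C.eqv x (α w) ∧ D.eqv y (β w)

/-- The graph is the image of `a` under `w ↦ (α w, β w)`. Both sides are thus given through a common
parameter `w`: no inverse of the coding is needed, and well-definedness can be checked afterwards in
the two-valued model. -/
theorem exists_isGraph {Y : Type*} [Ctx M Y] (α β : Y → M → M) [DefFun fun p : Y × M => α p.1 p.2]
    [DefFun fun p : Y × M => β p.1 p.2] (g : Gen A Y) (a : Gen A M) (α' β' : Gen A M → Gen A M)
    (hα : ∀ w, α' w = Gen.map₂ α g w) (hβ : ∀ w, β' w = Gen.map₂ β g w) {C D : SCls A}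
    (hC : C.IsSetoid T) (hD : D.IsSetoid T) : ∃ f, T.IsGraph C D a α' β' f := by
  refine ⟨(g.prod a).map fun p => imgInd A (fun w => pair (α p.1 w) (β p.1 w)) p.2, fun x y => ?_⟩
  have key : ∀ x y : Gen A M, T.Eps (x.pair y) ((g.prod a).map fun p =>
      imgInd A (fun w => pair (α p.1 w) (β p.1 w)) p.2) ↔
      ∃ w, T.Eps w a ∧ T.Eqv (x.pair y) (Gen.pair (Gen.map₂ α g w) (Gen.map₂ β g w)) :=
    fun x y => T.holds_eps_imgInd (fun y w => pair (α y w) (β y w)) g (x.pair y) a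
  simp only [SCls.Rel, key, eqv_pair, hα, hβ]
  constructor
  · rintro ⟨x', y', hx, hy, w, hw, h1, h2⟩
    exact ⟨w, hw, hC.congr hx h1, hD.congr hy h2⟩
  · rintro ⟨w, hw, hx, hy⟩
    exact ⟨_, _, hx, hy, w, hw, .refl _, .refl _⟩

section
variable {C D : SCls A} {a : Gen A M} {α β : Gen A M → Gen A M} {f : Gen A M}

theorem IsGraph.isFun (hf : T.IsGraph C D a α β f) (hC : C.IsSetoid T) (hD : D.IsSetoid T)
    (htot : ∀ x, C.mem x → ∃ w, T.Eps w a ∧ C.eqv x (α w) ∧ D.mem (β w))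
    (hwd : ∀ w w', T.Eps w a → T.Eps w' a → C.eqv (α w) (α w') → D.eqv (β w) (β w')) :
    C.IsFun T D f := by
  constructor
  · intro x hx
    obtain ⟨w, hw, h, h'⟩ := htot x hx
    exact ⟨_, h', (hf _ _).2 ⟨w, hw, h, hD.refl h'⟩⟩
  · intro x _ y _ y' _ h h'
    obtain ⟨w, hw, h1, h2⟩ := (hf _ _).1 h
    obtain ⟨w', hw', h1', h2'⟩ := (hf _ _).1 h'
    exact hD.trans h2 (hD.trans (hwd w w' hw hw' (hC.trans (hC.symm h1) h1')) (hD.symm h2'))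

theorem IsGraph.isInj (hf : T.IsGraph C D a α β f) (hC : C.IsSetoid T) (hD : D.IsSetoid T)
    (hinj : ∀ w w', T.Eps w a → T.Eps w' a → D.eqv (β w) (β w') → C.eqv (α w) (α w')) :
    C.IsInj T D f := by
  intro x _ x' _ y _ h h'
  obtain ⟨w, hw, h1, h2⟩ := (hf _ _).1 h
  obtain ⟨w', hw', h1', h2'⟩ := (hf _ _).1 h'
  exact hC.trans h1 (hC.trans (hinj w w' hw hw' (hD.trans (hD.symm h2) h2')) (hC.symm h1'))

theorem IsGraph.isOnto (hf : T.IsGraph C D a α β f) (hC : C.IsSetoid T)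
    (honto : ∀ y, D.mem y → ∃ w, T.Eps w a ∧ D.eqv y (β w) ∧ C.mem (α w)) : C.IsOnto T D f := by
  intro y hy
  obtain ⟨w, hw, h, h'⟩ := honto y hy
  exact ⟨_, h', (hf _ _).2 ⟨w, hw, hC.refl h', h⟩⟩

end

end HenkinTheory

end

/-! ### Maps between the sets of the family -/

noncomputable section
variable {M : Type u} [langSet.Structure M] [Nonempty M] {A : RealizabilityAlgebra M}
variable [hM : Fact (IsModelZFC M)]

open TV RealizabilityAlgebra

theorem meet_comm (i j : M) : meet i j = meet j i := by
  by_cases hi : i = one M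
  · by_cases hj : j = one M
    · rw [hi, hj]
    · rw [meet_of_ne_right hj, meet_of_ne_left hj]
  · rw [meet_of_ne_left hi, meet_of_ne_right hi]

/-! ### Splitting subsets of `ω × U` by parity -/

/-- The section of a subset of `ω × U` formed by the even integers. -/
def evenPart (U w : M) : M :=
  compr fun k => k ∈ₘ times (omega M) U ∧ ∃ n a, k = pair n a ∧ pair (double n) a ∈ₘ w

/-- The section of a subset of `ω × U` formed by the odd integers. -/
def oddPart (U w : M) : M :=
  compr fun k => k ∈ₘ times (omega M) U ∧ ∃ n a, k = pair n a ∧ pair (succ (double n)) a ∈ₘ w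

section parts
variable {U w n a φ ψ : M}

theorem pair_mem_evenPart :
    pair n a ∈ₘ evenPart U w ↔ (n ∈ₘ omega M ∧ a ∈ₘ U) ∧ pair (double n) a ∈ₘ w := by
  rw [evenPart, mem_sep, pair_mem_times]
  refine and_congr_right fun _ => ⟨fun ⟨n', a', h, h'⟩ => ?_, fun h => ⟨n, a, rfl, h⟩⟩
  obtain ⟨rfl, rfl⟩ := pair_inj.1 h
  exact h'

theorem pair_mem_oddPart :
    pair n a ∈ₘ oddPart U w ↔ (n ∈ₘ omega M ∧ a ∈ₘ U) ∧ pair (succ (double n)) a ∈ₘ w := by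
  rw [oddPart, mem_sep, pair_mem_times]
  refine and_congr_right fun _ => ⟨fun ⟨n', a', h, h'⟩ => ?_, fun h => ⟨n, a, rfl, h⟩⟩
  obtain ⟨rfl, rfl⟩ := pair_inj.1 h
  exact h'

theorem evenPart_mem_pow : evenPart U w ∈ₘ pow (times (omega M) U) :=
  mem_pow.2 fun _ h => (mem_sep.1 h).1

theorem oddPart_mem_pow : oddPart U w ∈ₘ pow (times (omega M) U) :=
  mem_pow.2 fun _ h => (mem_sep.1 h).1

instance {Y : Type*} [Ctx M Y] {t : Y → M} [ht : DefFun t] : DefFun fun y => evenPart U (t y) := by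
  have : DefFun fun p : ((Y × M) × M) × M => t p.1.1.1 := ht.comp _
  exact .of_mem (P := fun y k => k ∈ₘ times (omega M) U ∧ ∃ n a, k = pair n a ∧
    pair (double n) a ∈ₘ t y) fun y k => mem_sep

instance {Y : Type*} [Ctx M Y] {t : Y → M} [ht : DefFun t] : DefFun fun y => oddPart U (t y) := by
  have : DefFun fun p : ((Y × M) × M) × M => t p.1.1.1 := ht.comp _
  exact .of_mem (P := fun y k => k ∈ₘ times (omega M) U ∧ ∃ n a, k = pair n a ∧
    pair (succ (double n)) a ∈ₘ t y) fun y k => mem_sep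

theorem ext_pow {x y : M} (hx : x ∈ₘ pow (times (omega M) U)) (hy : y ∈ₘ pow (times (omega M) U))
    (h : ∀ n a, n ∈ₘ omega M → a ∈ₘ U → (pair n a ∈ₘ x ↔ pair n a ∈ₘ y)) : x = y := by
  refine ext fun k => ⟨fun hk => ?_, fun hk => ?_⟩
  · obtain ⟨n, hn, a, ha, rfl⟩ := mem_times.1 (mem_pow.1 hx k hk)
    exact (h n a hn ha).1 hk
  · obtain ⟨n, hn, a, ha, rfl⟩ := mem_times.1 (mem_pow.1 hy k hk)
    exact (h n a hn ha).2 hk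

theorem eq_of_parts (hφ : φ ∈ₘ pow (times (omega M) U)) (hψ : ψ ∈ₘ pow (times (omega M) U))
    (h : evenPart U φ = evenPart U ψ) (h' : oddPart U φ = oddPart U ψ) : φ = ψ := by
  refine ext_pow hφ hψ fun n a hn ha => ?_
  obtain ⟨m, hm, rfl | rfl⟩ := exists_double hn
  · have := (eq_iff.1 h) (pair m a)
    rwa [pair_mem_evenPart, pair_mem_evenPart, and_iff_right ⟨hm, ha⟩, and_iff_right ⟨hm, ha⟩] at this
  · have := (eq_iff.1 h') (pair m a)
    rwa [pair_mem_oddPart, pair_mem_oddPart, and_iff_right ⟨hm, ha⟩, and_iff_right ⟨hm, ha⟩] at this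

theorem exists_merge (hφ : φ ∈ₘ pow (times (omega M) U)) (hψ : ψ ∈ₘ pow (times (omega M) U)) :
    ∃ w, w ∈ₘ pow (times (omega M) U) ∧ evenPart U w = φ ∧ oddPart U w = ψ := by
  let w : M := compr fun k => k ∈ₘ times (omega M) U ∧ ∃ n a, n ∈ₘ omega M ∧
    ((k = pair (double n) a ∧ pair n a ∈ₘ φ) ∨ (k = pair (succ (double n)) a ∧ pair n a ∈ₘ ψ))
  have hw : ∀ k, k ∈ₘ w ↔ k ∈ₘ times (omega M) U ∧ ∃ n a, n ∈ₘ omega M ∧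
    ((k = pair (double n) a ∧ pair n a ∈ₘ φ) ∨
      (k = pair (succ (double n)) a ∧ pair n a ∈ₘ ψ)) := fun k => mem_sep
  refine ⟨w, mem_pow.2 fun k hk => ((hw k).1 hk).1, ext_pow evenPart_mem_pow hφ fun n a hn ha => ?_,
    ext_pow oddPart_mem_pow hψ fun n a hn ha => ?_⟩
  · rw [pair_mem_evenPart, and_iff_right ⟨hn, ha⟩, hw, pair_mem_times,
      and_iff_right ⟨double_mem hn, ha⟩]
    constructor
    · rintro ⟨m, b, hm, ⟨h, h'⟩ | ⟨h, h'⟩⟩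
      · obtain ⟨h1, rfl⟩ := pair_inj.1 h
        rwa [double_inj hn hm h1]
      · exact (double_ne_succ_double hn hm (pair_inj.1 h).1).elim
    · exact fun h => ⟨n, a, hn, .inl ⟨rfl, h⟩⟩
  · rw [pair_mem_oddPart, and_iff_right ⟨hn, ha⟩, hw, pair_mem_times,
      and_iff_right ⟨succ_mem_omega (double_mem hn), ha⟩]
    constructor
    · rintro ⟨m, b, hm, ⟨h, h'⟩ | ⟨h, h'⟩⟩
      · exact (double_ne_succ_double hm hn (pair_inj.1 h).1.symm).elim
      · obtain ⟨h1, rfl⟩ := pair_inj.1 h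
        rwa [double_inj hn hm (succ_inj h1)]
    · exact fun h => ⟨n, a, hn, .inr ⟨rfl, h⟩⟩

end parts

theorem sel_evenPart (U i w : M) : evenPart U (sel i w) = sel i (evenPart U w) := by
  by_cases hi : i = one M
  · rw [hi, sel_one, sel_one]
  · rw [sel_of_ne hi, sel_of_ne hi]
    refine ext_pow evenPart_mem_pow (zero_mem_pow _) fun n a _ _ => ?_
    rw [pair_mem_evenPart]
    exact iff_of_false (fun h => not_mem_zero _ h.2) (not_mem_zero _)

theorem sel_oddPart (U i w : M) : oddPart U (sel i w) = sel i (oddPart U w) := by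
  by_cases hi : i = one M
  · rw [hi, sel_one, sel_one]
  · rw [sel_of_ne hi, sel_of_ne hi]
    refine ext_pow oddPart_mem_pow (zero_mem_pow _) fun n a _ _ => ?_
    rw [pair_mem_oddPart]
    exact iff_of_false (fun h => not_mem_zero _ h.2) (not_mem_zero _)

namespace HenkinTheory
variable {T : HenkinTheory A} {K U : M} {e i j : Gen A M}

theorem not_eps_zero {x : Gen A M} : ¬ T.Eps x (Gen.const (zero M)) := by
  intro h
  have : ∀ x : M, (neps x (zero M) : TV A) = refute False := fun x =>
    neps_eq_refute fun p => iff_of_false (not_mem_zero _) id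
  simp only [Eps, Gen.const, eps, this, T.holds_neg, T.holds_refute] at h
  exact h fun h => T.filter_neBot.ne (Filter.eventually_false_iff_eq_bot.1 h)

theorem value_zero {x : Gen A M} : (T.value (pow K) e (Gen.const (zero M))).mem x ↔
    T.reals.eqv x (Gen.const (zero M)) := by
  have h0 : ∀ φ, T.reals.eqv (e.codeReal (Gen.sel (Gen.const (zero M)) φ)) (Gen.const (zero M)) := by
    refine fun φ n => iff_of_false (fun h => ?_) not_eps_zero
    obtain ⟨-, a, -, ha⟩ := eps_codeReal.1 h
    refine ha (.of_forall fun ω h => ?_)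
    have h : a ω ∈ₘ sel (zero M) (φ ω) := h
    rw [sel_zero] at h
    exact not_mem_zero _ h
  constructor
  · rintro ⟨φ, -, h⟩
    exact real_trans h (h0 φ)
  · exact fun h => ⟨Gen.const (zero M), .of_forall fun _ => zero_mem_pow K,
      real_trans h (real_symm (h0 _))⟩

/-- If `iφ = jψ`, then `jψ = i(iφ) = i(jψ) = (i ∧ j)ψ`. Conversely, `(i ∧ j)φ = i(jφ) = j(iφ)`. -/
theorem value_inter (he : T.Codes K e) {x : Gen A M} : (T.value (pow K) e i).mem x ∧
    (T.value (pow K) e j).mem x ↔ (T.value (pow K) e (Gen.map₂ meet i j)).mem x := by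
  constructor
  · rintro ⟨⟨φ, hφ, h⟩, ψ, hψ, h'⟩
    refine ⟨ψ, hψ, real_trans h ((he.eqv_iff (eventually_sel_mem_pow hφ)
      (eventually_sel_mem_pow hψ)).2 ?_)⟩
    filter_upwards [(he.eqv_iff (eventually_sel_mem_pow hφ)
      (eventually_sel_mem_pow hψ)).1 (real_trans (real_symm h) h')] with ω h
    have h : sel (i ω) (φ ω) = sel (j ω) (ψ ω) := h
    change sel (i ω) (φ ω) = sel (meet (i ω) (j ω)) (ψ ω)
    rw [← sel_sel, ← h, sel_idem]
  · rintro ⟨φ, hφ, h⟩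
    refine ⟨⟨j.sel φ, eventually_sel_mem_pow hφ, real_trans h (real_of_eqv (.of_forall fun ω => ?_))⟩,
      i.sel φ, eventually_sel_mem_pow hφ, real_trans h (real_of_eqv (.of_forall fun ω => ?_))⟩
    · change _ = codeReal A (e ω) (sel (i ω) (sel (j ω) (φ ω)))
      rw [sel_sel]
      rfl
    · change _ = codeReal A (e ω) (sel (j ω) (sel (i ω) (φ ω)))
      rw [sel_sel, meet_comm]
      rfl

theorem value_congr (h : T.Eqv i j) : T.value (pow K) e i = T.value (pow K) e j := by
  have key : ∀ {i j : Gen A M} {x}, T.Eqv i j → (T.value (pow K) e i).mem x →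
      (T.value (pow K) e j).mem x := by
    rintro i j x h ⟨φ, hφ, h'⟩
    refine ⟨φ, hφ, real_trans h' (real_of_eqv (h.mono fun ω h => ?_))⟩
    exact congrArg (fun i => codeReal A (e ω) (sel i (φ ω))) h
  rw [value, value, SCls.mk.injEq]
  exact ⟨funext fun x => propext ⟨key h, key h.symm⟩, rfl⟩

/-- The injection is `n ↦ code (i{(n, 0)})`. Distinct integers differ with truth value `1`
(`Nat.eqv_or_ne`), so equal codes would force `i ≠ 1` along the filter, that is, `i = 0`. -/
theorem infinite_value (he : T.Codes (times (omega M) U) e) (hU : zero M ∈ₘ U)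
    (hi : ∀ᶠ ω in T.filter, i ω ∈ₘ two M) (hi0 : ¬ T.Eqv i (Gen.const (zero M))) :
    ∃ f, (T.ind (Gen.const A.nat)).IsFun T (T.value (pow (times (omega M) U)) e i) f ∧
      (T.ind (Gen.const A.nat)).IsInj T (T.value (pow (times (omega M) U)) e i) f := by
  let s : M → M := fun n => upair (pair n (zero M)) (pair n (zero M))
  have hs : ∀ n : Gen A M, T.Nat n → ∀ᶠ ω in T.filter, n.map s ω ∈ₘ pow (times (omega M) U) :=
    fun n hn => hn.mem_omega.mono fun ω hω => mem_pow.2 fun z hz => by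
      rcases mem_upair.1 hz with rfl | rfl <;> exact pair_mem_times.2 ⟨hω, hU⟩
  obtain ⟨f, hf⟩ := exists_isGraph (fun (_ : (PUnit.{u + 1} × M) × M) n => n)
    (fun y n => codeReal A y.1.2 (sel y.2 (s n))) (((Gen.const PUnit.unit).prod e).prod i)
    (Gen.const A.nat) (fun n => n) (fun n => e.codeReal (i.sel (n.map s))) (fun _ => rfl)
    (fun _ => rfl) (ind_isSetoid (Gen.const A.nat))
    (value_isSetoid (T := T) (E := pow (times (omega M) U)) (e := e) (i := i))
  refine ⟨f, hf.isFun (ind_isSetoid _) value_isSetoid (fun n hn => ?_) (fun n m hn hm h => ?_),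
    hf.isInj (ind_isSetoid _) value_isSetoid (fun n m hn hm h => ?_)⟩
  · exact ⟨n, hn, .refl _, n.map s, hs n hn, real_of_eqv (.refl _)⟩
  · exact real_of_eqv (h.mono fun ω h => congrArg (fun n => codeReal A (e ω) (sel (i ω) (s n))) h)
  · refine (Nat.eqv_or_ne hn hm).resolve_right fun hne => hi0 ?_
    filter_upwards [hi, hne, (he.eqv_iff (eventually_sel_mem_pow (i := i) (hs n hn))
      (eventually_sel_mem_pow (hs m hm))).1 h] with ω hi hne h
    refine (mem_two.1 hi).resolve_right fun hi => hne ?_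
    have h : sel (i ω) (s (n ω)) = sel (i ω) (s (m ω)) := h
    rw [hi, sel_one, sel_one] at h
    have h1 : pair (n ω) (zero M) ∈ₘ s (m ω) := h ▸ mem_upair.2 (.inl rfl)
    exact (pair_inj.1 ((mem_upair.1 h1).elim id id)).1

theorem eqv_codeReal {φ ψ : Gen A M} (h : T.Eqv φ ψ) :
    T.reals.eqv (e.codeReal φ) (e.codeReal ψ) :=
  real_of_eqv (h.mono fun ω h => congrArg (codeReal A (e ω)) h)

/-- The even and odd sections give a bijection of `𝒫(ω × U)` with its square. It commutes with
multiplication by `i`, hence restricts to `X_i`. -/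
theorem square_equip_value (he : T.Codes (times (omega M) U) e) :
    ∃ f, ((T.value (pow (times (omega M) U)) e i).prod T (T.value (pow (times (omega M) U)) e i)).IsFun
        T (T.value (pow (times (omega M) U)) e i) f ∧
      ((T.value (pow (times (omega M) U)) e i).prod T (T.value (pow (times (omega M) U)) e i)).IsInj
        T (T.value (pow (times (omega M) U)) e i) f ∧
      ((T.value (pow (times (omega M) U)) e i).prod T (T.value (pow (times (omega M) U)) e i)).IsOnto
        T (T.value (pow (times (omega M) U)) e i) f := by
  have hV : (T.value (pow (times (omega M) U)) e i).IsSetoid T := value_isSetoid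
  have hE : ∀ w, T.Eps w (Gen.const (A.gimel (pow (times (omega M) U)))) ↔
      ∀ᶠ ω in T.filter, w ω ∈ₘ pow (times (omega M) U) :=
    fun w => eps_gimel_iff (a := Gen.const (pow (times (omega M) U)))
  have hl : ∀ w : Gen A M, ∀ᶠ ω in T.filter, i.sel (w.map (evenPart U)) ω ∈ₘ pow (times (omega M) U) :=
    fun w => .of_forall fun ω => sel_mem_pow evenPart_mem_pow
  have hr : ∀ w : Gen A M, ∀ᶠ ω in T.filter, i.sel (w.map (oddPart U)) ω ∈ₘ pow (times (omega M) U) :=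
    fun w => .of_forall fun ω => sel_mem_pow oddPart_mem_pow
  obtain ⟨f, hf⟩ := exists_isGraph (fun (y : (PUnit.{u + 1} × M) × M) w =>
      pair (codeReal A y.1.2 (sel y.2 (evenPart U w))) (codeReal A y.1.2 (sel y.2 (oddPart U w))))
    (fun y w => codeReal A y.1.2 (sel y.2 w)) (((Gen.const PUnit.unit).prod e).prod i)
    (Gen.const (A.gimel (pow (times (omega M) U))))
    (fun w => Gen.pair (e.codeReal (i.sel (w.map (evenPart U)))) (e.codeReal (i.sel (w.map (oddPart U)))))
    (fun w => e.codeReal (i.sel w)) (fun _ => rfl) (fun _ => rfl) (hV.prod hV) hV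
  refine ⟨f, hf.isFun (hV.prod hV) hV ?_ ?_, hf.isInj (hV.prod hV) hV ?_,
    hf.isOnto (hV.prod hV) ?_⟩
  · rintro z ⟨x, ⟨φ, hφ, hx⟩, y, ⟨ψ, hψ, hy⟩, hz⟩
    classical
    -- A set with prescribed even part `φ` and odd part `ψ`, chosen in the ground model and applied
    -- pointwise.
    let m : M → M → M := fun φ ψ => if h : ∃ w, w ∈ₘ pow (times (omega M) U) ∧
      evenPart U w = φ ∧ oddPart U w = ψ then h.choose else zero M
    have hm : ∀ φ ψ, φ ∈ₘ pow (times (omega M) U) → ψ ∈ₘ pow (times (omega M) U) →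
        m φ ψ ∈ₘ pow (times (omega M) U) ∧ evenPart U (m φ ψ) = φ ∧ oddPart U (m φ ψ) = ψ :=
      fun φ ψ hφ hψ => by
        have h := exists_merge hφ hψ
        simp only [m, dif_pos h]
        exact h.choose_spec
    have hw : ∀ᶠ ω in T.filter, Gen.map₂ m φ ψ ω ∈ₘ pow (times (omega M) U) ∧
        evenPart U (Gen.map₂ m φ ψ ω) = φ ω ∧ oddPart U (Gen.map₂ m φ ψ ω) = ψ ω := by
      filter_upwards [hφ, hψ] with ω h1 h2 using hm _ _ h1 h2
    refine ⟨Gen.map₂ m φ ψ, (hE _).2 (hw.mono fun ω h => h.1),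
      ⟨x, y, _, _, hz, .refl _, real_trans hx (eqv_codeReal ?_), real_trans hy (eqv_codeReal ?_)⟩,
      _, hw.mono fun ω h => h.1, real_of_eqv (.refl _)⟩
    · exact hw.mono fun ω h => congrArg (sel (i ω)) h.2.1.symm
    · exact hw.mono fun ω h => congrArg (sel (i ω)) h.2.2.symm
  · intro w w' hw hw' h
    rw [SCls.prod_eqv_iff hV hV] at h
    refine eqv_codeReal ?_
    filter_upwards [(hE _).1 hw, (hE _).1 hw', (he.eqv_iff (hl w) (hl w')).1 h.1,
      (he.eqv_iff (hr w) (hr w')).1 h.2] with ω h1 h2 h3 h4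
    have h3 : sel (i ω) (evenPart U (w ω)) = sel (i ω) (evenPart U (w' ω)) := h3
    have h4 : sel (i ω) (oddPart U (w ω)) = sel (i ω) (oddPart U (w' ω)) := h4
    rw [← sel_evenPart, ← sel_evenPart] at h3
    rw [← sel_oddPart, ← sel_oddPart] at h4
    exact eq_of_parts (sel_mem_pow h1) (sel_mem_pow h2) h3 h4
  · intro w w' hw hw' h
    rw [SCls.prod_eqv_iff hV hV]
    have h := (he.eqv_iff (eventually_sel_mem_pow ((hE _).1 hw))
      (eventually_sel_mem_pow ((hE _).1 hw'))).1 h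
    refine ⟨eqv_codeReal (h.mono fun ω h => ?_), eqv_codeReal (h.mono fun ω h => ?_)⟩
    · change sel (i ω) (evenPart U (w ω)) = sel (i ω) (evenPart U (w' ω))
      rw [← sel_evenPart, ← sel_evenPart]
      exact congrArg (evenPart U) h
    · change sel (i ω) (oddPart U (w ω)) = sel (i ω) (oddPart U (w' ω))
      rw [← sel_oddPart, ← sel_oddPart]
      exact congrArg (oddPart U) h
  · rintro y ⟨φ, hφ, hy⟩
    exact ⟨φ, (hE _).2 hφ, hy, _, ⟨_, .of_forall fun _ => evenPart_mem_pow, real_of_eqv (.refl _)⟩, _,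
      ⟨_, .of_forall fun _ => oddPart_mem_pow, real_of_eqv (.refl _)⟩, .refl _⟩

end HenkinTheory

end

/-! ### Disjoint joins, and the surjection from `X_1` onto `ℝ` -/

noncomputable section
variable {M : Type u} [langSet.Structure M] [Nonempty M] {A : RealizabilityAlgebra M}
variable [hM : Fact (IsModelZFC M)]

open TV RealizabilityAlgebra

theorem join_eq_one {i j : M} : join i j = one M ↔ i = one M ∨ j = one M := by
  unfold join
  split_ifs with h <;> simp [h, GroundModel.one_ne_zero.symm]

/-- The values at `i ∨ j` are determined by the values at `i` and at `j`. -/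
theorem sel_join_eq_iff {i j x y : M} :
    sel (join i j) x = sel (join i j) y ↔ sel i x = sel i y ∧ sel j x = sel j y := by
  by_cases hi : i = one M <;> by_cases hj : j = one M <;>
    simp [sel, join_eq_one, hi, hj]

/-- The set equal to `x` at `i` and to `y` elsewhere. -/
def mix (i x y : M) : M := open scoped Classical in if i = one M then x else y

theorem sel_mix_left (i x y : M) : sel i (mix i x y) = sel i x := by
  by_cases hi : i = one M <;> simp [sel, mix, hi]

theorem sel_mix_right {i j x y : M} (h : meet i j = zero M) : sel j (mix i x y) = sel j y := by
  by_cases hi : i = one M <;> by_cases hj : j = one M <;> simp_all [sel, mix, meet, GroundModel.one_ne_zero]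

theorem mix_mem {E i x y : M} (hx : x ∈ₘ E) (hy : y ∈ₘ E) : mix i x y ∈ₘ E := by
  unfold mix
  split_ifs <;> assumption

namespace HenkinTheory
variable {T : HenkinTheory A} {K U : M} {e i j : Gen A M}

/-- The bijection takes `(i ∨ j)w` to `(iw, jw)`. It is onto because, when `i ∧ j = 0`, a set equal
to `φ` where `i = 1` and to `ψ` elsewhere has the prescribed parts. -/
theorem value_join_equip (he : T.Codes K e) (hij : ∀ᶠ ω in T.filter, meet (i ω) (j ω) = zero M) :
    ∃ f, (T.value (pow K) e (Gen.map₂ join i j)).IsFun T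
        ((T.value (pow K) e i).prod T (T.value (pow K) e j)) f ∧
      (T.value (pow K) e (Gen.map₂ join i j)).IsInj T
        ((T.value (pow K) e i).prod T (T.value (pow K) e j)) f ∧
      (T.value (pow K) e (Gen.map₂ join i j)).IsOnto T
        ((T.value (pow K) e i).prod T (T.value (pow K) e j)) f := by
  have hI : (T.value (pow K) e i).IsSetoid T := value_isSetoid
  have hJ : (T.value (pow K) e j).IsSetoid T := value_isSetoid
  have hV : (T.value (pow K) e (Gen.map₂ join i j)).IsSetoid T := value_isSetoid
  have hE : ∀ w, T.Eps w (Gen.const (A.gimel (pow K))) ↔ ∀ᶠ ω in T.filter, w ω ∈ₘ pow K :=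
    fun w => eps_gimel_iff (a := Gen.const (pow K))
  have key : ∀ w w', T.Eps w (Gen.const (A.gimel (pow K))) → T.Eps w' (Gen.const (A.gimel (pow K))) →
      (T.reals.eqv (e.codeReal (Gen.sel (Gen.map₂ join i j) w))
        (e.codeReal (Gen.sel (Gen.map₂ join i j) w')) ↔
      ((T.value (pow K) e i).prod T (T.value (pow K) e j)).eqv
        (Gen.pair (e.codeReal (i.sel w)) (e.codeReal (j.sel w)))
        (Gen.pair (e.codeReal (i.sel w')) (e.codeReal (j.sel w')))) := by
    intro w w' hw hw'
    rw [hE] at hw hw'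
    rw [SCls.prod_eqv_iff hI hJ]
    refine (he.eqv_iff (eventually_sel_mem_pow hw) (eventually_sel_mem_pow hw')).trans (Iff.trans ?_
      (and_congr (he.eqv_iff (eventually_sel_mem_pow hw) (eventually_sel_mem_pow hw'))
      (he.eqv_iff (eventually_sel_mem_pow hw) (eventually_sel_mem_pow hw'))).symm)
    refine Iff.trans ?_ Filter.eventually_and
    exact Filter.eventually_congr (.of_forall fun ω => sel_join_eq_iff)
  obtain ⟨f, hf⟩ := exists_isGraph (fun (y : ((PUnit.{u + 1} × M) × M) × M) w =>
      codeReal A y.1.1.2 (sel (join y.1.2 y.2) w))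
    (fun y w => pair (codeReal A y.1.1.2 (sel y.1.2 w)) (codeReal A y.1.1.2 (sel y.2 w)))
    ((((Gen.const PUnit.unit).prod e).prod i).prod j) (Gen.const (A.gimel (pow K)))
    (fun w => e.codeReal (Gen.sel (Gen.map₂ join i j) w))
    (fun w => Gen.pair (e.codeReal (i.sel w)) (e.codeReal (j.sel w)))
    (fun _ => rfl) (fun _ => rfl) hV (hI.prod hJ)
  refine ⟨f, hf.isFun hV (hI.prod hJ) ?_ fun w w' hw hw' => (key w w' hw hw').1,
    hf.isInj hV (hI.prod hJ) fun w w' hw hw' => (key w w' hw hw').2, hf.isOnto hV ?_⟩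
  · rintro x ⟨φ, hφ, hx⟩
    exact ⟨φ, (hE φ).2 hφ, hx, _, ⟨φ, hφ, real_of_eqv (.refl _)⟩, _,
      ⟨φ, hφ, real_of_eqv (.refl _)⟩, .refl _⟩
  · rintro z ⟨x, ⟨φ, hφ, hx⟩, y, ⟨ψ, hψ, hy⟩, hz⟩
    let w : Gen A M := ((i.prod φ).prod ψ).map fun p => mix p.1.1 p.1.2 p.2
    have hw : ∀ᶠ ω in T.filter, w ω ∈ₘ pow K := by
      filter_upwards [hφ, hψ] with ω h1 h2 using mix_mem h1 h2
    refine ⟨w, (hE w).2 hw, ⟨x, y, _, _, hz, .refl _, real_trans hx (eqv_codeReal ?_),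
      real_trans hy (eqv_codeReal ?_)⟩, w, hw, real_of_eqv (.refl _)⟩
    · exact .of_forall fun ω => (sel_mix_left (i ω) (φ ω) (ψ ω)).symm
    · exact hij.mono fun ω h => (sel_mix_right (x := φ ω) (y := ψ ω) h).symm

variable (A) in
/-- The set of the integers of the realizability model that belong to `w`. -/
def natPart (w : M) : M := sepInd (fun n => (n ε' w : TV A)) A.nat

instance {Y : Type*} [Ctx M Y] {t : Y → M} [ht : DefFun t] : DefFun fun y => natPart A (t y) := by
  have : DefFun fun p : Y × M => t p.1 := ht.comp _
  unfold natPart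
  infer_instance

theorem eps_natPart {n w : Gen A M} : T.Eps n (w.map (natPart A)) ↔ T.Nat n ∧ T.Eps n w := by
  rw [and_comm]
  exact T.holds_eps_sepInd (F := fun (y : PUnit.{u + 1} × M) n => (n ε' y.2 : TV A))
    (fun ω => (PUnit.unit, w ω)) n (fun _ => A.nat)

/-- A set `φ ⊆ ω × U` of the ground model is itself an individual, whose strong elements among the
integers form a real. The map sends `code φ` to this real. -/
theorem value_one_surj (he : T.Codes (times (omega M) U) e) (hU : ∀ p, p ∈ₘ A.Stk → p ∈ₘ U) :
    ∃ f, (T.value (pow (times (omega M) U)) e (Gen.const (one M))).IsFun T T.reals f ∧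
      (T.value (pow (times (omega M) U)) e (Gen.const (one M))).IsOnto T T.reals f := by
  have hV : (T.value (pow (times (omega M) U)) e (Gen.const (one M))).IsSetoid T := value_isSetoid
  have hR : T.reals.IsSetoid T := isSetoid_of_eqv rfl
  have hE : ∀ w, T.Eps w (Gen.const (A.gimel (pow (times (omega M) U)))) ↔
      ∀ᶠ ω in T.filter, w ω ∈ₘ pow (times (omega M) U) :=
    fun w => eps_gimel_iff (a := Gen.const (pow (times (omega M) U)))
  obtain ⟨f, hf⟩ := exists_isGraph (fun (y : PUnit.{u + 1} × M) w =>
      codeReal A y.2 (sel (one M) w)) (fun y w => natPart A w) ((Gen.const PUnit.unit).prod e)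
    (Gen.const (A.gimel (pow (times (omega M) U))))
    (fun w => e.codeReal (Gen.sel (Gen.const (one M)) w)) (fun w => w.map (natPart A))
    (fun _ => rfl) (fun _ => rfl) hV hR
  refine ⟨f, hf.isFun hV hR ?_ ?_, hf.isOnto hV ?_⟩
  · rintro x ⟨φ, hφ, hx⟩
    exact ⟨φ, (hE φ).2 hφ, hx, fun n hn => (eps_natPart.1 hn).1⟩
  · intro w w' hw hw' h
    refine real_of_eqv ?_
    filter_upwards [(he.eqv_iff (eventually_sel_mem_pow ((hE w).1 hw))
      (eventually_sel_mem_pow ((hE w').1 hw'))).1 h] with ω h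
    have h : sel (one M) (w ω) = sel (one M) (w' ω) := h
    rw [sel_one, sel_one] at h
    exact congrArg (natPart A) h
  · intro r hr
    -- Cutting `r` down to `ω × U` does not change the falsity value of `n ∉ r` for `n ∈ ω`, as `U`
    -- contains all stacks. The integers in `r` stay the same, and the cut set is a subset of `ω ×
    -- U`.
    let s : M → M := fun r => compr fun k => k ∈ₘ times (omega M) U ∧ k ∈ₘ r
    have hs : ∀ r k, k ∈ₘ s r ↔ k ∈ₘ times (omega M) U ∧ k ∈ₘ r := fun r k => mem_sep
    have hsE : ∀ᶠ ω in T.filter, r.map s ω ∈ₘ pow (times (omega M) U) :=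
      .of_forall fun ω => mem_pow.2 fun k hk => ((hs _ k).1 hk).1
    refine ⟨r.map s, (hE _).2 hsE, fun n => ?_, _, hsE, real_of_eqv (.refl _)⟩
    rw [eps_natPart]
    have key : T.Nat n → (T.Eps n r ↔ T.Eps n (r.map s)) := fun hn => by
      refine T.holds_congr (fun F : TV A => neg F) (hn.mem_omega.mono fun ω hω => TV.ext fun p => ?_)
      rw [mem_neps, mem_neps]
      change _ ↔ _ ∈ₘ s (r ω)
      rw [hs, pair_mem_times, and_iff_right ⟨hω, hU _ p.2⟩]
    exact ⟨fun h => ⟨hr n h, (key (hr n h)).1 h⟩, fun h => (key h.1).2 h.2⟩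

end HenkinTheory

end

/-! ### Nonexistence of surjections -/

noncomputable section
variable {M : Type u} [langSet.Structure M] [Nonempty M] {A : RealizabilityAlgebra M}
variable [hM : Fact (IsModelZFC M)]

open TV RealizabilityAlgebra

/-- A definable family of classes. -/
class DefCls {Y : Type*} [Ctx M Y] (C : Y → Cls A) : Prop where
  mem : DefTV fun p : Y × M => (C p.1).mem p.2
  eqv : DefTV fun p : (Y × M) × M => (C p.1.1).eqv p.1.2 p.2

theorem DefTV.subst {Y : Type*} [Ctx M Y] {F : Y → M → TV A} (hF : DefTV fun p : Y × M => F p.1 p.2)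
    (t : Y → M) [ht : DefFun t] : DefTV fun y => F y (t y) := by
  have : DefFun fun p : Y × M => t p.1 := ht.comp _
  have : DefPred M fun p : (Y × M) × M => MemM p.1.2 (F p.1.1 p.2) :=
    hF.out.comp fun p : (Y × M) × M => ((p.1.1, p.2), p.1.2)
  exact ⟨DefPred.subst (P := fun (p : Y × M) x => MemM p.2 (F p.1 x)) this fun p => t p.1⟩

namespace DefCls
variable {Y Z : Type*} [Ctx M Y] [Ctx M Z] {C D : Y → Cls A} {t s f : Y → M}

theorem comp (h : DefCls C) (f : Z → Y) [hf : CtxMap M f] : DefCls fun z => C (f z) := by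
  have h1 : CtxMap M fun p : Z × M => (f p.1, p.2) := hf.lift
  have h2 : CtxMap M fun p : (Z × M) × M => ((f p.1.1, p.1.2), p.2) := h1.lift
  exact ⟨h.mem.comp fun p : Z × M => (f p.1, p.2),
    h.eqv.comp fun p : (Z × M) × M => ((f p.1.1, p.1.2), p.2)⟩

instance memTV [hC : DefCls C] [DefFun t] : DefTV fun y => (C y).mem (t y) :=
  DefTV.subst (F := fun y x => (C y).mem x) hC.mem t

instance eqvTV [hC : DefCls C] [ht : DefFun t] [DefFun s] : DefTV fun y => (C y).eqv (t y) (s y) := by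
  have : DefFun fun p : Y × M => s p.1 := DefFun.comp ‹_› _
  have : DefTV fun p : Y × M => (C p.1).eqv p.2 (s p.1) :=
    DefTV.subst (F := fun (p : Y × M) x => (C p.1).eqv p.2 x) hC.eqv fun p => s p.1
  exact DefTV.subst (F := fun y x => (C y).eqv x (s y)) this t

instance ofInd [ht : DefFun t] : DefCls fun y => (Cls.ofInd (t y) : Cls A) := by
  have : DefFun fun p : Y × M => t p.1 := ht.comp _
  refine ⟨?_, ?_⟩ <;> unfold Cls.ofInd <;> infer_instance

instance real : DefCls fun _ : Y => Cls.real A := by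
  refine ⟨?_, ?_⟩ <;> unfold Cls.real <;> infer_instance

instance valueAt [ht : DefFun t] [hs : DefFun s] :
    DefCls fun y => (Cls.valueAt (t y) (s y) : Cls A) := by
  have : DefFun fun p : (Y × M) × M => t p.1.1 := ht.comp _
  have : DefFun fun p : (Y × M) × M => s p.1.1 := hs.comp _
  refine ⟨?_, inferInstanceAs (DefTV fun p : (Y × M) × M => (Cls.real A).eqv p.1.2 p.2)⟩
  unfold Cls.valueAt Cls.realSubset
  infer_instance

instance unionOver [ht : DefFun t] [hs : DefFun s] :
    DefCls fun y => (Cls.unionOver (t y) (s y) : Cls A) := by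
  have : DefFun fun p : (Y × M) × M => t p.1.1 := ht.comp _
  have : DefFun fun p : (Y × M) × M => s p.1.1 := hs.comp _
  refine ⟨?_, inferInstanceAs (DefTV fun p : (Y × M) × M => (Cls.real A).eqv p.1.2 p.2)⟩
  unfold Cls.unionOver
  infer_instance

instance sum [hC : DefCls C] [hD : DefCls D] : DefCls fun y => (C y).sum (D y) := by
  have : DefCls fun p : (Y × M) × M => C p.1.1 := hC.comp _
  have : DefCls fun p : (Y × M) × M => D p.1.1 := hD.comp _
  have : DefCls fun p : (((Y × M) × M) × M) × M => C p.1.1.1.1 := hC.comp _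
  have : DefCls fun p : (((Y × M) × M) × M) × M => D p.1.1.1.1 := hD.comp _
  refine ⟨?_, ?_⟩ <;> unfold Cls.sum Cls.ex <;> infer_instance

instance prod [hC : DefCls C] [hD : DefCls D] : DefCls fun y => (C y).prod (D y) := by
  have : DefCls fun p : (Y × M) × M => C p.1.1 := hC.comp _
  have : DefCls fun p : ((Y × M) × M) × M => D p.1.1.1 := hD.comp _
  have : DefCls fun p : (((((Y × M) × M) × M) × M) × M) × M => C p.1.1.1.1.1.1 := hC.comp _
  have : DefCls fun p : (((((Y × M) × M) × M) × M) × M) × M => D p.1.1.1.1.1.1 := hD.comp _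
  refine ⟨?_, ?_⟩ <;> unfold Cls.prod Cls.ex <;> infer_instance

instance relTV [hC : DefCls C] [hD : DefCls D] [hf : DefFun f] [ht : DefFun t] [hs : DefFun s] :
    DefTV fun y => (C y).rel (D y) (f y) (t y) (s y) := by
  have : DefCls fun p : (Y × M) × M => C p.1.1 := hC.comp _
  have : DefCls fun p : (Y × M) × M => D p.1.1 := hD.comp _
  have : DefFun fun p : (Y × M) × M => f p.1.1 := hf.comp _
  have : DefFun fun p : (Y × M) × M => t p.1.1 := ht.comp _
  have : DefFun fun p : (Y × M) × M => s p.1.1 := hs.comp _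
  unfold Cls.rel
  infer_instance

end DefCls

namespace HenkinTheory
variable {T : HenkinTheory A}

/-- If the elements of `C` have codes `c z (j x)` with `z ∈ ω`, and if the subsets of `K` of the form
`i v` code elements of `D`, then a surjection from `C` onto `D` is possible only if `i ≤ j` for one
of these `j`. -/
theorem exists_le_of_surj {Y : Type*} [Ctx M Y] (C D : Y → Cls A) [hC : DefCls C] [hD : DefCls D]
    (c : Y → M → M → M) (β : Y → M → M) (i : Y → M)
    [hc : DefFun fun p : (Y × M) × M => c p.1.1 p.1.2 p.2] [hβ : DefFun fun p : Y × M => β p.1 p.2]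
    [hi : DefFun i] (g : Gen A Y) {K : M} (hK : ∀ z t, z ∈ₘ omega M → t ∈ₘ A.Lam → pair z t ∈ₘ K)
    {C' D' : SCls A} (hCC : T.cls (g.map C) = C') (hDD : T.cls (g.map D) = D')
    (hC' : C'.IsSetoid T) (hD' : D'.IsSetoid T) (c' : Gen A M → Gen A M → Gen A M)
    (β' : Gen A M → Gen A M) (i' : Gen A M)
    (hc' : ∀ z x, c' z x = ((g.prod z).prod x).map fun p => c p.1.1 p.1.2 p.2)
    (hβ' : ∀ v, β' v = Gen.map₂ β g v) (hii : i' = g.map i) (h2 : ∀ᶠ ω in T.filter, i' ω ∈ₘ two M)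
    (hmem : ∀ v : Gen A M, (∀ᶠ ω in T.filter, v ω ∈ₘ pow K) → D'.mem (β' v))
    (hinj : ∀ v v' : Gen A M, (∀ᶠ ω in T.filter, v ω ∈ₘ pow K) → (∀ᶠ ω in T.filter, v' ω ∈ₘ pow K) →
      T.Eqv (i'.sel v) v → T.Eqv (i'.sel v') v' → D'.eqv (β' v) (β' v') → T.Eqv v v')
    (P : Gen A M → Prop) (hP : ∀ x, C'.mem x → ∃ z j x', (∀ᶠ ω in T.filter, z ω ∈ₘ omega M) ∧ P j ∧
      C'.mem (c' z (j.sel x')) ∧ C'.eqv x (c' z (j.sel x')))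
    (h : ∃ f, C'.IsFun T D' f ∧ C'.IsOnto T D' f) :
    ∃ j, P j ∧ T.Eqv (Gen.map₂ meet i' j) i' := by
  subst hCC hDD hii
  obtain rfl : c' = fun z x => ((g.prod z).prod x).map fun p => c p.1.1 p.1.2 p.2 :=
    funext fun z => funext fun x => hc' z x
  obtain rfl : β' = Gen.map₂ β g := funext hβ'
  obtain ⟨f, hf, hf'⟩ := h
  -- `G z x v` says that `f` sends `c z x` to `β v`, where `v ⊆ K` and `iv = v`. The last condition
  -- makes `v` recoverable from `β v`, so `G` is functional in `v`.
  let G : Y × M → M → M → M → TV A := fun y z x v => (C y.1).mem (c y.1 z x) ⩓ prop (v ∈ₘ pow K) ⩓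
    prop (sel (i y.1) v = v) ⩓ (C y.1).rel (D y.1) y.2 (c y.1 z x) (β y.1 v)
  have hG : DefTV fun p : ((Y × M) × M) × M => G p.1.1 p.1.2 (zero M) p.2 := by
    have : DefCls fun p : ((Y × M) × M) × M => C p.1.1.1 := hC.comp _
    have : DefCls fun p : ((Y × M) × M) × M => D p.1.1.1 := hD.comp _
    have : DefFun fun p : ((Y × M) × M) × M => i p.1.1.1 := hi.comp _
    have : DefFun fun p : ((Y × M) × M) × M => c p.1.1.1 p.1.2 (zero M) :=
      hc.comp fun p : ((Y × M) × M) × M => ((p.1.1.1, p.1.2), zero M)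
    have : DefFun fun p : ((Y × M) × M) × M => β p.1.1.1 p.2 :=
      hβ.comp fun p : ((Y × M) × M) × M => (p.1.1.1, p.2)
    infer_instance
  have hGy : ∀ y, DefTV fun p : (PUnit.{u + 1} × M) × M => G y p.1.2 (zero M) p.2 := fun y =>
    hG.comp fun p : (PUnit.{u + 1} × M) × M => ((y, p.1.2), p.2)
  have key : ∀ z x v : Gen A M, T.holds (fun ω => G (g ω, f ω) (z ω) (x ω) (v ω)) ↔
      (T.cls (g.map C)).mem (((g.prod z).prod x).map fun p => c p.1.1 p.1.2 p.2) ∧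
      (∀ᶠ ω in T.filter, v ω ∈ₘ pow K) ∧ T.Eqv ((g.map i).sel v) v ∧
      (T.cls (g.map C)).Rel T (T.cls (g.map D)) f
        (((g.prod z).prod x).map fun p => c p.1.1 p.1.2 p.2) (Gen.map₂ β g v) := fun z x v => by
    change T.Sat (fun p : (((Y × M) × M) × M) × M => G p.1.1.1 p.1.1.2 p.1.2 p.2)
      ((((g.prod f).prod z).prod x).prod v) ↔ _
    simp only [G, sat_and, sat_prop, sat_mem, sat_rel]
    rfl
  -- The target is `iΔ`, where `Δ` diagonalises against `G` at the argument `0`. Surjectivity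
  -- provides a preimage of its image under `β`, coded by some `c z (jx')`.
  let w : Gen A M := (g.prod f).map fun y => sel (i y.1) (diagonal K fun z v => G y z (zero M) v)
  have hd : ∀ y, diagonal K (fun z v => G y z (zero M) v) ∈ₘ pow K := fun y =>
    have := hGy y
    mem_pow.2 fun k hk => (mem_diagonal.1 hk).1
  have hw : ∀ᶠ ω in T.filter, w ω ∈ₘ pow K := .of_forall fun ω => sel_mem_pow (hd _)
  obtain ⟨x, hx, hxw⟩ := hf' _ (hmem w hw)
  obtain ⟨z, j, x', hz, hj, hxC, hxx⟩ := hP x hx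
  refine ⟨j, hj, ?_⟩
  have hfun : T.holds fun ω => TV.all fun z => TV.all fun x => TV.all fun v => TV.all fun v' =>
      G (g ω, f ω) z x v ⇾ G (g ω, f ω) z x v' ⇾ prop (v = v') := by
    change T.Sat (fun y => TV.all fun z => TV.all fun x => TV.all fun v => TV.all fun v' =>
      G y z x v ⇾ G y z x v' ⇾ prop (v = v')) (g.prod f)
    simp only [sat_all, sat_imp, sat_prop]
    intro z x v v' h1 h2
    obtain ⟨h1, h3, h4, h5⟩ := (key z x v).1 h1
    obtain ⟨-, h3', h4', h5'⟩ := (key z x v').1 h2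
    exact hinj v v' h3 h3' h4 h4' (hf.2 _ h1 _ (hmem v h3) _ (hmem v' h3') h5 h5')
  have := T.holds_imp.1 (T.mp (.diagonal (fun ω => G (g ω, f ω)) K hK (fun ω => hGy _)
    (fun ω => i (g ω)) z j x') hfun) ((key z (j.sel x') w).2 ⟨hxC, hw,
      .of_forall fun ω => sel_idem _ _, hC'.rel_congr hD' hxw hxx (hD'.refl (hmem w hw))⟩)
  filter_upwards [h2, hz, T.holds_prop.1 this] with ω h2 hz h using h h2 hz

end HenkinTheory

end

/-! ### The negative items, deduced from the diagonal argument -/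

noncomputable section
variable {M : Type u} [langSet.Structure M] [Nonempty M] {A : RealizabilityAlgebra M}
variable [hM : Fact (IsModelZFC M)]

open TV RealizabilityAlgebra

theorem join_comm (i j : M) : join i j = join j i := by
  unfold join
  by_cases h : i = one M ∨ j = one M
  · rw [if_pos h, if_pos h.symm]
  · rw [if_neg h, if_neg fun h' => h h'.symm]

theorem HenkinTheory.not_eqv_pair_zero_one {T : HenkinTheory A} {z x y : Gen A M}
    (h : T.Eqv z (Gen.pair (Gen.const (zero M)) x)) (h' : T.Eqv z (Gen.pair (Gen.const (one M)) y)) :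
    False := by
  obtain ⟨ω, hω⟩ := Filter.Eventually.exists (HenkinTheory.eqv_pair.1 (h.symm.trans h')).1
  exact one_ne_zero (M := M) hω.symm

theorem SCls.IsSetoid.sum {T : HenkinTheory A} {C D : SCls A} (hC : C.IsSetoid T)
    (hD : D.IsSetoid T) : (C.sum T D).IsSetoid T where
  refl := by
    rintro z (⟨x, hx, h⟩ | ⟨x, hx, h⟩)
    · exact .inl ⟨x, x, h, h, hC.refl hx⟩
    · exact .inr ⟨x, x, h, h, hD.refl hx⟩
  symm := by
    rintro z w (⟨x, y, h1, h2, h⟩ | ⟨x, y, h1, h2, h⟩)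
    · exact .inl ⟨y, x, h2, h1, hC.symm h⟩
    · exact .inr ⟨y, x, h2, h1, hD.symm h⟩
  trans := by
    rintro z₁ z₂ z₃ (⟨x, y, h1, h2, h⟩ | ⟨x, y, h1, h2, h⟩) (⟨x', y', h1', h2', h'⟩ | ⟨x', y', h1', h2', h'⟩)
    · exact .inl ⟨x, y', h1, h2',
        hC.trans (hC.congr h (HenkinTheory.eqv_pair.1 (h2.symm.trans h1')).2) h'⟩
    · exact (HenkinTheory.not_eqv_pair_zero_one h2 h1').elim
    · exact (HenkinTheory.not_eqv_pair_zero_one h1' h2).elim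
    · exact .inr ⟨x, y', h1, h2',
        hD.trans (hD.congr h (HenkinTheory.eqv_pair.1 (h2.symm.trans h1')).2) h'⟩
  congr := by
    rintro z₁ z₂ z₃ (⟨x, y, h1, h2, h⟩ | ⟨x, y, h1, h2, h⟩) h'
    · exact .inl ⟨x, y, h1, h'.symm.trans h2, h⟩
    · exact .inr ⟨x, y, h1, h'.symm.trans h2, h⟩

namespace HenkinTheory
variable {T : HenkinTheory A} {K : M} {e i j J : Gen A M}

theorem eqv_of_sel {φ ψ : Gen A M} (h : T.Eqv (i.sel φ) (i.sel ψ)) (hφ : T.Eqv (i.sel φ) φ)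
    (hψ : T.Eqv (i.sel ψ) ψ) : T.Eqv φ ψ := hφ.symm.trans (h.trans hψ)

/-- An integer is coded by the index `z` alone, so `j` may be taken to be `0`; the diagonal argument
then gives `i ≤ 0`. -/
theorem not_countable_value (he : T.Codes K e)
    (hK : ∀ z t, z ∈ₘ omega M → t ∈ₘ A.Lam → pair z t ∈ₘ K) (hi : ∀ᶠ ω in T.filter, i ω ∈ₘ two M)
    (hi0 : ¬ T.Eqv i (Gen.const (zero M)))
    (h : ∃ f, (T.ind (Gen.const A.nat)).IsFun T (T.value (pow K) e i) f ∧
      (T.ind (Gen.const A.nat)).IsOnto T (T.value (pow K) e i) f) : False := by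
  let X : Gen A M := e.map (familyInd A (pow K))
  obtain ⟨j, rfl, hj⟩ := exists_le_of_surj (fun _ => Cls.ofInd A.nat)
    (fun y : ((PUnit.{u + 1} × M) × M) × M => Cls.valueAt y.1.1.2 y.2) (fun _ z _ => z)
    (fun y v => codeReal A y.1.2 (sel y.2 v)) (fun y => y.2)
    ((((Gen.const PUnit.unit).prod X).prod e).prod i) hK cls_map_ofInd
    (cls_valueAt.trans (valueAt_familyInd hi)) (ind_isSetoid _) value_isSetoid (fun z _ => z)
    (fun v => e.codeReal (i.sel v)) i (fun _ _ => rfl) (fun _ => rfl) rfl hi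
    (fun v hv => ⟨v, hv, real_of_eqv (.refl _)⟩)
    (fun v v' hv hv' h1 h2 h => eqv_of_sel
      ((he.eqv_iff (eventually_sel_mem_pow hv) (eventually_sel_mem_pow hv')).1 h) h1 h2)
    (fun j => j = Gen.const (zero M))
    (fun n hn => ⟨n, _, n, Nat.mem_omega hn, rfl, hn, .refl _⟩) h
  refine hi0 (hj.symm.trans (.of_forall fun ω => ?_))
  exact meet_of_ne_right one_ne_zero.symm

/-- Each element of the union is `code (jφ)` for some `j ε J`. The index `z` plays no role and is
set to `0`. -/
theorem exists_le_of_unionOver_surj (he : T.Codes K e)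
    (hK : ∀ z t, z ∈ₘ omega M → t ∈ₘ A.Lam → pair z t ∈ₘ K) (hi : ∀ᶠ ω in T.filter, i ω ∈ₘ two M)
    (hJ : ∀ j, T.Eps j J → ∀ᶠ ω in T.filter, j ω ∈ₘ two M)
    (h : ∃ f, (T.unionOver (e.map (familyInd A (pow K))) J).IsFun T (T.value (pow K) e i) f ∧
      (T.unionOver (e.map (familyInd A (pow K))) J).IsOnto T (T.value (pow K) e i) f) :
    ∃ j, T.Eps j J ∧ T.Eqv (Gen.map₂ meet i j) i := by
  let X : Gen A M := e.map (familyInd A (pow K))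
  refine exists_le_of_surj
    (fun y : (((PUnit.{u + 1} × M) × M) × M) × M => Cls.unionOver y.1.1.1.2 y.2)
    (fun y => Cls.valueAt y.1.1.1.2 y.1.2) (fun y _ x => codeReal A y.1.1.2 x)
    (fun y v => codeReal A y.1.1.2 (sel y.1.2 v)) (fun y => y.1.2)
    (((((Gen.const PUnit.unit).prod X).prod e).prod i).prod J) hK cls_unionOver
    (cls_valueAt.trans (valueAt_familyInd hi)) (isSetoid_of_eqv rfl) value_isSetoid
    (fun _ x => e.codeReal x)
    (fun v => e.codeReal (i.sel v)) i (fun _ _ => rfl) (fun _ => rfl) rfl hi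
    (fun v hv => ⟨v, hv, real_of_eqv (.refl _)⟩)
    (fun v v' hv hv' h1 h2 h => eqv_of_sel
      ((he.eqv_iff (eventually_sel_mem_pow hv) (eventually_sel_mem_pow hv')).1 h) h1 h2)
    (fun j => T.Eps j J) (fun x hx => ?_) h
  obtain ⟨j, hj, hx⟩ := hx
  have hV := valueAt_familyInd (E := pow K) (e := e) (hJ j hj)
  have hx : (T.valueAt (e.map (familyInd A (pow K))) j).mem x := hx
  rw [hV] at hx
  obtain ⟨φ, hφ, hx⟩ := hx
  refine ⟨Gen.const (zero M), j, φ, .of_forall fun _ => zero_mem_omega, hj, ⟨j, hj, ?_⟩, hx⟩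
  change (T.valueAt (e.map (familyInd A (pow K))) j).mem _
  rw [hV]
  exact ⟨φ, hφ, real_of_eqv (.refl _)⟩

theorem le_of_value_surj (he : T.Codes K e)
    (hK : ∀ z t, z ∈ₘ omega M → t ∈ₘ A.Lam → pair z t ∈ₘ K) (hi : ∀ᶠ ω in T.filter, i ω ∈ₘ two M)
    (hj : ∀ᶠ ω in T.filter, j ω ∈ₘ two M)
    (h : ∃ f, (T.value (pow K) e j).IsFun T (T.value (pow K) e i) f ∧
      (T.value (pow K) e j).IsOnto T (T.value (pow K) e i) f) : T.Eqv (Gen.map₂ meet i j) i := by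
  let X : Gen A M := e.map (familyInd A (pow K))
  obtain ⟨j', rfl, hle⟩ := exists_le_of_surj
    (fun y : (((PUnit.{u + 1} × M) × M) × M) × M => Cls.valueAt y.1.1.1.2 y.2)
    (fun y => Cls.valueAt y.1.1.1.2 y.1.2) (fun y _ x => codeReal A y.1.1.2 x)
    (fun y v => codeReal A y.1.1.2 (sel y.1.2 v)) (fun y => y.1.2)
    (((((Gen.const PUnit.unit).prod X).prod e).prod i).prod j) hK
    (cls_valueAt.trans (valueAt_familyInd hj))
    (cls_valueAt.trans (valueAt_familyInd hi)) value_isSetoid value_isSetoid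
    (fun _ x => e.codeReal x)
    (fun v => e.codeReal (i.sel v)) i (fun _ _ => rfl) (fun _ => rfl) rfl hi
    (fun v hv => ⟨v, hv, real_of_eqv (.refl _)⟩)
    (fun v v' hv hv' h1 h2 h => eqv_of_sel
      ((he.eqv_iff (eventually_sel_mem_pow hv) (eventually_sel_mem_pow hv')).1 h) h1 h2)
    (fun j' => j' = j) (fun x ⟨φ, hφ, hx⟩ => ⟨Gen.const (zero M), j, φ,
      .of_forall fun _ => zero_mem_omega, rfl, ⟨φ, hφ, real_of_eqv (.refl _)⟩, hx⟩) h
  exact hle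

theorem eqv_zero_of_join_le (hj : ∀ᶠ ω in T.filter, j ω ∈ₘ two M)
    (hij : ∀ᶠ ω in T.filter, meet (i ω) (j ω) = zero M)
    (h : ∀ᶠ ω in T.filter, meet (join (i ω) (j ω)) (i ω) = join (i ω) (j ω)) :
    T.Eqv j (Gen.const (zero M)) := by
  filter_upwards [hj, hij, h] with ω hj hij h
  refine (mem_two.1 hj).resolve_right fun hj => ?_
  by_cases hi : i ω = one M
  · rw [hi, hj, meet_one_one] at hij
    exact one_ne_zero hij
  · rw [meet_of_ne_right hi, join_eq_one.2 (.inr hj)] at h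
    exact one_ne_zero h.symm

/-- The index `z` is the tag, `0` or `1`, of the summand. An element of the target is coded by a set
`v` with `(i ∨ j)v = v`, through `(code (iv), code (jv))`. The diagonal argument yields `i ∨ j ≤ i`
or `i ∨ j ≤ j`, so that `j = 0` or `i = 0` by disjointness. -/
theorem not_sum_surj_prod (he : T.Codes K e)
    (hK : ∀ z t, z ∈ₘ omega M → t ∈ₘ A.Lam → pair z t ∈ₘ K) (hi : ∀ᶠ ω in T.filter, i ω ∈ₘ two M)
    (hj : ∀ᶠ ω in T.filter, j ω ∈ₘ two M) (hi0 : ¬ T.Eqv i (Gen.const (zero M)))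
    (hj0 : ¬ T.Eqv j (Gen.const (zero M))) (hij : ∀ᶠ ω in T.filter, meet (i ω) (j ω) = zero M)
    (h : ∃ f, ((T.value (pow K) e i).sum T (T.value (pow K) e j)).IsFun T
        ((T.value (pow K) e i).prod T (T.value (pow K) e j)) f ∧
      ((T.value (pow K) e i).sum T (T.value (pow K) e j)).IsOnto T
        ((T.value (pow K) e i).prod T (T.value (pow K) e j)) f) : False := by
  let X : Gen A M := e.map (familyInd A (pow K))
  have hI : (T.value (pow K) e i).IsSetoid T := value_isSetoid
  have hJ : (T.value (pow K) e j).IsSetoid T := value_isSetoid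
  let g : Gen A ((((PUnit.{u + 1} × M) × M) × M) × M) :=
    ((((Gen.const PUnit.unit).prod X).prod e).prod i).prod j
  have hCi : T.cls (g.map fun y => Cls.valueAt y.1.1.1.2 y.1.2) = T.value (pow K) e i :=
    cls_valueAt.trans (valueAt_familyInd hi)
  have hCj : T.cls (g.map fun y => Cls.valueAt y.1.1.1.2 y.2) = T.value (pow K) e j :=
    cls_valueAt.trans (valueAt_familyInd hj)
  have hP : ∀ x, ((T.value (pow K) e i).sum T (T.value (pow K) e j)).mem x → ∃ z k x',
      (∀ᶠ ω in T.filter, z ω ∈ₘ omega M) ∧ (k = i ∨ k = j) ∧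
      ((T.value (pow K) e i).sum T (T.value (pow K) e j)).mem (Gen.pair z (e.codeReal (k.sel x'))) ∧
      ((T.value (pow K) e i).sum T (T.value (pow K) e j)).eqv x
        (Gen.pair z (e.codeReal (k.sel x'))) := by
    rintro x (⟨x', ⟨φ, hφ, hx'⟩, hx⟩ | ⟨x', ⟨φ, hφ, hx'⟩, hx⟩)
    · exact ⟨Gen.const (zero M), i, φ, .of_forall fun _ => zero_mem_omega, .inl rfl,
        .inl ⟨_, ⟨φ, hφ, real_of_eqv (.refl _)⟩, .refl _⟩, .inl ⟨_, _, hx, .refl _, hx'⟩⟩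
    · exact ⟨Gen.const (one M), j, φ, .of_forall fun _ => one_mem_omega, .inr rfl,
        .inr ⟨_, ⟨φ, hφ, real_of_eqv (.refl _)⟩, .refl _⟩, .inr ⟨_, _, hx, .refl _, hx'⟩⟩
  obtain ⟨k, hk, h⟩ := exists_le_of_surj
    (fun y : (((PUnit.{u + 1} × M) × M) × M) × M =>
      (Cls.valueAt y.1.1.1.2 y.1.2).sum (Cls.valueAt y.1.1.1.2 y.2))
    (fun y => (Cls.valueAt y.1.1.1.2 y.1.2).prod (Cls.valueAt y.1.1.1.2 y.2))
    (fun y z x => pair z (codeReal A y.1.1.2 x))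
    (fun y v => pair (codeReal A y.1.1.2 (sel y.1.2 v)) (codeReal A y.1.1.2 (sel y.2 v)))
    (fun y => join y.1.2 y.2) g hK (cls_map_sum.trans (by rw [hCi, hCj]))
    (cls_map_prod.trans (by rw [hCi, hCj])) (hI.sum hJ) (hI.prod hJ)
    (fun z x => Gen.pair z (e.codeReal x))
    (fun v => Gen.pair (e.codeReal (i.sel v)) (e.codeReal (j.sel v))) (Gen.map₂ join i j)
    (fun _ _ => rfl) (fun _ => rfl) rfl (.of_forall fun _ => join_mem_two _ _)
    (fun v hv => ⟨_, ⟨v, hv, real_of_eqv (.refl _)⟩, _, ⟨v, hv, real_of_eqv (.refl _)⟩, .refl _⟩)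
    (fun v v' hv hv' h1 h2 h => by
      rw [SCls.prod_eqv_iff hI hJ] at h
      refine eqv_of_sel ?_ h1 h2
      filter_upwards [(he.eqv_iff (eventually_sel_mem_pow hv) (eventually_sel_mem_pow hv')).1 h.1,
        (he.eqv_iff (eventually_sel_mem_pow hv) (eventually_sel_mem_pow hv')).1 h.2] with ω h1 h2
      exact sel_join_eq_iff.2 ⟨h1, h2⟩)
    (fun k => k = i ∨ k = j) hP h
  rcases hk with rfl | rfl
  · exact hj0 (eqv_zero_of_join_le hj hij h)
  · refine hi0 (eqv_zero_of_join_le (i := k) hi (hij.mono fun ω h => ?_) (h.mono fun ω h => ?_))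
    · rwa [meet_comm]
    · rw [join_comm]
      exact h

end HenkinTheory

end

/-! ### The enumerations deduced from an enumeration of the cardinal -/

noncomputable section
variable {M : Type u} [langSet.Structure M] [Nonempty M] {A : RealizabilityAlgebra M}
variable [hM : Fact (IsModelZFC M)]

open TV RealizabilityAlgebra

theorem mem_support {x : M} : x ∈ₘ A.support ↔ x ∈ₘ A.Lam ∨ x ∈ₘ A.Stk ∨ x ∈ₘ omega M := by
  obtain ⟨a, ha⟩ := exists_union A.Stk (omega M)
  obtain ⟨b, hb⟩ := exists_union A.Lam a
  exact mem_compr ⟨b, fun x => by rw [hb, ha]⟩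

/-- The predecessor. -/
def pred (x : M) : M := compr fun y => ∃ n, x = succ n ∧ y ∈ₘ n

theorem mem_pred {x y : M} : y ∈ₘ pred x ↔ ∃ n, x = succ n ∧ y ∈ₘ n := by
  refine mem_compr_of_subset (sUnion x) ?_
  rintro y ⟨n, rfl, hy⟩
  exact mem_sUnion.2 ⟨n, mem_succ.2 (.inr rfl), hy⟩

theorem pred_succ (n : M) : pred (succ n) = n := by
  refine ext fun y => mem_pred.trans ⟨?_, fun h => ⟨n, rfl, h⟩⟩
  rintro ⟨m, h, hy⟩
  rwa [succ_inj h]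

instance {Y : Type*} [Ctx M Y] {t : Y → M} [ht : DefFun t] : DefFun fun y => pred (t y) := by
  have : DefFun fun p : (Y × M) × M => t p.1.1 := ht.comp _
  exact .of_mem (P := fun y x => ∃ n, t y = succ n ∧ x ∈ₘ n) fun y x => mem_pred

theorem GroundModel.Equipotent.exists_onto {a b : M} (h : Equipotent a b) : ∃ s : M → M, DefFun₁ s ∧
    ∀ y, y ∈ₘ b → ∃ x, x ∈ₘ a ∧ s x = y := by
  classical
  obtain ⟨G, h1, h2⟩ := h
  refine ⟨fun x => if h : ∃ y, x ∈ₘ a ∧ y ∈ₘ b ∧ pair x y ∈ₘ G then h.choose else zero M, ?_,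
    fun y hy => ?_⟩
  · refine .of_pred (P := fun (p : PUnit.{u + 1} × M) y => (p.2 ∈ₘ a ∧ y ∈ₘ b ∧ pair p.2 y ∈ₘ G) ∨
      (¬ ∃ y, p.2 ∈ₘ a ∧ y ∈ₘ b ∧ pair p.2 y ∈ₘ G) ∧ y = zero M) fun p y => ?_
    by_cases h : ∃ y, p.2 ∈ₘ a ∧ y ∈ₘ b ∧ pair p.2 y ∈ₘ G
    · simp only [h, not_true_eq_false, false_and, or_false]
      refine ⟨fun h' => h' ▸ h.choose_spec, fun h' => ?_⟩
      exact (h1 p.2 h'.1).unique h'.2 h.choose_spec.2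
    · simp only [h, not_false_eq_true, true_and]
      exact ⟨.inr, fun h' => h'.resolve_left fun h' => h ⟨y, h'⟩⟩
  · obtain ⟨x, ⟨hx, hxy⟩, -⟩ := h2 y hy
    have h : ∃ y, x ∈ₘ a ∧ y ∈ₘ b ∧ pair x y ∈ₘ G := ⟨y, hx, hy, hxy⟩
    refine ⟨x, hx, ?_⟩
    simp only [dif_pos h]
    exact (h1 x hx).unique h.choose_spec.2 ⟨hy, hxy⟩

namespace HenkinTheory
variable {T : HenkinTheory A} {κ : M} {f : Gen A M}

/-- The part of the graph `f` that lies in the product of the integers and of `ℷκ`. -/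
def graphPart (A : RealizabilityAlgebra M) (κ f : M) : M :=
  sepInd (fun z => ((z ε' f) ⩓ (fst z ε' A.nat) : TV A)) (A.gimel (times (omega M) κ))

theorem eps_graphPart {w : Gen A M} : T.Eps w (f.map (graphPart A κ)) ↔
    (T.Eps w f ∧ T.Nat (w.map fst)) ∧ ∀ᶠ ω in T.filter, w ω ∈ₘ times (omega M) κ := by
  refine (T.holds_eps_sepInd (F := fun (y : PUnit.{u + 1} × M) z =>
    ((z ε' y.2) ⩓ (fst z ε' A.nat) : TV A)) (fun ω => (PUnit.unit, f ω)) w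
    (fun _ => A.gimel (times (omega M) κ))).trans (and_congr T.holds_and (T.holds_eps_gimel _ _))

/-- The enumeration of `ℷκ` is composed with `s`. The relation `f` may contain pairs outside of `ℕ ×
ℷκ`, on which it need not be functional, so it is first cut down to `graphPart`. -/
theorem countable_of_onto {Z : M} (s : M → M) [hs : DefFun₁ s] (hsZ : ∀ x, s x ∈ₘ Z)
    (hZ : ∀ y, y ∈ₘ Z → ∃ x, x ∈ₘ κ ∧ s x = y)
    (hf : (T.ind (Gen.const A.nat)).IsFun T (T.ind (Gen.const (A.gimel κ))) f)
    (hf' : (T.ind (Gen.const A.nat)).IsOnto T (T.ind (Gen.const (A.gimel κ))) f) :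
    ∃ f, (T.ind (Gen.const A.nat)).IsFun T (T.ind (Gen.const (A.gimel Z))) f ∧
      (T.ind (Gen.const A.nat)).IsOnto T (T.ind (Gen.const (A.gimel Z))) f := by
  have hκ : ∀ w, T.Eps w (Gen.const (A.gimel κ)) ↔ ∀ᶠ ω in T.filter, w ω ∈ₘ κ :=
    fun w => eps_gimel_iff (a := Gen.const κ)
  have hZ' : ∀ w, T.Eps w (Gen.const (A.gimel Z)) ↔ ∀ᶠ ω in T.filter, w ω ∈ₘ Z :=
    fun w => eps_gimel_iff (a := Gen.const Z)
  have : DefFun fun p : PUnit.{u + 1} × M => s (snd p.2) := DefFun₁.comp hs _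
  obtain ⟨f', hg⟩ := exists_isGraph (fun (_ : PUnit.{u + 1}) w => fst w) (fun _ w => s (snd w))
    (Gen.const PUnit.unit) (f.map (graphPart A κ)) (fun w => w.map fst)
    (fun w => w.map fun w => s (snd w)) (fun _ => rfl) (fun _ => rfl)
    (ind_isSetoid (T := T) (Gen.const A.nat)) (ind_isSetoid (Gen.const (A.gimel Z)))
  have hpair : ∀ n a : Gen A M, T.Nat n → (∀ᶠ ω in T.filter, a ω ∈ₘ κ) → T.Eps (n.pair a) f →
      T.Eps (n.pair a) (f.map (graphPart A κ)) := fun n a hn ha h => by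
    refine eps_graphPart.2 ⟨⟨h, hn.congr (.of_forall fun ω => (fst_pair _ _).symm)⟩, ?_⟩
    filter_upwards [hn.mem_omega, ha] with ω h1 h2 using pair_mem_times.2 ⟨h1, h2⟩
  refine ⟨f', hg.isFun (ind_isSetoid _) (ind_isSetoid _) (fun n hn => ?_) (fun w w' hw hw' h => ?_),
    hg.isOnto (ind_isSetoid _) fun y hy => ?_⟩
  · obtain ⟨a, ha, h⟩ := hf.1 n hn
    exact ⟨_, hpair n a hn ((hκ a).1 ha) (ind_rel.1 h), .of_forall fun ω => (fst_pair _ _).symm,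
      (hZ' _).2 (.of_forall fun _ => hsZ _)⟩
  · have key : ∀ w : Gen A M, T.Eps w (f.map (graphPart A κ)) → T.Nat (w.map fst) ∧
        T.Eps (w.map snd) (Gen.const (A.gimel κ)) ∧ T.Eps (Gen.pair (w.map fst) (w.map snd)) f := by
      intro w hw
      obtain ⟨⟨h1, h2⟩, h3⟩ := eps_graphPart.1 hw
      refine ⟨h2, (hκ _).2 (h3.mono fun ω h => ?_), h1.congr (h3.mono fun ω h => ?_) (.refl _)⟩
      · obtain ⟨n, -, a, ha, h⟩ := mem_times.1 h
        change snd (w ω) ∈ₘ κ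
        rwa [h, snd_pair]
      · obtain ⟨n, -, a, -, h⟩ := mem_times.1 h
        change w ω = pair (fst (w ω)) (snd (w ω))
        rw [h, fst_pair, snd_pair]
    obtain ⟨h1, h2, h3⟩ := key w hw
    obtain ⟨h1', h2', h3'⟩ := key w' hw'
    have := hf.2 _ h1 _ h2 _ h2' (ind_rel.2 h3)
      (ind_rel.2 (h3'.congr (eqv_pair.2 ⟨Eqv.symm h, .refl _⟩) (.refl _)))
    exact Filter.Eventually.mono this fun ω h => congrArg s h
  · classical
    let r : M → M := fun y => if h : ∃ x, x ∈ₘ κ ∧ s x = y then h.choose else zero M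
    have hr : ∀ y, y ∈ₘ Z → r y ∈ₘ κ ∧ s (r y) = y := fun y hy => by
      have h := hZ y hy
      simp only [r, dif_pos h]
      exact h.choose_spec
    have hy := (hZ' y).1 hy
    have hr' : ∀ᶠ ω in T.filter, y.map r ω ∈ₘ κ := hy.mono fun ω h => (hr _ h).1
    obtain ⟨n, hn, h⟩ := hf' (y.map r) ((hκ _).2 hr')
    refine ⟨n.pair (y.map r), hpair n _ hn hr' (ind_rel.1 h), hy.mono fun ω h => ?_,
      Nat.congr hn (.of_forall fun ω => (fst_pair _ _).symm)⟩
    change y ω = s (snd (pair (n ω) (r (y ω))))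
    rw [snd_pair, (hr _ h).2]

theorem exists_codes (hκ : Equipotent κ A.support)
    (hf : (T.ind (Gen.const A.nat)).IsFun T (T.ind (Gen.const (A.gimel κ))) f)
    (hf' : (T.ind (Gen.const A.nat)).IsOnto T (T.ind (Gen.const (A.gimel κ))) f) :
    ∃ e, T.Codes (times (omega M) A.support) e := by
  classical
  obtain ⟨s, hs, hs'⟩ := hκ.exists_onto
  obtain ⟨Z, hZ⟩ := exists_union (times (omega M) A.support) (upair (zero M) (zero M))
  -- `s` maps `κ` onto the support, which contains `ω`. The value `s a = 0` is reserved for the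
  -- extra point `0`, and `s a = n + 1` stands for the first component `n`.
  let t : M → M → M := fun a b => if s a = zero M then zero M else pair (pred (s a)) (s b)
  have ht : DefFun₂ t := by
    have : DefFun fun p : (PUnit.{u + 1} × M) × M => s p.1.2 := DefFun₁.comp hs _
    have : DefFun fun p : (PUnit.{u + 1} × M) × M => s p.2 := DefFun₁.comp hs _
    have : DefFun fun p : (PUnit.{u + 1} × M) × M =>
      if s p.1.2 = zero M then zero M else pair (pred (s p.1.2)) (s p.2) := inferInstance
    exact this
  have hZt : ∀ z, z ∈ₘ Z → ∃ a b, a ∈ₘ κ ∧ b ∈ₘ κ ∧ z = t a b := by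
    intro z hz
    rw [hZ, mem_upair, or_self] at hz
    obtain hz | rfl := hz
    · obtain ⟨n, hn, u, hu, rfl⟩ := mem_times.1 hz
      obtain ⟨a, ha, h⟩ := hs' (succ n) (mem_support.2 (.inr (.inr (succ_mem_omega hn))))
      obtain ⟨b, hb, h'⟩ := hs' u hu
      refine ⟨a, b, ha, hb, ?_⟩
      simp only [t]
      rw [h, h', if_neg (succ_ne_zero n), pred_succ]
    · obtain ⟨a, ha, h⟩ := hs' (zero M) (mem_support.2 (.inr (.inr zero_mem_omega)))
      exact ⟨a, a, ha, ha, (if_pos h).symm⟩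
  obtain ⟨e, he⟩ := exists_enumerates t hZt hf hf'
  refine ⟨e, fun h => ?_, Z, fun z => by rw [hZ, mem_upair, or_self], he⟩
  obtain ⟨x, -, y, -, h⟩ := mem_times.1 h
  exact pair_ne_zero x y h.symm

theorem gimel_two_countable (hκ : Equipotent κ A.support)
    (hf : (T.ind (Gen.const A.nat)).IsFun T (T.ind (Gen.const (A.gimel κ))) f)
    (hf' : (T.ind (Gen.const A.nat)).IsOnto T (T.ind (Gen.const (A.gimel κ))) f) :
    ∃ f, (T.ind (Gen.const A.nat)).IsFun T (T.ind (Gen.const (A.gimel (two M)))) f ∧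
      (T.ind (Gen.const A.nat)).IsOnto T (T.ind (Gen.const (A.gimel (two M)))) f := by
  classical
  obtain ⟨s, hs, hs'⟩ := hκ.exists_onto
  have : DefFun₁ fun x => if s x = one M then one M else zero M := by
    have : DefFun fun p : PUnit.{u + 1} × M => s p.2 := hs
    have : DefFun fun p : PUnit.{u + 1} × M => if s p.2 = one M then one M else zero M :=
      inferInstance
    exact this
  refine countable_of_onto (κ := κ) (fun x => if s x = one M then one M else zero M) (fun x => ?_)
    (fun y hy => ?_) hf hf'
  · split_ifs <;> simp [mem_two]
  · rcases mem_two.1 hy with rfl | rfl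
    · obtain ⟨a, ha, h⟩ := hs' (zero M) (mem_support.2 (.inr (.inr zero_mem_omega)))
      have hne : s a ≠ one M := fun h' => GroundModel.one_ne_zero (h'.symm.trans h)
      exact ⟨a, ha, if_neg hne⟩
    · obtain ⟨a, ha, h⟩ := hs' (one M) (mem_support.2 (.inr (.inr one_mem_omega)))
      exact ⟨a, ha, if_pos h⟩

end HenkinTheory

end

/-! ### Assembling the theorem -/

noncomputable section
variable {M : Type u} [langSet.Structure M] [Nonempty M] {A : RealizabilityAlgebra M}
variable [hM : Fact (IsModelZFC M)]

open TV RealizabilityAlgebra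

namespace HenkinTheory
variable {T : HenkinTheory A} {Y : Type*} {g : Gen A Y}

variable (T) in
/-- Interpretation of `Cls.realSubset`. -/
def realSubset (S : Gen A M) : SCls A where
  mem x := ∃ y, T.Eps y S ∧ T.reals.eqv y x
  eqv := T.reals.eqv

theorem cls_realSubset {S : Y → M} :
    T.cls (g.map fun y => Cls.realSubset (S y)) = T.realSubset (g.map S) := by
  refine T.cls_ext (fun x => ?_) fun x y => ?_
  · change T.Sat (fun p : Y × M => (Cls.realSubset (S p.1)).mem p.2) (g.prod x) ↔ _
    simp only [Cls.realSubset, sat_ex, sat_and, sat_eps, sat_eqv, cls_real]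
    rfl
  · change T.Sat (fun p : M × M => (Cls.real A).eqv p.1 p.2) (x.prod y) ↔ _
    rw [sat_eqv, cls_real]
    rfl

end HenkinTheory

end

open TV in
theorem mainTheorem7 {M : Type u} [langSet.Structure M] [Nonempty M] (hM : IsModelZFC M)
    (A : RealizabilityAlgebra M) (hA : A.Coherent) (κ : M) (hκ : IsCardinalOf κ A.support) :
    A.Realizes
      ((Cls.ofInd (A.gimel κ)).countable ⇾
        (Cls.ofInd (A.gimel (two M))).countable ⩓
        TV.ex fun X =>
          -- a map from `ℷ2` into `𝒫(ℝ)`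
          Cls.isFamily (A.gimel (two M)) X ⩓
          -- i) the only element of `X_0` is `∅`
          (TV.all fun x => iff ((Cls.valueAt X (zero M)).mem x) ((Cls.real A).eqv x (zero M))) ⩓
          ((Cls.ofInd (A.gimel (two M))).all fun i => neg (i ≐ zero M) ⇾
            (Cls.valueAt X i).infinite ⩓ neg (Cls.valueAt X i).countable) ⩓
          -- ii)
          ((Cls.ofInd (A.gimel (two M))).all fun i =>
            ((Cls.valueAt X i).prod (Cls.valueAt X i)).equip (Cls.valueAt X i)) ⩓
          -- iii)
          ((Cls.ofInd (A.gimel (two M))).all fun i => (Cls.ofInd (A.gimel (two M))).all fun j =>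
            TV.all fun x => iff ((Cls.valueAt X i).mem x ⩓ (Cls.valueAt X j).mem x)
              ((Cls.valueAt X (meet i j)).mem x)) ⩓
          ((Cls.ofInd (A.gimel (two M))).all fun i => (Cls.ofInd (A.gimel (two M))).all fun j =>
            TV.le i j ⇾ TV.all fun x => (Cls.valueAt X i).mem x ⇾ (Cls.valueAt X j).mem x) ⩓
          -- iv)
          ((Cls.ofInd (A.gimel (two M))).all fun i => (Cls.ofInd (A.gimel (two M))).all fun j =>
            meet i j ≐ zero M ⇾
              (Cls.valueAt X (join i j)).equip ((Cls.valueAt X i).prod (Cls.valueAt X j))) ⩓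
          -- v)
          (Cls.valueAt X (one M)).surj (Cls.real A) ⩓
          -- vi)
          (TV.all fun J => (TV.all fun j => j ε' J ⇾ j ε' A.gimel (two M)) ⇾
            (Cls.ofInd (A.gimel (two M))).all fun i =>
              (Cls.unionOver X J).surj (Cls.valueAt X i) ⇾ TV.ex fun j => j ε' J ⩓ TV.le i j) ⩓
          -- vii)
          ((Cls.ofInd (A.gimel (two M))).all fun i => (Cls.ofInd (A.gimel (two M))).all fun j =>
            (Cls.valueAt X j).surj (Cls.valueAt X i) ⇾ TV.le i j) ⩓
          -- viii)
          ((Cls.ofInd (A.gimel (two M))).all fun i => (Cls.ofInd (A.gimel (two M))).all fun j =>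
            neg (i ≐ zero M) ⇾ neg (j ≐ zero M) ⇾ meet i j ≐ zero M ⇾
              neg (((Cls.valueAt X i).sum (Cls.valueAt X j)).surj
                ((Cls.valueAt X i).prod (Cls.valueAt X j))))) := by
  have := Fact.mk hM
  refine realizes_of_forall_henkinTheory fun T => ?_
  change T.Sat (fun _ : PUnit.{u + 1} => _) (Gen.const PUnit.unit)
  -- The formula is translated connective by connective into a statement about generic individuals
  -- of `T`.
  simp only [Cls.countable, Cls.infinite, Cls.isFamily, Cls.all, TV.le, HenkinTheory.sat_imp,
    HenkinTheory.sat_and, HenkinTheory.sat_ex, HenkinTheory.sat_all, HenkinTheory.sat_iff,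
    HenkinTheory.sat_neg, HenkinTheory.sat_surj, HenkinTheory.sat_inj, HenkinTheory.sat_equip,
    HenkinTheory.sat_mem, HenkinTheory.sat_eqv, HenkinTheory.sat_eps, HenkinTheory.sat_eq,
    HenkinTheory.cls_map_ofInd, HenkinTheory.cls_map_prod, HenkinTheory.cls_map_sum,
    HenkinTheory.cls_valueAt, HenkinTheory.cls_unionOver, HenkinTheory.cls_real,
    HenkinTheory.cls_realSubset]
  rintro ⟨f, hf, hf'⟩
  obtain ⟨e, he⟩ := HenkinTheory.exists_codes hκ.2.1 hf hf'
  let X : Gen A M := e.map (familyInd A (pow (times (omega M) A.support)))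
  have h2 : ∀ i, T.Eps i (Gen.const (A.gimel (two M))) → ∀ᶠ ω in T.filter, i ω ∈ₘ two M :=
    fun i => (HenkinTheory.eps_gimel_iff (a := Gen.const (two M))).1
  have hV : ∀ i : Gen A M, (∀ᶠ ω in T.filter, i ω ∈ₘ two M) →
      T.valueAt X i = T.value (pow (times (omega M) A.support)) e i :=
    fun i => HenkinTheory.valueAt_familyInd
  have hK : ∀ z t, z ∈ₘ omega M → t ∈ₘ A.Lam → pair z t ∈ₘ times (omega M) A.support :=
    fun z t hz ht => pair_mem_times.2 ⟨hz, mem_support.2 (.inl ht)⟩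
  have h0 : ∀ᶠ ω in T.filter, Gen.const (A := A) (zero M) ω ∈ₘ two M :=
    .of_forall fun _ => mem_two.2 (.inl rfl)
  have h1 : ∀ᶠ ω in T.filter, Gen.const (A := A) (one M) ω ∈ₘ two M :=
    .of_forall fun _ => mem_two.2 (.inr rfl)
  have hmeet : ∀ i j : Gen A M, ∀ᶠ ω in T.filter, Gen.map₂ meet i j ω ∈ₘ two M :=
    fun i j => .of_forall fun ω => meet_mem_two (i ω) (j ω)
  refine ⟨HenkinTheory.gimel_two_countable hκ.2.1 hf hf', X, fun i hi => ⟨?_, ?_, ?_⟩, fun x => ?_,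
    fun i hi hi0 => ⟨?_, fun h => ?_⟩, fun i hi => ?_, fun i hi j hj x => ?_,
    fun i hi j hj hij x => ?_, fun i hi j hj hij => ?_, ?_, fun J hJ i hi h => ?_,
    fun i hi j hj h => ?_, fun i hi j hj hi0 hj0 hij h => ?_⟩
  · exact ⟨_, HenkinTheory.eps_familyInd.2 ⟨h2 i hi, .refl _⟩⟩
  · intro S hS x hx
    obtain ⟨φ, -, hφ⟩ := HenkinTheory.eps_valueInd.1
      (HenkinTheory.Eps.congr hx (.refl _) (HenkinTheory.eps_familyInd.1 hS).2)
    exact fun n hn => (HenkinTheory.eps_codeReal.1 (HenkinTheory.Eps.congr hn (.refl _) hφ)).1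
  · intro S S' hS hS' x
    have h := (HenkinTheory.eps_familyInd.1 hS).2.trans (HenkinTheory.eps_familyInd.1 hS').2.symm
    exact exists_congr fun y => and_congr_left fun _ =>
      ⟨fun hy => HenkinTheory.Eps.congr hy (.refl _) h,
        fun hy => HenkinTheory.Eps.congr hy (.refl _) h.symm⟩
  · change (T.valueAt X (Gen.const (zero M))).mem x ↔ T.reals.eqv x (Gen.const (zero M))
    rw [hV _ h0]
    exact HenkinTheory.value_zero
  · have h := HenkinTheory.infinite_value he (mem_support.2 (.inr (.inr zero_mem_omega))) (h2 i hi) hi0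
    rwa [← hV _ (h2 i hi)] at h
  · refine HenkinTheory.not_countable_value he hK (h2 i hi) hi0 ?_
    rwa [← hV _ (h2 i hi)]
  · have h := HenkinTheory.square_equip_value (i := i) he
    rwa [← hV _ (h2 i hi)] at h
  · have h := HenkinTheory.value_inter (i := i) (j := j) (x := x) he
    rwa [← hV _ (h2 i hi), ← hV _ (h2 j hj), ← hV _ (hmeet i j)] at h
  -- `i ≤ j` gives `X_i = X_{i ∧ j} = X_i ∩ X_j`.
  · intro hx
    have h := (HenkinTheory.value_inter (i := i) (j := j) (x := x) he).2
    rw [HenkinTheory.value_congr (i := Gen.map₂ meet i j) (j := i) hij, ← hV _ (h2 i hi), ← hV _ (h2 j hj)] at h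
    exact (h hx).2
  · have h := HenkinTheory.value_join_equip (i := i) (j := j) he hij
    rwa [← hV _ (h2 i hi), ← hV _ (h2 j hj),
      ← hV _ (.of_forall fun ω => join_mem_two (i ω) (j ω))] at h
  · have h := HenkinTheory.value_one_surj he fun p hp => mem_support.2 (.inr (.inl hp))
    rwa [← hV _ h1] at h
  · refine HenkinTheory.exists_le_of_unionOver_surj he hK (h2 i hi) (fun j hj => h2 j (hJ j hj)) ?_
    rwa [← hV _ (h2 i hi)]
  · refine HenkinTheory.le_of_value_surj he hK (h2 i hi) (h2 j hj) ?_
    rwa [← hV _ (h2 i hi), ← hV _ (h2 j hj)]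
  · refine HenkinTheory.not_sum_surj_prod he hK (h2 i hi) (h2 j hj) hi0 hj0 hij ?_
    rwa [← hV _ (h2 i hi), ← hV _ (h2 j hj)]
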